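/- **Setting.** Let $I=[0,2\pi)$, and let $L_2(I^2)$ be the complex Hilbert space with inner product $\langle\cdot,\cdot\rangle$ and norm $\|\cdot\|$. For $\mathbf k\in\mathbb Z^2$ put $e_{\mathbf k}(\boldsymbol\theta)=\frac1{2\pi}e^{i(k_0\theta_0+k_1\theta_1)}$ and $\hat\varphi_{\mathbf k}=\int_{I^2}\varphi\,e_{-\mathbf k}$. For an integer $p\ge 1$, $H_p$ is the space of $\varphi\in L_2(I^2)$ with $\|\varphi\|_{H_p}^2:=\sum_{\mathbf k\in\mathbb Z^2}(1+\|\mathbf k\|_2^2)^p|\hat\varphi_{\mathbf k}|^2<\infty$. Let $\Gamma=(\gamma_0,\gamma_1,\gamma_2):\mathbb R^2\to\mathbb R^3$ be $2\pi$-periodic in each variable, and assume: * **(A1)** there is $C_0>0$ with $\|\Gamma(\boldsymbol\theta)-\Gamma(\boldsymbol\eta)\|_2\ge C_0\,\zeta(\boldsymbol\theta-\boldsymbol\eta)$ for all $\boldsymbol\theta,\boldsymbol\eta\in I^2$, where $\zeta(\boldsymbol\theta)=\big(\sum_{\iota=0}^1\operatorname{dist}(\theta_\iota,2\pi\mathbb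 Z)^2\big)^{1/2}$; * **(A2)** there is $R_0>0$ such that each $\gamma_j$ extends to a function, again denoted $\gamma_j$, that is analytic on a neighbourhood of $\overline{W(R_0)^2}$, where $W(R_0)=\{z\in\mathbb C:|\operatorname{Im}z|<R_0\}$. Let $M_{0,j}=\sup_{\mathbf z\in W(R_0)^2}\|D\gamma_j(\mathbf z)+D\gamma_j(\operatorname{Re}\mathbf z)\|_2$ and $M_{1,j}=\sup_{\mathbf z\in W(R_0)^2}\|\mathbf H_j(\mathbf z)\|_2$, where $D\gamma_j$ is the complex gradient and $\mathbf H_j$ the complex Hessian matrix of $\gamma_j$ (with the spectral norm). Let $M_0=(\sum_jM_{0,j}^2)^{1/2}$ and $M_1=(\sum_jM_{1,j}^2)^{1/2}$. Let $\mathcal K$ be the operator $(\mathcal K\varphi)(\boldsymbol\theta)=\int_{I^2}K(\boldsymbol\theta,\boldsymbol\eta)\varphi(\boldsymbol\eta)\,d\boldsymbol\eta$ with $$K(\boldsymbol\theta,\boldsymbol\eta)=-\frac1{2\pi}\,\frac{(\Gamma(\boldsymbol\theta)-\Gamma(\boldsymbol\eta))\cdot\big(\frac{\partial\Gamma}{\partial\eta_0}\times\frac{\partial\Gamma}{\partial\eta_1}\big)(\boldsymbol\eta)}{\|\Gamma(\boldsymbol\theta)-\Gamma(\boldsymbol\eta)\|_2^3}.$$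 For $n\in\mathbb N$ put $N=(2n+1)^2$, let $X_n=\operatorname{span}\{e_{\mathbf k}:\mathbf k\in\{-n,\dots,n\}^2\}$, and let $\mathcal P_n$ be the orthogonal projection of $L_2(I^2)$ onto $X_n$. For $q>0$ and $\mathbf k,\mathbf l\in\{-n,\dots,n\}^2$ let $\widetilde K_{\mathbf k,\mathbf l}=\langle\mathcal K e_{\mathbf l},e_{\mathbf k}\rangle$ if $\|\mathbf k-\mathbf l\|_1\le q\ln N$ and $\widetilde K_{\mathbf k,\mathbf l}=0$ otherwise. Let $\widetilde{\mathcal K}_n$ be the integral operator with kernel $\sum_{\mathbf k,\mathbf l\in\{-n,\dots,n\}^2}\widetilde K_{\mathbf k,\mathbf l}\,e_{\mathbf k}(\boldsymbol\theta)\,e_{-\mathbf l}(\boldsymbol\eta)$. Given $g$, the fast Fourier–Galerkin solution is $\tilde\rho_n\in X_n$ with $\tilde\rho_n-\widetilde{\mathcal K}_n\tilde\rho_n=\mathcal P_ng$. **Theorem.** Let $p\ge1$ be an integer and assume (A1) and (A2). Suppose that $\mathcal I-\mathcal K$ is injective on $L_2(I^2)$, that $$0<b<\min\Big\{\frac{C_0^2}{\sqrt2\,M_0M_1},\frac{R_0}2\Big\},$$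 and that $q>0$ satisfies $qb\ge p/2$. Then $\mathcal K$ is a well-defined map of $L_2(I^2)$ into itself (for every $\varphi\in L_2(I^2)$ the integral converges absolutely for almost every $\boldsymbol\theta$ and defines an element of $L_2(I^2)$), and there are a constant $c>0$ and an $n_0\in\mathbb N$, independent of $\varphi$ and $g$, such that: 1. for all $n\ge n_0$ and all $\varphi\in H_p$, $\ \|(\mathcal I-\widetilde{\mathcal K}_n)\mathcal P_n\varphi\|\ge c\,\|\mathcal P_n\varphi\|$; 2. for each $\varphi\in H_p$ there is $n_1$ (depending on $\varphi$) such that $\|(\mathcal I-\widetilde{\mathcal K}_n)\mathcal P_n\varphi\|\ge c\,\|\varphi\|$ for all $n\ge n_1$; 3. for every $g\in H_p$ the equation $(\mathcal I-\mathcal K)\rho=g$ has a unique solution $\rho\in L_2(I^2)$, this solution lies in $H_p$, and for all $n\ge n_0$ the fast solution $\tilde\rho_n$ exists, is unique, and satisfies $$\|\rho-\tilde\rho_n\|\le c\,N^{-p/2}\,\ln N\,\|\rho\|_{H_p}.$$ -/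

import Mathlib

open MeasureTheory Set

open scoped Matrix

noncomputable section

namespace FastFourierGalerkin

/-! ### The parameter square and its Fourier basis -/

/-- The square `[0, 2π)²`. -/
def square : Set (Fin 2 → ℝ) := Set.univ.pi fun _ => Set.Ico 0 (2 * Real.pi)

/-- Lebesgue measure on the square `[0, 2π)²`. -/
abbrev squareMeasure : Measure (Fin 2 → ℝ) := volume.restrict square

/-- The Hilbert space of complex square-integrable functions on `[0, 2π)²`. -/
abbrev L2Square : Type := Lp ℂ 2 squareMeasure

instance : IsFiniteMeasure squareMeasure := by
  refine ⟨?_⟩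
  rw [Measure.restrict_apply_univ, square, volume_pi_pi]
  simp [ENNReal.mul_lt_top_iff]

/-- `e_k(θ) = (2π)^{-1/2} e^{i k₀ θ₀} · (2π)^{-1/2} e^{i k₁ θ₁}`. -/
def fourierFun (k : Fin 2 → ℤ) (θ : Fin 2 → ℝ) : ℂ :=
  ∏ i, ((1 / Real.sqrt (2 * Real.pi) : ℝ) : ℂ) * Complex.exp (Complex.I * (k i : ℂ) * (θ i : ℂ))

theorem continuous_fourierFun (k : Fin 2 → ℤ) : Continuous (fourierFun k) := by
  unfold fourierFun
  fun_prop

theorem norm_fourierFun (k : Fin 2 → ℤ) (θ : Fin 2 → ℝ) :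
    ‖fourierFun k θ‖ = ∏ _i : Fin 2, (1 / Real.sqrt (2 * Real.pi)) := by
  unfold fourierFun
  rw [norm_prod]
  refine Finset.prod_congr rfl fun i _ => ?_
  have h : Complex.I * (k i : ℂ) * (θ i : ℂ) = (((k i : ℝ) * θ i : ℝ) : ℂ) * Complex.I := by
    push_cast
    ring
  rw [norm_mul, h, Complex.norm_exp_ofReal_mul_I, mul_one, Complex.norm_real, Real.norm_eq_abs,
    abs_of_nonneg (by positivity)]

theorem conj_fourierFun (k : Fin 2 → ℤ) (θ : Fin 2 → ℝ) :
    (starRingEnd ℂ) (fourierFun k θ) = fourierFun (-k) θ := by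
  unfold fourierFun
  rw [map_prod]
  refine Finset.prod_congr rfl fun i _ => ?_
  rw [map_mul, ← Complex.exp_conj]
  simp

theorem memLp_fourierFun (k : Fin 2 → ℤ) : MemLp (fourierFun k) 2 squareMeasure :=
  MemLp.of_bound (continuous_fourierFun k).aestronglyMeasurable _
    (Filter.Eventually.of_forall fun θ => (norm_fourierFun k θ).le)

/-- `e_k` as an element of `L₂`. -/
def fourierL2 (k : Fin 2 → ℤ) : L2Square := (memLp_fourierFun k).toLp (fourierFun k)

/-- The Fourier coefficient `∫ φ e_{-k}`. -/
def fourierCoef (k : Fin 2 → ℤ) (φ : L2Square) : ℂ :=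
  ∫ θ, φ θ * fourierFun (-k) θ ∂squareMeasure

/-- The summand `(1 + ‖k‖₂²)^p |φ̂_k|²` of the squared Sobolev norm of order `p`. -/
def sobolevTerm (p : ℕ) (φ : L2Square) (k : Fin 2 → ℤ) : ℝ :=
  (1 + ∑ i, (k i : ℝ) ^ 2) ^ p * ‖fourierCoef k φ‖ ^ 2

/-- Membership in the periodic Sobolev space `H_p`. -/
def MemSobolev (p : ℕ) (φ : L2Square) : Prop := Summable (sobolevTerm p φ)

/-- The norm of `H_p`, meaningful for elements of `H_p`. -/
def sobolevNorm (p : ℕ) (φ : L2Square) : ℝ := Real.sqrt (∑' k, sobolevTerm p φ k)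

/-- The frequencies `k` with `-n ≤ k₀, k₁ ≤ n`. -/
def freqBox (n : ℕ) : Finset (Fin 2 → ℤ) := Fintype.piFinset fun _ => Finset.Icc (-(n : ℤ)) n

/-- The trial space `X_n`, spanned by the `e_k` with `k` in the box. -/
def trialSpace (n : ℕ) : Submodule ℂ L2Square :=
  Submodule.span ℂ (fourierL2 '' (freqBox n : Set (Fin 2 → ℤ)))

instance (n : ℕ) : FiniteDimensional ℂ (trialSpace n) :=
  FiniteDimensional.span_of_finite ℂ ((freqBox n).finite_toSet.image _)

/-- The orthogonal projection `P_n` of `L₂` onto `X_n`. -/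
def proj (n : ℕ) (φ : L2Square) : L2Square := (trialSpace n).starProjection φ

/-- The number of degrees of freedom `N = (2n+1)²`. -/
def dof (n : ℕ) : ℝ := (2 * (n : ℝ) + 1) ^ 2

/-! ### Integral operators on the square -/

/-- The function `θ ↦ ∫ κ(θ, η) φ(η) dη`. -/
def kernelIntegral (κ : (Fin 2 → ℝ) → (Fin 2 → ℝ) → ℂ) (φ : L2Square) (θ : Fin 2 → ℝ) : ℂ :=
  ∫ η, κ θ η * φ η ∂squareMeasure

open Classical in
/-- The integral operator with kernel `κ` as a map `L₂ → L₂`; an image function that is not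
square integrable is replaced by `0`. -/
def integralOp (κ : (Fin 2 → ℝ) → (Fin 2 → ℝ) → ℂ) (φ : L2Square) : L2Square :=
  if h : MemLp (kernelIntegral κ φ) 2 squareMeasure then h.toLp (kernelIntegral κ φ) else 0

/-! ### The surface and the double layer operator -/

/-- The distance from `t` to `2πℤ`, that is `min {t, 2π - t}` for `t` reduced to `[0, 2π)`. -/
def angleDist (t : ℝ) : ℝ :=
  min (toIcoMod Real.two_pi_pos 0 t) (2 * Real.pi - toIcoMod Real.two_pi_pos 0 t)

/-- `ζ(θ)`, extended `2π`-periodically in both variables. -/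
def zeta (θ : Fin 2 → ℝ) : ℝ := Real.sqrt (∑ i, angleDist (θ i) ^ 2)

/-- `Γ` is `2π`-periodic in both variables. -/
def Biperiodic (Γ : (Fin 2 → ℝ) → Fin 3 → ℝ) : Prop :=
  ∀ (θ : Fin 2 → ℝ) (i : Fin 2), Γ (θ + Pi.single i (2 * Real.pi)) = Γ θ

/-- Assumption (A1), with constant `C₀`. -/
def AssumptionA1 (Γ : (Fin 2 → ℝ) → Fin 3 → ℝ) (C₀ : ℝ) : Prop :=
  0 < C₀ ∧ ∀ θ ∈ square, ∀ η ∈ square, C₀ * zeta (θ - η) ≤ ‖WithLp.toLp 2 (Γ θ - Γ η)‖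

/-- `W(r)² = {z ∈ ℂ² : |Im z₀| < r, |Im z₁| < r}`. -/
def strip (r : ℝ) : Set (EuclideanSpace ℂ (Fin 2)) := {z | ∀ i, |(z i).im| < r}

/-- A real point as a point of `ℂ²`. -/
def realPoint (θ : Fin 2 → ℝ) : EuclideanSpace ℂ (Fin 2) := WithLp.toLp 2 fun i => (θ i : ℂ)

/-- The componentwise real part of a point of `ℂ²`, as a point of `ℂ²`. -/
def rePart (z : EuclideanSpace ℂ (Fin 2)) : EuclideanSpace ℂ (Fin 2) := realPoint fun i => (z i).re

/-- Assumption (A2), with radius `R₀`: the functions `γ j` are analytic on (a neighbourhood of)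
the closure of `W(R₀)²` and extend the components of `Γ`. -/
def AssumptionA2 (Γ : (Fin 2 → ℝ) → Fin 3 → ℝ) (R₀ : ℝ)
    (γ : Fin 3 → EuclideanSpace ℂ (Fin 2) → ℂ) : Prop :=
  0 < R₀ ∧ ∀ j, AnalyticOnNhd ℂ (γ j) (closure (strip R₀)) ∧
    ∀ θ : Fin 2 → ℝ, γ j (realPoint θ) = (Γ θ j : ℂ)

/-- `M_{0,j}` for `f = γ_j`. The norm is the operator norm of a linear form on Hermitian `ℂ²`,
which is the Euclidean norm of the row of its coefficients. -/
def M0comp (R₀ : ℝ) (f : EuclideanSpace ℂ (Fin 2) → ℂ) : ℝ :=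
  sSup ((fun z => ‖fderiv ℂ f z + fderiv ℂ f (rePart z)‖) '' strip R₀)

/-- `M_{1,j}` for `f = γ_j`. The norm is the operator norm of the second derivative, which is the
spectral norm of the Hessian matrix. -/
def M1comp (R₀ : ℝ) (f : EuclideanSpace ℂ (Fin 2) → ℂ) : ℝ :=
  sSup ((fun z => ‖fderiv ℂ (fderiv ℂ f) z‖) '' strip R₀)

/-- `M₀`. -/
def M0 (R₀ : ℝ) (γ : Fin 3 → EuclideanSpace ℂ (Fin 2) → ℂ) : ℝ :=
  Real.sqrt (∑ j, M0comp R₀ (γ j) ^ 2)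

/-- `M₁`. -/
def M1 (R₀ : ℝ) (γ : Fin 3 → EuclideanSpace ℂ (Fin 2) → ℂ) : ℝ :=
  Real.sqrt (∑ j, M1comp R₀ (γ j) ^ 2)

/-- The partial derivative `∂Γ/∂θ_i` at `η`. -/
def partialGamma (Γ : (Fin 2 → ℝ) → Fin 3 → ℝ) (i : Fin 2) (η : Fin 2 → ℝ) : Fin 3 → ℝ :=
  fun j => fderiv ℝ (fun θ => Γ θ j) η (Pi.single i 1)

/-- The double layer kernel `K(θ, η)`. -/
def kernelK (Γ : (Fin 2 → ℝ) → Fin 3 → ℝ) (θ η : Fin 2 → ℝ) : ℂ :=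
  ((-(1 / (2 * Real.pi)) *
    (((Γ θ - Γ η) ⬝ᵥ (crossProduct (partialGamma Γ 0 η) (partialGamma Γ 1 η))) /
      ‖WithLp.toLp 2 (Γ θ - Γ η)‖ ^ 3) : ℝ) : ℂ)

/-- The double layer operator `𝒦`. -/
def opK (Γ : (Fin 2 → ℝ) → Fin 3 → ℝ) (φ : L2Square) : L2Square := integralOp (kernelK Γ) φ

/-- The matrix entry `K_{k,l} = ⟨𝒦 e_l, e_k⟩`. Mathlib's inner product is linear in its second
argument. -/
def entryK (Γ : (Fin 2 → ℝ) → Fin 3 → ℝ) (k l : Fin 2 → ℤ) : ℂ :=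
  inner ℂ (fourierL2 k) (opK Γ (fourierL2 l))

open Classical in
/-- The truncated entry: `K_{k,l}` if `‖k - l‖₁ ≤ q ln N`, and `0` otherwise. -/
def truncEntry (Γ : (Fin 2 → ℝ) → Fin 3 → ℝ) (q : ℝ) (n : ℕ) (k l : Fin 2 → ℤ) : ℂ :=
  if ((∑ i, |k i - l i| : ℤ) : ℝ) ≤ q * Real.log (dof n) then entryK Γ k l else 0

/-- The kernel `∑_{k,l} K̃_{k,l} e_k(θ) e_{-l}(η)` of the truncated operator. -/
def truncKernel (Γ : (Fin 2 → ℝ) → Fin 3 → ℝ) (q : ℝ) (n : ℕ) (θ η : Fin 2 → ℝ) : ℂ :=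
  ∑ k ∈ freqBox n, ∑ l ∈ freqBox n, truncEntry Γ q n k l * fourierFun k θ * fourierFun (-l) η

/-- The truncated operator `𝒦̃_n`. -/
def truncOp (Γ : (Fin 2 → ℝ) → Fin 3 → ℝ) (q : ℝ) (n : ℕ) (φ : L2Square) : L2Square :=
  integralOp (truncKernel Γ q n) φ

/-- `ψ` is a solution of the fast Fourier–Galerkin equation with right-hand side `g`:
`ψ ∈ X_n` and `ψ - 𝒦̃_n ψ = P_n g`. -/
def IsFastSolution (Γ : (Fin 2 → ℝ) → Fin 3 → ℝ) (q : ℝ) (n : ℕ) (g ψ : L2Square) : Prop :=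
  ψ ∈ trialSpace n ∧ ψ - truncOp Γ q n ψ = proj n g

theorem fourierCoef_eq_inner (k : Fin 2 → ℤ) (φ : L2Square) :
    fourierCoef k φ = inner ℂ (fourierL2 k) φ := by
  rw [L2.inner_def, fourierCoef]
  refine integral_congr_ae ?_
  filter_upwards [(memLp_fourierFun k).coeFn_toLp] with θ hθ
  simp only [fourierL2, hθ, RCLike.inner_apply, conj_fourierFun]

/-- The truncated operator is the operator of the truncated matrix in the Fourier basis. -/
theorem truncOp_eq (Γ : (Fin 2 → ℝ) → Fin 3 → ℝ) (q : ℝ) (n : ℕ) (φ : L2Square) :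
    truncOp Γ q n φ = ∑ k ∈ freqBox n, (∑ l ∈ freqBox n,
      truncEntry Γ q n k l * fourierCoef l φ) • fourierL2 k := by
  have hint (l : Fin 2 → ℤ) : Integrable (fun η => φ η * fourierFun (-l) η) squareMeasure :=
    (Lp.memLp φ).integrable_mul (memLp_fourierFun (-l))
  have hker : kernelIntegral (truncKernel Γ q n) φ = fun θ => ∑ k ∈ freqBox n,
      (∑ l ∈ freqBox n, truncEntry Γ q n k l * fourierCoef l φ) * fourierFun k θ := by
    funext θ
    have h1 : ∀ η, truncKernel Γ q n θ η * φ η = ∑ k ∈ freqBox n, ∑ l ∈ freqBox n,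
        (truncEntry Γ q n k l * fourierFun k θ) * (φ η * fourierFun (-l) η) := by
      intro η
      simp only [truncKernel, Finset.sum_mul]
      refine Finset.sum_congr rfl fun k _ => Finset.sum_congr rfl fun l _ => ?_
      ring
    simp only [kernelIntegral, h1]
    rw [integral_finsetSum _ fun k _ => integrable_finsetSum _ fun l _ => (hint l).const_mul _]
    refine Finset.sum_congr rfl fun k _ => ?_
    rw [integral_finsetSum _ fun l _ => (hint l).const_mul _, Finset.sum_mul]
    refine Finset.sum_congr rfl fun l _ => ?_
    rw [integral_const_mul, fourierCoef]
    ring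
  have hmem : MemLp (kernelIntegral (truncKernel Γ q n) φ) 2 squareMeasure := by
    rw [hker]
    exact memLp_finsetSum _ fun k _ => (memLp_fourierFun k).const_mul _
  rw [truncOp, integralOp, dif_pos hmem]
  refine Lp.ext ?_
  refine hmem.coeFn_toLp.trans ?_
  rw [hker]
  refine Filter.EventuallyEq.trans ?_ (Lp.coeFn_finsetSum _ _).symm
  have hall : ∀ᵐ θ ∂squareMeasure, ∀ k : Fin 2 → ℤ,
      (((∑ l ∈ freqBox n, truncEntry Γ q n k l * fourierCoef l φ) • fourierL2 k : L2Square) :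
        (Fin 2 → ℝ) → ℂ) θ =
      (∑ l ∈ freqBox n, truncEntry Γ q n k l * fourierCoef l φ) * fourierFun k θ := by
    rw [ae_all_iff]
    intro k
    filter_upwards [Lp.coeFn_smul (∑ l ∈ freqBox n, truncEntry Γ q n k l * fourierCoef l φ)
      (fourierL2 k), (memLp_fourierFun k).coeFn_toLp] with θ h1 h2
    rw [h1, Pi.smul_apply, smul_eq_mul, fourierL2, h2]
  filter_upwards [hall] with θ hθ
  simp [hθ]

end FastFourierGalerkin

end

open FastFourierGalerkin

/-! In the coordinates θ = η + t the kernel K(η + t, η) is, for fixed t off the period lattice,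
analytic and periodic in η. Its denominator is a power of S = ∑ Δ_j², where Δ_j is the increment of
γ_j in the direction t. The change of S between z and Re z factors as ∑ (Δ_j(z) + Δ_j(Re z))(Δ_j(z)
- Δ_j(Re z)). For shortest t modulo periods and |Im z_i| < r, this is at most √2 r M₀ M₁ ζ(t)². So
(A1) gives Re S ≥ δ ζ(t)² with δ > 0 as long as √2 r M₀ M₁ < C₀² (`AssumptionA2.re_sqDist_ge`). The
numerator is O(ζ(t)²), because the first-order part of the increment is tangential and the normal
annihilates it. Hence the continued kernel is O(1/ζ(t)) uniformly on the strip
(`AssumptionA2.exists_norm_shiftedKernel_le`), an integrable singularity in two dimensions.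

Shifting the contour against e^{im·η} gains e^{-β‖m‖₁}. Integration over t then gives |K_{k,l}| ≤ C
e^{-β‖k-l‖₁} for some β > b (`AssumptionA2.exists_norm_entryK_le`). Along a fixed diagonal k - l = m
the entries are Fourier coefficients of one function of t, so they tend to 0 by Riemann–Lebesgue
(`tendsto_entryK`).

In Fourier coordinates 𝒦 is therefore a norm-convergent sum of weighted shifts with weights tending
to zero, hence compact (`exists_matrixOperator`), and injectivity of 𝓘 - 𝒦 yields a bounded inverse.
Conjugating by the Sobolev weight costs only a polynomial factor in k - l, so the same argument
solves the equation in H_p (`exists_weighted_solution`).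

Each discarded entry has ‖k-l‖₁ > q ln N. The part e^{-b‖k-l‖₁} of its bound is at most N^{-qb} ≤
N^{-p/2}, and the remaining e^{-(β-b)‖k-l‖₁} is summable. So truncation perturbs P_n 𝒦 P_n by
O(N^{-p/2}) in norm (`exists_consistency_error_le`). Compactness makes P_n 𝒦 → 𝒦 in norm, which
gives stability by perturbation. A Céa-type estimate (`norm_sub_galerkin_solution_le`) then combines
the truncation error with the best approximation error, also O(N^{-p/2}). The factor ln N only
absorbs the constant, so that a single c serves both the lower bounds and the error bound. -/

namespace FastFourierGalerkin

open Filter Topology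
open scoped Pointwise

/-! ### Matrices with summable off-diagonal decay as operators on ℓ². -/

section MatrixOperators

variable {ι : Type*} [AddCommGroup ι]

/-- The space `ℓ²(ι)` of square-summable complex families. -/
abbrev SeqL2 (ι : Type*) : Type _ := lp (fun _ : ι => ℂ) 2

theorem memℓp_two_iff {ι : Type*} {f : ι → ℂ} :
    Memℓp f 2 ↔ Summable fun i => ‖f i‖ ^ 2 := by
  rw [memℓp_gen_iff (by simp)]
  simp

theorem SeqL2.hasSum_norm_sq {ι : Type*} (u : SeqL2 ι) :
    HasSum (fun i => ‖u i‖ ^ 2) (‖u‖ ^ 2) := by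
  have h := lp.hasSum_norm (p := 2) (by simp) u
  simpa using h

theorem SeqL2.norm_le_of_tsum_le {ι : Type*} {u : SeqL2 ι} {C : ℝ} (hC : 0 ≤ C)
    (h : ∑' i, ‖u i‖ ^ 2 ≤ C ^ 2) : ‖u‖ ≤ C := by
  rw [(hasSum_norm_sq u).tsum_eq] at h
  exact (pow_le_pow_iff_left₀ (norm_nonneg _) hC two_ne_zero).1 h

/-- The operator `u ↦ (d k * u (k - m))_k`. -/
theorem exists_weightedShift (d : ι → ℂ) (C : ℝ) (hd : ∀ k, ‖d k‖ ≤ C) (m : ι) :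
    ∃ S : SeqL2 ι →L[ℂ] SeqL2 ι, ‖S‖ ≤ C ∧ ∀ u k, S u k = d k * u (k - m) := by
  have hC : 0 ≤ C := (norm_nonneg _).trans (hd 0)
  have hshift (u : SeqL2 ι) : HasSum (fun k => ‖u (k - m)‖ ^ 2) (‖u‖ ^ 2) :=
    (Equiv.subRight m).hasSum_iff.2 (SeqL2.hasSum_norm_sq u)
  have hle (u : SeqL2 ι) (k : ι) : ‖d k * u (k - m)‖ ^ 2 ≤ C ^ 2 * ‖u (k - m)‖ ^ 2 := by
    rw [norm_mul, mul_pow]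
    gcongr
    exact hd k
  have hsum (u : SeqL2 ι) : Summable fun k => ‖d k * u (k - m)‖ ^ 2 :=
    Summable.of_nonneg_of_le (fun _ => by positivity) (hle u) ((hshift u).summable.mul_left _)
  let L : SeqL2 ι →ₗ[ℂ] SeqL2 ι :=
    { toFun := fun u => ⟨fun k => d k * u (k - m), memℓp_two_iff.2 (hsum u)⟩
      map_add' := fun u v => by
        ext k
        exact mul_add _ _ _
      map_smul' := fun c u => by
        ext k
        simp [mul_left_comm] }
  refine ⟨L.mkContinuous C fun u => ?_, L.mkContinuous_norm_le hC _, fun u k => rfl⟩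
  refine SeqL2.norm_le_of_tsum_le (by positivity) ?_
  calc ∑' k, ‖L u k‖ ^ 2 ≤ ∑' k, C ^ 2 * ‖u (k - m)‖ ^ 2 :=
        (hsum u).tsum_le_tsum (hle u) ((hshift u).summable.mul_left _)
    _ = (C * ‖u‖) ^ 2 := by rw [tsum_mul_left, (hshift u).tsum_eq, mul_pow]

/-- Cutting the weights off outside a finite set leaves a finite-rank operator. The remainder is
again a weighted shift, with weights that are uniformly small because `d` tends to zero, so it is
small in norm. -/
theorem isCompactOperator_of_tendsto_cofinite {S : SeqL2 ι →L[ℂ] SeqL2 ι} {d : ι → ℂ} {m : ι}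
    (hS : ∀ u k, S u k = d k * u (k - m)) (hd : Tendsto d cofinite (𝓝 0)) :
    IsCompactOperator S := by
  classical
  let D (F : Finset ι) : SeqL2 ι →L[ℂ] SeqL2 ι := ∑ k ∈ F,
    (lp.singleContinuousLinearMap ℂ (fun _ : ι => ℂ) 2 k).comp
      (d k • lp.evalCLM ℂ (fun _ : ι => ℂ) 2 (k - m))
  have hDc (F : Finset ι) : IsCompactOperator (D F) := by
    have : D F ∈ compactOperator (RingHom.id ℂ) (SeqL2 ι) (SeqL2 ι) :=
      Submodule.sum_mem _ fun k _ =>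
        show IsCompactOperator ((lp.singleContinuousLinearMap ℂ (fun _ : ι => ℂ) 2 k) ∘
            (d k • lp.evalCLM ℂ (fun _ : ι => ℂ) 2 (k - m))) from
          (isCompactOperator_of_locallyCompactSpace_rng
            (lp.singleContinuousLinearMap ℂ (fun _ : ι => ℂ) 2 k)).comp_clm _
    exact this
  have hD (F : Finset ι) (u : SeqL2 ι) (k : ι) :
      D F u k = if k ∈ F then d k * u (k - m) else 0 := by
    have h1 : D F u = ∑ j ∈ F, lp.single 2 j (d j * u (j - m)) := by
      simp only [D, _root_.sum_apply]
      rfl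
    rw [h1, lp.coeFn_sum, Finset.sum_apply]
    simp only [lp.single_apply, Pi.single_apply, Finset.sum_ite_eq]
  refine isCompactOperator_of_tendsto (l := atTop) (F := D) ?_ (Eventually.of_forall hDc)
  rw [tendsto_iff_norm_sub_tendsto_zero, Metric.tendsto_nhds]
  intro ε hε
  have hfin : {k | ¬ ‖d k‖ < ε / 2}.Finite := by
    have := (Metric.tendsto_nhds.1 hd) (ε / 2) (by positivity)
    simpa [dist_eq_norm] using this
  filter_upwards [eventually_ge_atTop hfin.toFinset] with F hF
  obtain ⟨R, hRn, hR⟩ := exists_weightedShift (fun k => if k ∈ F then 0 else - d k) (ε / 2)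
    (fun k => by
      split_ifs with h
      · simpa using (half_pos hε).le
      · by_contra hk
        exact h (hF (by simpa using (not_le.1 hk).le))) m
  have : D F - S = R := by
    ext u k
    simp [hD, hR, hS]
    split_ifs <;> simp
  rw [this]
  simpa using hRn.trans_lt (half_lt_self hε)

/-- A matrix dominated by a summable function of the difference of the indices defines a bounded
operator on `ℓ²`. -/
theorem exists_matrixOperator {A : ι → ι → ℂ} {a : ι → ℝ} (ha : Summable a)
    (hA : ∀ k l, ‖A k l‖ ≤ a (k - l)) :
    ∃ S : SeqL2 ι →L[ℂ] SeqL2 ι, ‖S‖ ≤ ∑' m, a m ∧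
      (∀ u k, HasSum (fun l => A k l * u l) (S u k)) ∧
      ((∀ m, Tendsto (fun k => A k (k - m)) cofinite (𝓝 0)) → IsCompactOperator S) := by
  -- `T m` is the m-th diagonal of the matrix; its norm is at most `a m`, so the diagonals sum in
  -- operator norm.
  choose T hTn hT using fun m => exists_weightedShift (fun k => A k (k - m)) (a m)
    (fun k => (hA k (k - m)).trans_eq (by rw [sub_sub_cancel])) m
  have hsum : Summable T := Summable.of_norm_bounded ha hTn
  refine ⟨∑' m, T m, tsum_of_norm_bounded ha.hasSum hTn, fun u k => ?_, fun h0 => ?_⟩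
  · have h1 : HasSum (fun m => T m u k) ((∑' m, T m) u k) :=
      hsum.hasSum.map ((lp.evalCLM ℂ (fun _ : ι => ℂ) 2 k).comp
        (ContinuousLinearMap.apply ℂ (SeqL2 ι) u)) (ContinuousLinearMap.continuous _)
    simp only [hT] at h1
    -- The substitution l = k - m turns the sum over diagonals into the row sum.
    rw [← (Equiv.subLeft k).hasSum_iff]
    exact h1
  · exact isCompactOperator_of_tendsto hsum.hasSum (Eventually.of_forall fun F =>
      (Submodule.sum_mem (compactOperator (RingHom.id ℂ) (SeqL2 ι) (SeqL2 ι)) fun m _ =>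
        isCompactOperator_of_tendsto_cofinite (hT m) (h0 m) :))

end MatrixOperators

/-! ### Riesz–Fredholm theory and uniform convergence on compact images. -/

section Fredholm

variable {E : Type*} [NormedAddCommGroup E] [NormedSpace ℂ E]

/-- Fredholm alternative at the spectral value 1: injectivity excludes the eigenvalue, so 1 lies in
the resolvent set. -/
theorem IsCompactOperator.bijective_one_sub [CompleteSpace E] {T : E →L[ℂ] E}
    (hT : IsCompactOperator T)
    (hinj : Function.Injective fun u => u - T u) :
    (Function.Surjective fun u => u - T u) ∧ ∃ c > 0, ∀ u, c * ‖u‖ ≤ ‖u - T u‖ := by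
  have hne : ¬ Module.End.HasEigenvalue (T : Module.End ℂ E) 1 := by
    intro h
    obtain ⟨u, hu⟩ := h.exists_hasEigenvector
    refine hu.2 (hinj ?_)
    have := hu.apply_eq_smul
    simp only [ContinuousLinearMap.coe_coe, one_smul] at this
    simp [this]
  have hbij : Function.Bijective (algebraMap ℂ (E →L[ℂ] E) 1 - T) := by
    rw [← ContinuousLinearMap.isUnit_iff_bijective]
    exact (hT.hasEigenvalue_or_mem_resolventSet one_ne_zero).resolve_left hne
  refine ⟨fun g => ?_, ?_⟩
  · obtain ⟨u, hu⟩ := hbij.2 g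
    exact ⟨u, by simpa using hu⟩
  · obtain ⟨K, hK⟩ := hT.antilipschitz_of_not_hasEigenvalue one_ne_zero hne
    obtain ⟨c, hc, h⟩ := (antilipschitzWith_iff_exists_mul_le_norm).1 ⟨K, hK⟩
    exact ⟨c, hc, fun u => by simpa [norm_sub_rev] using h u⟩

/-- Uniformly bounded operators converging strongly to the identity converge uniformly on the
image of the unit ball under a compact operator. -/
theorem IsCompactOperator.tendsto_norm_sub_comp {T : E →L[ℂ] E} (hT : IsCompactOperator T)
    {P : ℕ → E →L[ℂ] E} (hP1 : ∀ n, ‖P n‖ ≤ 1) (hP : ∀ u, Tendsto (fun n => P n u) atTop (𝓝 u))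
    {ε : ℝ} (hε : 0 < ε) : ∀ᶠ n in atTop, ∀ u, ‖T u - P n (T u)‖ ≤ ε * ‖u‖ := by
  obtain ⟨K, hK, hKT⟩ := hT.image_closedBall_subset_compact (𝕜₁ := ℂ) (f := T.toLinearMap) 1
  -- With y in the finite net near z, the three thirds pay for z - y, for y - P y and for P (z - y);
  -- the last uses the uniform bound on P.
  obtain ⟨F, hF, hFin, hcov⟩ := hK.finite_cover_balls (e := ε / 3) (by positivity)
  have hev : ∀ᶠ n in atTop, ∀ y ∈ F, ‖y - P n y‖ < ε / 3 := by
    rw [hFin.eventually_all]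
    intro y _
    have := (tendsto_iff_norm_sub_tendsto_zero.1 (hP y)).eventually_lt_const
      (show (0 : ℝ) < ε / 3 by positivity)
    simpa only [norm_sub_rev] using this
  filter_upwards [hev] with n hn u
  have key : ∀ z ∈ K, ‖z - P n z‖ ≤ ε := by
    intro z hz
    obtain ⟨y, hy, hzy⟩ := mem_iUnion₂.1 (hcov hz)
    rw [Metric.mem_ball, dist_eq_norm] at hzy
    have h1 : ‖P n (z - y)‖ ≤ ‖z - y‖ := by
      simpa using (P n).le_of_opNorm_le (hP1 n) (z - y)
    have h2 : z - P n z = (z - y) + (y - P n y) - P n (z - y) := by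
      rw [map_sub]; abel
    rw [h2]
    have := norm_sub_le ((z - y) + (y - P n y)) (P n (z - y))
    have := norm_add_le (z - y) (y - P n y)
    have := hn y hy
    linarith
  rcases eq_or_ne u 0 with rfl | hu
  · simp
  have hu' : 0 < ‖u‖ := norm_pos_iff.2 hu
  have h3 := key (T (((‖u‖⁻¹ : ℝ) : ℂ) • u)) (hKT ⟨_, by
    simp [norm_smul, hu'.ne'], rfl⟩)
  rw [map_smul, map_smul, ← smul_sub, norm_smul] at h3
  simp only [Complex.norm_real, norm_inv, norm_norm] at h3
  rwa [inv_mul_le_iff₀ hu', mul_comm] at h3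

end Fredholm

/-- Solvability of `y - A y = g` in a weighted `ℓ²` space, for a weight of moderate growth. -/
theorem exists_weighted_solution {ι : Type*} [AddCommGroup ι] {A : ι → ι → ℂ} {a v w : ι → ℝ}
    (hw : ∀ k, 1 ≤ w k) (hwv : ∀ k l, w k ≤ v (k - l) * w l)
    (hav : Summable fun m => a m * v m) (hA : ∀ k l, ‖A k l‖ ≤ a (k - l))
    (hA0 : ∀ m, Tendsto (fun k => A k (k - m)) cofinite (𝓝 0)) {T : SeqL2 ι →L[ℂ] SeqL2 ι}
    (hT : ∀ u k, HasSum (fun l => A k l * u l) (T u k))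
    (hinj : Function.Injective fun u => u - T u)
    {g : SeqL2 ι} (hg : Memℓp (fun k => (w k : ℂ) * g k) 2) :
    ∃ y : SeqL2 ι, y - T y = g ∧ Memℓp (fun k => (w k : ℂ) * y k) 2 := by
  have hw0 (k : ι) : 0 < w k := one_pos.trans_le (hw k)
  have hwc (k : ι) : (w k : ℂ) ≠ 0 := by exact_mod_cast (hw0 k).ne'
  have hv0 (m : ι) : 0 < v m := by
    have := hwv m 0
    rw [sub_zero] at this
    exact pos_of_mul_pos_left ((hw0 m).trans_le this) (hw0 0).le
  have hratio (k l : ι) : w k / w l ≤ v (k - l) := (div_le_iff₀ (hw0 l)).2 (hwv k l)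
  -- Conjugation by the diagonal weight turns the weighted problem into an unweighted one. The
  -- factor w k / w l is at most v (k - l), so the conjugated matrix keeps both the summable
  -- domination and the vanishing diagonals.
  obtain ⟨S, -, hS, hSc⟩ := exists_matrixOperator (A := fun k l => (w k : ℂ) * A k l / w l) hav
    (fun k l => by
      have : ‖(w k : ℂ) * A k l / w l‖ = ‖A k l‖ * (w k / w l) := by
        simp [abs_of_pos (hw0 _)]
        ring
      rw [this]
      have := hw0 k
      have := hw0 l
      exact mul_le_mul (hA k l) (hratio k l) (by positivity) ((norm_nonneg _).trans (hA k l)))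
  have hcomp : IsCompactOperator S := by
    refine hSc fun m => ?_
    refine squeeze_zero_norm (a := fun k => ‖A k (k - m)‖ * v m) (fun k => ?_) ?_
    · have : ‖(w k : ℂ) * A k (k - m) / w (k - m)‖ = ‖A k (k - m)‖ * (w k / w (k - m)) := by
        simp [abs_of_pos (hw0 _)]
        ring
      rw [this]
      refine mul_le_mul_of_nonneg_left ?_ (norm_nonneg _)
      simpa using hratio k (k - m)
    · simpa using (hA0 m).norm.mul_const (v m)
  have hdiv (u : SeqL2 ι) : Memℓp (fun k => u k / (w k : ℂ)) 2 := by
    rw [memℓp_two_iff]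
    refine Summable.of_nonneg_of_le (fun _ => by positivity) (fun k => ?_)
      (SeqL2.hasSum_norm_sq u).summable
    gcongr
    rw [norm_div, Complex.norm_real, Real.norm_of_nonneg (hw0 k).le]
    exact div_le_self (norm_nonneg _) (hw k)
  have hTS (u : SeqL2 ι) (k : ι) : (w k : ℂ) * T ⟨_, hdiv u⟩ k = S u k := by
    refine HasSum.unique ?_ (hS u k)
    have h1 : (fun l => (w k : ℂ) * A k l / w l * u l) =
        fun l => (w k : ℂ) * (A k l * (u l / w l)) := by
      funext l
      ring
    rw [h1]
    exact (hT ⟨_, hdiv u⟩ k).mul_left (w k : ℂ)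
  -- Since w ≥ 1, division by w maps ℓ² into ℓ². It intertwines the two equations and so transfers
  -- injectivity.
  have hSinj : Function.Injective fun u => u - S u := by
    intro u u' huu
    have : (⟨_, hdiv u⟩ : SeqL2 ι) = ⟨_, hdiv u'⟩ := by
      refine hinj ?_
      ext k
      have h1 := congrArg (fun f : SeqL2 ι => f k) huu
      simp only [lp.coeFn_sub, Pi.sub_apply, ← hTS] at h1 ⊢
      refine mul_left_cancel₀ (hwc k) ?_
      rw [mul_sub, mul_sub, mul_div_cancel₀ _ (hwc k), mul_div_cancel₀ _ (hwc k)]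
      exact h1
    ext k
    have h1 := congrArg (fun f : SeqL2 ι => f k) this
    exact (div_left_inj' (hwc k)).1 h1
  obtain ⟨u, hu⟩ := (IsCompactOperator.bijective_one_sub hcomp hSinj).1 ⟨_, hg⟩
  refine ⟨⟨_, hdiv u⟩, ?_, ?_⟩
  · ext k
    have h1 := congrArg (fun f : SeqL2 ι => f k) hu
    simp only [lp.coeFn_sub, Pi.sub_apply, ← hTS] at h1 ⊢
    refine mul_left_cancel₀ (hwc k) ?_
    rw [mul_sub, mul_div_cancel₀ _ (hwc k)]
    exact h1
  · have h1 : (fun k => (w k : ℂ) * (u k / w k)) = u := by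
      ext k
      exact mul_div_cancel₀ _ (hwc k)
    simpa only [h1] using lp.memℓp u

/-! ### Translation invariance of integrals over a period. -/

section PeriodicIntegrals

variable {E : Type*} {f : (Fin 2 → ℝ) → E}

/-- `2π`-periodicity in both variables. -/
def IsBiperiodic (f : (Fin 2 → ℝ) → E) : Prop :=
  ∀ (θ : Fin 2 → ℝ) (i : Fin 2), f (θ + Pi.single i (2 * Real.pi)) = f θ

/-- The basis of `ℝ²` generating the lattice of periods. -/
noncomputable def periodBasis : Module.Basis (Fin 2) ℝ (Fin 2 → ℝ) :=
  (Pi.basisFun ℝ (Fin 2)).isUnitSMul (w := fun _ => 2 * Real.pi)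
    fun _ => (Real.two_pi_pos.ne').isUnit

theorem periodBasis_apply (i : Fin 2) : periodBasis i = Pi.single i (2 * Real.pi) := by
  rw [periodBasis, Module.Basis.isUnitSMul_apply, Pi.basisFun_apply, ← Pi.single_smul, smul_eq_mul,
    mul_one]

theorem fundamentalDomain_periodBasis : ZSpan.fundamentalDomain periodBasis = square := by
  ext x
  have (i : Fin 2) : periodBasis.repr x i = (2 * Real.pi)⁻¹ * x i := by
    simp [periodBasis, Module.Basis.repr_isUnitSMul, Units.smul_def]
  have h2 := Real.two_pi_pos
  simp only [ZSpan.mem_fundamentalDomain, this, square, Set.mem_pi, mem_univ, true_imp_iff, mem_Ico]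
  refine forall_congr' fun i => and_congr ?_ ?_
  · rw [mul_nonneg_iff_of_pos_left (by positivity)]
  · rw [inv_mul_lt_iff₀ h2, mul_one]

theorem IsBiperiodic.vadd (hf : IsBiperiodic f) (v : Submodule.span ℤ (range periodBasis))
    (x : Fin 2 → ℝ) : f (v +ᵥ x) = f x := by
  have key : ∀ v ∈ Submodule.span ℤ (range periodBasis), ∀ x, f (x + v) = f x := by
    intro v hv
    induction hv using Submodule.span_induction with
    | mem v hv =>
      obtain ⟨i, rfl⟩ := hv
      rw [periodBasis_apply]
      exact fun x => hf x i
    | zero => simp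
    | add v w _ _ h1 h2 => intro x; rw [← add_assoc, h2, h1]
    | smul n v _ h =>
      have hp : Function.Periodic f v := h
      exact hp.zsmul n
  rw [Submodule.vadd_def, vadd_eq_add, add_comm]
  exact key _ v.2 x

theorem IsBiperiodic.add_zsmul (hf : IsBiperiodic f) (n : Fin 2 → ℤ) (x : Fin 2 → ℝ) :
    f (x + fun i => n i * (2 * Real.pi)) = f x := by
  have h (i : Fin 2) (x : Fin 2 → ℝ) : f (x + n i • Pi.single i (2 * Real.pi)) = f x :=
    Function.Periodic.zsmul (f := f) (fun x => hf x i) (n i) x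
  have h1 : (fun i => (n i : ℝ) * (2 * Real.pi)) = n 0 • Pi.single 0 (2 * Real.pi) +
      n 1 • Pi.single 1 (2 * Real.pi) := by
    ext i
    fin_cases i <;> simp
  rw [h1, ← add_assoc, h, h]

theorem isAddFundamentalDomain_square (a : Fin 2 → ℝ) :
    IsAddFundamentalDomain (Submodule.span ℤ (range periodBasis)) (a +ᵥ square) volume := by
  rw [← fundamentalDomain_periodBasis]
  exact (ZSpan.isAddFundamentalDomain periodBasis volume).vadd_of_comm a

instance : VAddInvariantMeasure (Submodule.span ℤ (range periodBasis)) (Fin 2 → ℝ) volume :=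
  ⟨fun c s _ => measure_preimage_add volume c.1 s⟩

theorem measurePreserving_vadd_square (a : Fin 2 → ℝ) :
    MeasurePreserving (fun x => a + x) squareMeasure (volume.restrict (a +ᵥ square)) := by
  have h := (measurePreserving_add_left volume a).restrict_image_emb
    (measurableEmbedding_addLeft a) square
  exact h

/-- A translate of the square is another fundamental domain of the same lattice, and a periodic
function has the same integral over both. -/
theorem IsBiperiodic.integral_comp_add [NormedAddCommGroup E] [NormedSpace ℝ E]
    (hf : IsBiperiodic f) (a : Fin 2 → ℝ) :
    ∫ x, f (a + x) ∂squareMeasure = ∫ x, f x ∂squareMeasure := by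
  rw [(measurePreserving_vadd_square a).integral_comp (measurableEmbedding_addLeft a)]
  have h0 := isAddFundamentalDomain_square 0
  rw [zero_vadd] at h0
  exact (isAddFundamentalDomain_square a).setIntegral_eq h0 hf.vadd

theorem IsBiperiodic.lintegral_comp_add {f : (Fin 2 → ℝ) → ENNReal} (hf : IsBiperiodic f)
    (a : Fin 2 → ℝ) :
    ∫⁻ x, f (a + x) ∂squareMeasure = ∫⁻ x, f x ∂squareMeasure := by
  rw [(measurePreserving_vadd_square a).lintegral_comp_emb (measurableEmbedding_addLeft a)]
  have h0 := isAddFundamentalDomain_square 0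
  rw [zero_vadd] at h0
  exact (isAddFundamentalDomain_square a).setLIntegral_eq h0 _ hf.vadd

end PeriodicIntegrals

/-! ### The Fourier basis, transported from the unit torus. -/

section FourierBasis

attribute [local instance] instMeasureSpaceUnitAddCircle

/-- The point of `(0, 2π]²` over a point of the unit torus. -/
noncomputable def torusLift (u : UnitAddTorus (Fin 2)) : Fin 2 → ℝ :=
  (2 * Real.pi) • (UnitAddTorus.measurableEquivPiIoc (fun _ => 0) u).1

/-- The chart of the torus uses boxes open on the left; the two half-open squares differ by a null
set. -/
theorem squareMeasure_eq_Ioc :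
    squareMeasure = volume.restrict (Set.univ.pi fun _ : Fin 2 => Ioc 0 (2 * Real.pi)) := by
  refine Measure.restrict_congr_set ?_
  exact (Measure.univ_pi_Ico_ae_eq_Icc (f := fun _ : Fin 2 => (0 : ℝ))
    (g := fun _ => 2 * Real.pi)).trans (Measure.univ_pi_Ioc_ae_eq_Icc).symm

theorem measurable_torusLift : Measurable torusLift := by
  unfold torusLift
  exact (measurable_subtype_coe.comp
    (UnitAddTorus.measurableEquivPiIoc fun _ : Fin 2 => (0 : ℝ)).measurable).const_smul
    (2 * Real.pi)

theorem map_torusLift :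
    Measure.map torusLift volume = ENNReal.ofReal ((2 * Real.pi) ^ 2)⁻¹ • squareMeasure := by
  have h1 := (UnitAddTorus.measurePreserving_equivPiIoc (fun _ : Fin 2 => (0 : ℝ))).map_eq
  have hm : MeasurableSet {x : Fin 2 → ℝ | ∀ i, x i ∈ Ioc (0 : ℝ) (0 + 1)} :=
    MeasurableSet.univ_pi' fun _ => measurableSet_Ioc
  have h5 : Measure.map (Subtype.val : {x : Fin 2 → ℝ // ∀ i, x i ∈ Ioc (0 : ℝ) (0 + 1)} → _)
      (Measure.comap Subtype.val volume) = volume.restrict {x | ∀ i, x i ∈ Ioc (0 : ℝ) (0 + 1)} :=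
    map_comap_subtype_coe hm volume
  have h2 : torusLift = (fun x : Fin 2 → ℝ => (2 * Real.pi) • x) ∘ Subtype.val ∘
      UnitAddTorus.measurableEquivPiIoc (fun _ => 0) := rfl
  have hpre : {x : Fin 2 → ℝ | ∀ i, x i ∈ Ioc (0 : ℝ) (0 + 1)} =
      (fun x : Fin 2 → ℝ => (2 * Real.pi) • x) ⁻¹'
        (Set.univ.pi fun _ : Fin 2 => Ioc 0 (2 * Real.pi)) := by
    ext x
    have := Real.two_pi_pos
    simp only [mem_ofPred_eq, mem_Ioc, mem_preimage, Set.mem_pi, mem_univ, true_imp_iff,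
        Pi.smul_apply,
      smul_eq_mul, zero_add]
    refine forall_congr' fun i => and_congr ?_ ?_
    · rw [mul_pos_iff_of_pos_left this]
    · rw [mul_le_iff_le_one_right this]
  rw [h2, ← Measure.map_map (by fun_prop)
      (measurable_subtype_coe.comp (MeasurableEquiv.measurable _)),
    ← Measure.map_map measurable_subtype_coe (MeasurableEquiv.measurable _), h1,
    h5, hpre, ← Measure.restrict_map (by fun_prop)
      (MeasurableSet.univ_pi fun _ => measurableSet_Ioc),
    Measure.map_addHaar_smul _ Real.two_pi_pos.ne', squareMeasure_eq_Ioc, Measure.restrict_smul]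
  congr 2
  rw [abs_of_pos (by have := Real.pi_pos; positivity)]
  simp

theorem integral_torusLift {E : Type*} [NormedAddCommGroup E] [NormedSpace ℝ E]
    {g : (Fin 2 → ℝ) → E} (hg : AEStronglyMeasurable g squareMeasure) :
    ∫ u, g (torusLift u) = ((2 * Real.pi) ^ 2)⁻¹ • ∫ x, g x ∂squareMeasure := by
  have hg' : AEStronglyMeasurable g (Measure.map torusLift volume) := by
    rw [map_torusLift]
    exact hg.smul_measure _
  rw [← integral_map measurable_torusLift.aemeasurable hg', map_torusLift, integral_smul_measure,
    ENNReal.toReal_ofReal (by positivity)]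

theorem fourierFun_torusLift (k : Fin 2 → ℤ) (u : UnitAddTorus (Fin 2)) :
    fourierFun k (torusLift u) = ((2 * Real.pi)⁻¹ : ℝ) * UnitAddTorus.mFourier k u := by
  have h1 (i : Fin 2) : fourier (k i) (u i) =
      Complex.exp (Complex.I * (k i : ℂ) * (torusLift u i : ℂ)) := by
    have h2 : u i = (((AddCircle.equivIoc (1 : ℝ) 0 (u i)).1 : ℝ) : AddCircle (1 : ℝ)) :=
      ((AddCircle.equivIoc (1 : ℝ) 0).symm_apply_apply (u i)).symm
    conv_lhs => rw [h2, fourier_coe_apply]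
    congr 1
    simp [torusLift]
    ring
  have h3 : (1 / Real.sqrt (2 * Real.pi)) * (1 / Real.sqrt (2 * Real.pi)) = (2 * Real.pi)⁻¹ := by
    rw [div_mul_div_comm, Real.mul_self_sqrt Real.two_pi_pos.le]
    simp
  rw [← h3, UnitAddTorus.mFourier]
  simp only [fourierFun, ContinuousMap.coe_mk, h1, Fin.prod_univ_two]
  push_cast
  ring

/-- The Jacobian (2π)⁻² of the rescaling equals the product of the two normalizing factors (2π)⁻¹,
so orthonormality passes over from the unit torus unchanged. -/
theorem orthonormal_fourierL2 : Orthonormal ℂ fourierL2 := by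
  have h0 := UnitAddTorus.orthonormal_mFourier (d := Fin 2)
  rw [orthonormal_iff_ite] at h0 ⊢
  intro k l
  rw [← h0 k l, L2.inner_def, L2.inner_def]
  have h1 : ∫ x, inner ℂ (fourierL2 k x) (fourierL2 l x) ∂squareMeasure =
      ∫ x, inner ℂ (fourierFun k x) (fourierFun l x) ∂squareMeasure := by
    refine integral_congr_ae ?_
    filter_upwards [(memLp_fourierFun k).coeFn_toLp, (memLp_fourierFun l).coeFn_toLp] with x h1 h2
    simp only [fourierL2, h1, h2]
  have h2 : ∫ u, inner ℂ (UnitAddTorus.mFourierLp 2 k u) (UnitAddTorus.mFourierLp 2 l u) =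
      ∫ u, inner ℂ (UnitAddTorus.mFourier k u) (UnitAddTorus.mFourier l u) := by
    refine integral_congr_ae ?_
    filter_upwards [UnitAddTorus.coeFn_mFourierLp 2 k, UnitAddTorus.coeFn_mFourierLp 2 l]
      with x h1 h2
    simp only [h1, h2]
  have h3 := integral_torusLift (g := fun x => inner ℂ (fourierFun k x) (fourierFun l x))
    ((continuous_fourierFun k).inner (continuous_fourierFun l)).aestronglyMeasurable
  have hpi : ((2 * Real.pi) ^ 2 : ℂ) ≠ 0 := by
    have := Real.pi_pos.ne'
    norm_cast
    positivity
  rw [h1, h2]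
  have h4 (u : UnitAddTorus (Fin 2)) : inner ℂ (fourierFun k (torusLift u))
      (fourierFun l (torusLift u)) = (((2 * Real.pi) ^ 2)⁻¹ : ℝ) •
        inner ℂ (UnitAddTorus.mFourier k u) (UnitAddTorus.mFourier l u) := by
    simp only [fourierFun_torusLift, RCLike.inner_apply, Complex.real_smul, map_mul,
      Complex.conj_ofReal]
    push_cast
    ring
  simp only [h4, integral_smul] at h3
  have h5 : ((2 * Real.pi) ^ 2)⁻¹ ≠ 0 := by positivity
  exact (smul_right_injective ℂ h5 h3).symm

/-- Completeness: the pullback to the torus has vanishing Fourier series, hence vanishes almost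
everywhere, and `map_torusLift` carries null sets back to the square. -/
theorem eq_zero_of_fourierCoef_eq_zero {φ : L2Square} (h : ∀ k, fourierCoef k φ = 0) : φ = 0 := by
  have hc : ENNReal.ofReal ((2 * Real.pi) ^ 2)⁻¹ ≠ 0 := by
    have := Real.pi_pos
    simp only [ne_eq, ENNReal.ofReal_eq_zero, not_le]
    positivity
  have hmem : MemLp (φ ∘ torusLift) 2 volume := by
    refine MemLp.comp_measurePreserving ?_ ⟨measurable_torusLift, map_torusLift⟩
    exact (Lp.memLp φ).smul_measure ENNReal.ofReal_ne_top
  have hcoef (k : Fin 2 → ℤ) : UnitAddTorus.mFourierCoeff (hmem.toLp _) k = 0 := by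
    rw [UnitAddTorus.mFourierCoeff]
    have h1 : ∫ u, UnitAddTorus.mFourier (-k) u • hmem.toLp _ u =
        ∫ u, ((2 * Real.pi : ℝ) : ℂ) * (φ (torusLift u) * fourierFun (-k) (torusLift u)) := by
      refine integral_congr_ae ?_
      filter_upwards [hmem.coeFn_toLp] with u hu
      have := Real.pi_pos.ne'
      simp only [hu, fourierFun_torusLift, smul_eq_mul, Function.comp]
      push_cast
      field_simp
    rw [h1, integral_torusLift (g := fun x => ((2 * Real.pi : ℝ) : ℂ) * (φ x * fourierFun (-k) x))
      (((Lp.aestronglyMeasurable φ).mul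
        (continuous_fourierFun _).aestronglyMeasurable).const_mul _), integral_const_mul]
    have := h k
    rw [fourierCoef] at this
    rw [this]
    simp
  have hz : hmem.toLp _ = 0 := by
    have h2 := UnitAddTorus.hasSum_mFourier_series_L2 (hmem.toLp _)
    simp only [hcoef, zero_smul] at h2
    exact h2.unique hasSum_zero
  have hae : ∀ᵐ u, φ (torusLift u) = 0 := by
    have h4 := hmem.coeFn_toLp
    rw [hz] at h4
    exact h4.symm.trans (Lp.coeFn_zero _ _ _)
  have h3 : ∀ᵐ x ∂(Measure.map torusLift volume), φ x = 0 := by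
    rw [ae_map_iff measurable_torusLift.aemeasurable]
    · exact hae
    · exact (Lp.stronglyMeasurable φ).measurable (measurableSet_singleton 0)
  rw [map_torusLift, ae_iff, Measure.smul_apply, smul_eq_mul, mul_eq_zero, or_iff_right hc] at h3
  exact (Lp.eq_zero_iff_ae_eq_zero).2 h3

/-- The functions `e_k` as a Hilbert basis of `L₂`. -/
noncomputable def fourierHilbertBasis : HilbertBasis (Fin 2 → ℤ) ℂ L2Square :=
  HilbertBasis.mkOfOrthogonalEqBot orthonormal_fourierL2 (by
    rw [eq_bot_iff]
    intro φ hφ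
    refine eq_zero_of_fourierCoef_eq_zero fun k => ?_
    rw [fourierCoef_eq_inner]
    exact (Submodule.mem_orthogonal _ _).1 hφ _ (Submodule.subset_span ⟨k, rfl⟩))

theorem fourierHilbertBasis_apply (k : Fin 2 → ℤ) : fourierHilbertBasis k = fourierL2 k := by
  simp [fourierHilbertBasis]

theorem fourierHilbertBasis_repr (φ : L2Square) (k : Fin 2 → ℤ) :
    fourierHilbertBasis.repr φ k = fourierCoef k φ := by
  rw [HilbertBasis.repr_apply_apply, fourierHilbertBasis_apply, fourierCoef_eq_inner]

end FourierBasis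

/-! ### The periodic distance ζ and the integrability of 1/ζ. -/

section Zeta

/-- Identification with the quotient norm of the circle supplies symmetry, periodicity, continuity
and an optimal representative. -/
theorem angleDist_eq_norm (t : ℝ) : angleDist t = ‖(t : AddCircle (2 * Real.pi))‖ := by
  have h2 := Real.two_pi_pos
  have hr := toIcoMod_mem_Ico Real.two_pi_pos 0 t
  have hn : (t : AddCircle (2 * Real.pi)) =
      ((toIcoMod Real.two_pi_pos 0 t : ℝ) : AddCircle (2 * Real.pi)) := by
    rw [toIcoMod, AddCircle.coe_sub, AddCircle.coe_zsmul, AddCircle.coe_period, smul_zero, sub_zero]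
  rw [hn, angleDist]
  generalize toIcoMod Real.two_pi_pos 0 t = r at hr
  rw [zero_add] at hr
  rcases le_or_gt r Real.pi with h | h
  · rw [(AddCircle.norm_coe_eq_abs_iff _ h2.ne').2, abs_of_nonneg hr.1, min_eq_left (by linarith)]
    rw [abs_of_nonneg hr.1, abs_of_pos h2]
    linarith
  · have h3 : (r : AddCircle (2 * Real.pi)) =
      ((r - 2 * Real.pi : ℝ) : AddCircle (2 * Real.pi)) := by
      rw [AddCircle.coe_sub, AddCircle.coe_period, sub_zero]
    have h4 : |r - 2 * Real.pi| = 2 * Real.pi - r := by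
      rw [abs_of_neg (by linarith [hr.2])]
      ring
    rw [h3, (AddCircle.norm_coe_eq_abs_iff _ h2.ne').2, h4, min_eq_right (by linarith)]
    rw [h4, abs_of_pos h2]
    linarith

theorem angleDist_nonneg (t : ℝ) : 0 ≤ angleDist t := by
  rw [angleDist_eq_norm]
  exact norm_nonneg _

theorem angleDist_neg (t : ℝ) : angleDist (-t) = angleDist t := by
  rw [angleDist_eq_norm, angleDist_eq_norm, AddCircle.coe_neg, norm_neg]

theorem angleDist_add_period (t : ℝ) : angleDist (t + 2 * Real.pi) = angleDist t := by
  rw [angleDist_eq_norm, angleDist_eq_norm, AddCircle.coe_add_period]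

theorem continuous_angleDist : Continuous angleDist := by
  have : angleDist = fun t : ℝ => ‖(t : AddCircle (2 * Real.pi))‖ := funext angleDist_eq_norm
  rw [this]
  exact continuous_norm.comp (AddCircle.continuous_mk' _)

theorem exists_abs_add_eq_angleDist (t : ℝ) :
    ∃ n : ℤ, |t + n * (2 * Real.pi)| = angleDist t := by
  refine ⟨-round ((2 * Real.pi)⁻¹ * t), ?_⟩
  rw [angleDist_eq_norm, AddCircle.norm_eq]
  push_cast
  rw [neg_mul, ← sub_eq_add_neg]

theorem continuous_zeta : Continuous zeta := by
  have := continuous_angleDist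
  unfold zeta
  fun_prop

theorem zeta_nonneg (θ : Fin 2 → ℝ) : 0 ≤ zeta θ := Real.sqrt_nonneg _

theorem zeta_neg (θ : Fin 2 → ℝ) : zeta (-θ) = zeta θ := by
  simp [zeta, angleDist_neg]

theorem isBiperiodic_zeta : IsBiperiodic zeta := by
  intro θ i
  have (j : Fin 2) : angleDist ((θ + Pi.single i (2 * Real.pi) : Fin 2 → ℝ) j) =
      angleDist (θ j) := by
    rcases eq_or_ne j i with rfl | h
    · simp [angleDist_add_period]
    · simp [h]
  simp only [zeta, this]

/-- Every `θ` is equivalent modulo periods to a vector of Euclidean norm `ζ(θ)`. -/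
theorem exists_norm_add_eq_zeta (θ : Fin 2 → ℝ) :
    ∃ n : Fin 2 → ℤ, ‖realPoint (θ + fun i => n i * (2 * Real.pi))‖ = zeta θ := by
  choose n hn using fun i => exists_abs_add_eq_angleDist (θ i)
  refine ⟨n, ?_⟩
  rw [EuclideanSpace.norm_eq, zeta]
  congr 1
  refine Finset.sum_congr rfl fun i _ => ?_
  rw [← hn i, realPoint]
  simp only [Complex.norm_real, Pi.add_apply, Real.norm_eq_abs]

theorem measurable_zeta_inv : Measurable fun x => ENNReal.ofReal (zeta x)⁻¹ :=
  (continuous_zeta.measurable.inv).ennreal_ofReal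

/-- On one period the distance is the smaller of s and 2π - s, so its inverse square root is at most
the sum of two integrable endpoint singularities. -/
theorem lintegral_angleDist_lt_top :
    ∫⁻ s in Ico 0 (2 * Real.pi), (ENNReal.ofReal (Real.sqrt (angleDist s)))⁻¹ < ⊤ := by
  have h2 := Real.two_pi_pos
  have hi1 : IntervalIntegrable (fun s : ℝ => s ^ (-(1 / 2) : ℝ)) volume 0 (2 * Real.pi) :=
    intervalIntegral.intervalIntegrable_rpow' (by norm_num)
  have hi2 : IntervalIntegrable (fun s : ℝ => (2 * Real.pi - s) ^ (-(1 / 2) : ℝ)) volume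
      0 (2 * Real.pi) := by
    have := (hi1.comp_sub_left (2 * Real.pi)).symm
    simpa using this
  have hi := (intervalIntegrable_iff_integrableOn_Ioc_of_le h2.le).1 (hi1.add hi2)
  have hle : ∫⁻ s in Ico 0 (2 * Real.pi), (ENNReal.ofReal (Real.sqrt (angleDist s)))⁻¹ ≤
      ∫⁻ s in Ioc 0 (2 * Real.pi), ENNReal.ofReal (s ^ (-(1 / 2) : ℝ) +
        (2 * Real.pi - s) ^ (-(1 / 2) : ℝ)) := by
    rw [restrict_Ico_eq_restrict_Ioc, ← restrict_Ioo_eq_restrict_Ioc]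
    refine setLIntegral_mono' measurableSet_Ioo fun s hs => ?_
    have hs1 : 0 < 2 * Real.pi - s := by linarith [hs.2]
    have hs0 := hs.1
    have hmod : toIcoMod Real.two_pi_pos 0 s = s :=
      (toIcoMod_eq_self _).2 ⟨hs.1.le, by simpa using hs.2⟩
    have hd : 0 < angleDist s := by
      rw [angleDist, hmod]
      exact lt_min hs0 hs1
    rw [← ENNReal.ofReal_inv_of_pos (Real.sqrt_pos.2 hd)]
    refine ENNReal.ofReal_le_ofReal ?_
    rw [Real.sqrt_eq_rpow, ← Real.rpow_neg hd.le, angleDist, hmod]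
    have p1 := Real.rpow_nonneg hs0.le (-(1 / 2) : ℝ)
    have p2 := Real.rpow_nonneg hs1.le (-(1 / 2) : ℝ)
    rcases min_choice s (2 * Real.pi - s) with h | h <;> rw [h] <;> linarith
  refine hle.trans_lt ?_
  have h3 := hi.2
  rw [hasFiniteIntegral_iff_enorm] at h3
  refine (lintegral_mono fun s => ?_).trans_lt h3
  exact Real.ofReal_le_enorm _

/-- Since a² + b² ≥ ab, 1/ζ is at most a product of inverse square roots of the coordinate
distances. The planar singularity thus reduces to two one-dimensional ones, without polar
coordinates. -/
theorem lintegral_zeta_inv_lt_top : ∫⁻ x, ENNReal.ofReal (zeta x)⁻¹ ∂squareMeasure < ⊤ := by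
  let h (s : ℝ) : ENNReal := (ENNReal.ofReal (Real.sqrt (angleDist s)))⁻¹
  have hm : Measurable h :=
    (continuous_angleDist.measurable.sqrt.ennreal_ofReal).inv
  have hle (x : Fin 2 → ℝ) : ENNReal.ofReal (zeta x)⁻¹ ≤ h (x 0) * h (x 1) := by
    -- At a zero of ζ the left side is 0, by the convention 0⁻¹ = 0 in ℝ.
    rcases (zeta_nonneg x).eq_or_lt with h0 | h0
    · simp [← h0]
    have h1 := angleDist_nonneg (x 0)
    have h2 := angleDist_nonneg (x 1)
    simp only [h]
    rw [← ENNReal.mul_inv (Or.inr ENNReal.ofReal_ne_top) (Or.inl ENNReal.ofReal_ne_top),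
      ← ENNReal.ofReal_mul (Real.sqrt_nonneg _), ENNReal.ofReal_inv_of_pos h0, ENNReal.inv_le_inv,
      ← Real.sqrt_mul h1, zeta, Fin.sum_univ_two]
    refine ENNReal.ofReal_le_ofReal (Real.sqrt_le_sqrt ?_)
    nlinarith [sq_nonneg (angleDist (x 0) - angleDist (x 1)), mul_nonneg h1 h2]
  have hpi : squareMeasure = Measure.pi fun _ : Fin 2 => volume.restrict (Ico 0 (2 * Real.pi)) :=
    Measure.restrict_pi_pi _ _
  refine (lintegral_mono hle).trans_lt ?_
  rw [hpi]
  have hmp := measurePreserving_finTwoArrow (volume.restrict (Ico 0 (2 * Real.pi)))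
  have h4 := hmp.lintegral_comp_emb (MeasurableEquiv.measurableEmbedding _)
    (fun z : ℝ × ℝ => h z.1 * h z.2)
  have h5 : ∫⁻ z : ℝ × ℝ, h z.1 * h z.2 ∂((volume.restrict (Ico 0 (2 * Real.pi))).prod
      (volume.restrict (Ico 0 (2 * Real.pi)))) < ⊤ := by
    rw [lintegral_prod_mul hm.aemeasurable hm.aemeasurable]
    exact ENNReal.mul_lt_top lintegral_angleDist_lt_top lintegral_angleDist_lt_top
  rw [← h4] at h5
  exact h5

theorem lintegral_zeta_inv_sub_left (θ : Fin 2 → ℝ) :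
    ∫⁻ η, ENNReal.ofReal (zeta (θ - η))⁻¹ ∂squareMeasure =
      ∫⁻ x, ENNReal.ofReal (zeta x)⁻¹ ∂squareMeasure := by
  have hp : IsBiperiodic fun x => ENNReal.ofReal (zeta x)⁻¹ := fun x i => by
    simp only [isBiperiodic_zeta x i]
  rw [← hp.lintegral_comp_add (-θ)]
  refine lintegral_congr fun η => ?_
  rw [← zeta_neg (θ - η), neg_sub, neg_add_eq_sub]

theorem lintegral_zeta_inv_sub_right (η : Fin 2 → ℝ) :
    ∫⁻ θ, ENNReal.ofReal (zeta (θ - η))⁻¹ ∂squareMeasure =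
      ∫⁻ x, ENNReal.ofReal (zeta x)⁻¹ ∂squareMeasure := by
  rw [← lintegral_zeta_inv_sub_left η]
  refine lintegral_congr fun θ => ?_
  rw [← zeta_neg (θ - η), neg_sub]

end Zeta

/-! ### Schur's test and weakly singular integral operators. -/

section WeaklySingular

open ENNReal in
-- Cauchy–Schwarz for the factorization w f = w^{1/2} · (w^{1/2} f).
theorem sq_lintegral_mul_le {α : Type*} [MeasurableSpace α] (μ : Measure α) {w f : α → ℝ≥0∞}
    (hw : Measurable w) (hf : Measurable f) :
    (∫⁻ x, w x * f x ∂μ) ^ 2 ≤ (∫⁻ x, w x ∂μ) * ∫⁻ x, w x * f x ^ 2 ∂μ := by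
  have hr (a : ℝ≥0∞) : (a ^ (1 / 2 : ℝ)) ^ (2 : ℝ) = a := by
    rw [← ENNReal.rpow_mul]
    norm_num
  have hr' (a : ℝ≥0∞) : (a ^ (1 / 2 : ℝ)) ^ 2 = a := by
    rw [← ENNReal.rpow_two, hr]
  have h1 := ENNReal.lintegral_mul_le_Lp_mul_Lq μ Real.HolderConjugate.two_two
    (f := fun x => w x ^ (1 / 2 : ℝ)) (g := fun x => w x ^ (1 / 2 : ℝ) * f x)
    (hw.pow_const _).aemeasurable ((hw.pow_const _).mul hf).aemeasurable
  have h2 (x : α) : ((fun x => w x ^ (1 / 2 : ℝ)) * fun x => w x ^ (1 / 2 : ℝ) * f x) x =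
      w x * f x := by
    rw [Pi.mul_apply, ← mul_assoc, ← sq, hr']
  have h3 (x : α) : (w x ^ (1 / 2 : ℝ) * f x) ^ (2 : ℝ) = w x * f x ^ 2 := by
    rw [ENNReal.mul_rpow_of_nonneg _ _ zero_le_two, hr, ENNReal.rpow_two]
  simp only [h2, hr, h3] at h1
  calc _ ≤ _ := pow_le_pow_left' h1 2
    _ = _ := by rw [mul_pow, hr', hr']

open ENNReal in
/-- Schur's test for the kernel `1/ζ(θ - η)`. -/
theorem lintegral_sq_zeta_inv_le {f : (Fin 2 → ℝ) → ℝ≥0∞} (hf : Measurable f) :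
    ∫⁻ θ, (∫⁻ η, ENNReal.ofReal (zeta (θ - η))⁻¹ * f η ∂squareMeasure) ^ 2 ∂squareMeasure ≤
      (∫⁻ x, ENNReal.ofReal (zeta x)⁻¹ ∂squareMeasure) ^ 2 * ∫⁻ η, f η ^ 2 ∂squareMeasure := by
  have hM := lintegral_zeta_inv_sub_left
  have hM' := lintegral_zeta_inv_sub_right
  generalize ∫⁻ x, ENNReal.ofReal (zeta x)⁻¹ ∂squareMeasure = M at hM hM' ⊢
  have hCS (θ : Fin 2 → ℝ) : (∫⁻ η, ENNReal.ofReal (zeta (θ - η))⁻¹ * f η ∂squareMeasure) ^ 2 ≤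
      M * ∫⁻ η, ENNReal.ofReal (zeta (θ - η))⁻¹ * f η ^ 2 ∂squareMeasure := by
    rw [← hM θ]
    exact sq_lintegral_mul_le squareMeasure (w := fun η => ENNReal.ofReal (zeta (θ - η))⁻¹)
      (measurable_zeta_inv.comp (measurable_const.sub measurable_id)) hf
  have hmeas : Measurable (fun z : (Fin 2 → ℝ) × (Fin 2 → ℝ) =>
      ENNReal.ofReal (zeta (z.1 - z.2))⁻¹ * f z.2 ^ 2) :=
    (measurable_zeta_inv.comp (measurable_fst.sub measurable_snd)).mul
      ((hf.comp measurable_snd).pow_const 2)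
  have hswap : ∫⁻ θ, ∫⁻ η, ENNReal.ofReal (zeta (θ - η))⁻¹ * f η ^ 2 ∂squareMeasure ∂squareMeasure =
      ∫⁻ η, M * f η ^ 2 ∂squareMeasure := by
    rw [lintegral_lintegral_swap (f := fun θ η => ENNReal.ofReal (zeta (θ - η))⁻¹ * f η ^ 2)
      hmeas.aemeasurable]
    refine lintegral_congr fun η => ?_
    rw [← hM' η]
    exact lintegral_mul_const (f := fun θ => ENNReal.ofReal (zeta (θ - η))⁻¹) _
      (measurable_zeta_inv.comp (measurable_id.sub measurable_const))
  calc _ ≤ ∫⁻ θ, M * ∫⁻ η, ENNReal.ofReal (zeta (θ - η))⁻¹ * f η ^ 2 ∂squareMeasure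
        ∂squareMeasure := lintegral_mono hCS
    _ = M * ∫⁻ η, M * f η ^ 2 ∂squareMeasure := by
      rw [lintegral_const_mul _ (Measurable.lintegral_prod_right' hmeas), hswap]
    _ = _ := by rw [lintegral_const_mul _ (hf.pow_const 2), sq, mul_assoc]

variable {κ : (Fin 2 → ℝ) → (Fin 2 → ℝ) → ℂ} {C : ℝ}

theorem enorm_mul_le_of_weaklySingular (hC : ∀ θ η, ‖κ θ η‖ ≤ C * (zeta (θ - η))⁻¹)
    (φ : L2Square) (θ η : Fin 2 → ℝ) :
    ‖κ θ η * φ η‖ₑ ≤ ENNReal.ofReal C * (ENNReal.ofReal (zeta (θ - η))⁻¹ * ‖φ η‖ₑ) := by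
  rw [enorm_mul, ← mul_assoc, ← ENNReal.ofReal_mul' (inv_nonneg.2 (zeta_nonneg _))]
  gcongr
  rw [← ofReal_norm]
  exact ENNReal.ofReal_le_ofReal (hC θ η)

theorem lintegral_sq_lt_top (φ : L2Square) : ∫⁻ η, ‖φ η‖ₑ ^ 2 ∂squareMeasure < ⊤ := by
  have h := (Lp.memLp φ).2
  rw [eLpNorm_lt_top_iff_lintegral_rpow_enorm_lt_top two_ne_zero ENNReal.ofNat_ne_top] at h
  simpa using h

theorem measurable_enorm_Lp (φ : L2Square) : Measurable fun η => ‖φ η‖ₑ :=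
  (Lp.stronglyMeasurable φ).measurable.enorm

/-- Schur's test makes the square of the majorizing integral integrable in θ, hence finite for
almost every θ. -/
theorem integrable_of_weaklySingular (hκ : Measurable (Function.uncurry κ))
    (hC : ∀ θ η, ‖κ θ η‖ ≤ C * (zeta (θ - η))⁻¹) (φ : L2Square) :
    ∀ᵐ θ ∂squareMeasure, Integrable (fun η => κ θ η * φ η) squareMeasure := by
  have hW : Measurable fun z : (Fin 2 → ℝ) × (Fin 2 → ℝ) =>
      ENNReal.ofReal (zeta (z.1 - z.2))⁻¹ * ‖φ z.2‖ₑ :=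
    (measurable_zeta_inv.comp (measurable_fst.sub measurable_snd)).mul
      ((measurable_enorm_Lp φ).comp measurable_snd)
  have h1 : ∀ᵐ θ ∂squareMeasure,
      (∫⁻ η, ENNReal.ofReal (zeta (θ - η))⁻¹ * ‖φ η‖ₑ ∂squareMeasure) ^ 2 < ⊤ := by
    refine ae_lt_top (hW.lintegral_prod_right'.pow_const 2) ?_
    refine ((lintegral_sq_zeta_inv_le (measurable_enorm_Lp φ)).trans_lt ?_).ne
    exact ENNReal.mul_lt_top (ENNReal.pow_lt_top lintegral_zeta_inv_lt_top) (lintegral_sq_lt_top φ)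
  filter_upwards [h1] with θ hθ
  refine ⟨((hκ.comp measurable_prodMk_left).mul
    (Lp.stronglyMeasurable φ).measurable).aestronglyMeasurable, ?_⟩
  refine (lintegral_mono (enorm_mul_le_of_weaklySingular hC φ θ)).trans_lt ?_
  rw [lintegral_const_mul' _ _ ENNReal.ofReal_ne_top]
  exact ENNReal.mul_lt_top ENNReal.ofReal_lt_top (ENNReal.pow_lt_top_iff.1 hθ |>.resolve_right
    two_ne_zero)

theorem lintegral_sq_kernelIntegral_le (hC : ∀ θ η, ‖κ θ η‖ ≤ C * (zeta (θ - η))⁻¹)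
    (φ : L2Square) :
    ∫⁻ θ, ‖kernelIntegral κ φ θ‖ₑ ^ 2 ∂squareMeasure ≤
      (ENNReal.ofReal C * ∫⁻ x, ENNReal.ofReal (zeta x)⁻¹ ∂squareMeasure) ^ 2 *
        ∫⁻ η, ‖φ η‖ₑ ^ 2 ∂squareMeasure := by
  have h1 (θ : Fin 2 → ℝ) : ‖kernelIntegral κ φ θ‖ₑ ^ 2 ≤ ENNReal.ofReal C ^ 2 *
      (∫⁻ η, ENNReal.ofReal (zeta (θ - η))⁻¹ * ‖φ η‖ₑ ∂squareMeasure) ^ 2 := by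
    rw [← mul_pow]
    refine pow_le_pow_left' ?_ 2
    refine (enorm_integral_le_lintegral_enorm _).trans ?_
    refine (lintegral_mono (enorm_mul_le_of_weaklySingular hC φ θ)).trans_eq ?_
    exact lintegral_const_mul' _ _ ENNReal.ofReal_ne_top
  refine (lintegral_mono h1).trans ?_
  rw [lintegral_const_mul' _ _ (ENNReal.pow_lt_top ENNReal.ofReal_lt_top).ne, mul_pow, mul_assoc]
  gcongr
  exact lintegral_sq_zeta_inv_le (measurable_enorm_Lp φ)

theorem eLpNorm_two_sq (f : (Fin 2 → ℝ) → ℂ) :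
    eLpNorm f 2 squareMeasure ^ 2 = ∫⁻ θ, ‖f θ‖ₑ ^ 2 ∂squareMeasure := by
  rw [eLpNorm_eq_lintegral_rpow_enorm_toReal two_ne_zero ENNReal.ofNat_ne_top, ← ENNReal.rpow_two,
    ← ENNReal.rpow_mul]
  simp

theorem eLpNorm_kernelIntegral_le (hC : ∀ θ η, ‖κ θ η‖ ≤ C * (zeta (θ - η))⁻¹) (φ : L2Square) :
    eLpNorm (kernelIntegral κ φ) 2 squareMeasure ≤
      (ENNReal.ofReal C * ∫⁻ x, ENNReal.ofReal (zeta x)⁻¹ ∂squareMeasure) *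
        eLpNorm φ 2 squareMeasure := by
  rw [← ENNReal.pow_le_pow_left_iff two_ne_zero, mul_pow, eLpNorm_two_sq, eLpNorm_two_sq]
  exact lintegral_sq_kernelIntegral_le hC φ

theorem memLp_kernelIntegral (hκ : Measurable (Function.uncurry κ))
    (hC : ∀ θ η, ‖κ θ η‖ ≤ C * (zeta (θ - η))⁻¹) (φ : L2Square) :
    MemLp (kernelIntegral κ φ) 2 squareMeasure := by
  refine ⟨?_, (eLpNorm_kernelIntegral_le hC φ).trans_lt ?_⟩
  · have : StronglyMeasurable fun z : (Fin 2 → ℝ) × (Fin 2 → ℝ) => κ z.1 z.2 * φ z.2 :=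
      (hκ.mul ((Lp.stronglyMeasurable φ).measurable.comp measurable_snd)).stronglyMeasurable
    exact this.integral_prod_right'.aestronglyMeasurable
  · exact ENNReal.mul_lt_top (ENNReal.mul_lt_top ENNReal.ofReal_lt_top lintegral_zeta_inv_lt_top)
      (Lp.memLp φ).2

theorem integralOp_ae_eq (hκ : Measurable (Function.uncurry κ))
    (hC : ∀ θ η, ‖κ θ η‖ ≤ C * (zeta (θ - η))⁻¹) (φ : L2Square) :
    integralOp κ φ =ᵐ[squareMeasure] kernelIntegral κ φ := by
  rw [integralOp, dif_pos (memLp_kernelIntegral hκ hC φ)]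
  exact MemLp.coeFn_toLp _

/-- A weakly singular kernel defines a bounded operator. -/
theorem exists_clm_integralOp (hκ : Measurable (Function.uncurry κ))
    (hC : ∀ θ η, ‖κ θ η‖ ≤ C * (zeta (θ - η))⁻¹) :
    ∃ T : L2Square →L[ℂ] L2Square, ∀ φ, integralOp κ φ = T φ := by
  let L : L2Square →ₗ[ℂ] L2Square :=
    { toFun := integralOp κ
      map_add' := fun φ ψ => by
        refine Lp.ext ((integralOp_ae_eq hκ hC _).trans ?_)
        filter_upwards [Lp.coeFn_add (integralOp κ φ) (integralOp κ ψ), integralOp_ae_eq hκ hC φ,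
          integralOp_ae_eq hκ hC ψ, integrable_of_weaklySingular hκ hC φ,
          integrable_of_weaklySingular hκ hC ψ] with θ h1 h2 h3 h4 h5
        rw [h1, Pi.add_apply, h2, h3, kernelIntegral, kernelIntegral, kernelIntegral,
          ← integral_add h4 h5]
        refine integral_congr_ae ?_
        filter_upwards [Lp.coeFn_add φ ψ] with η hη
        rw [hη, Pi.add_apply, mul_add]
      map_smul' := fun c φ => by
        refine Lp.ext ((integralOp_ae_eq hκ hC _).trans ?_)
        filter_upwards [Lp.coeFn_smul c (integralOp κ φ), integralOp_ae_eq hκ hC φ] with θ h1 h2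
        rw [RingHom.id_apply, h1, Pi.smul_apply, h2, kernelIntegral, kernelIntegral, smul_eq_mul,
          ← integral_const_mul]
        refine integral_congr_ae ?_
        filter_upwards [Lp.coeFn_smul c φ] with η hη
        rw [hη, Pi.smul_apply, smul_eq_mul, mul_left_comm] }
  have hfin : ENNReal.ofReal C * ∫⁻ x, ENNReal.ofReal (zeta x)⁻¹ ∂squareMeasure ≠ ⊤ :=
    (ENNReal.mul_lt_top ENNReal.ofReal_lt_top lintegral_zeta_inv_lt_top).ne
  refine ⟨L.mkContinuous
    (ENNReal.ofReal C * ∫⁻ x, ENNReal.ofReal (zeta x)⁻¹ ∂squareMeasure).toReal fun φ => ?_,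
    fun φ => rfl⟩
  rw [Lp.norm_def, Lp.norm_def, ← ENNReal.toReal_mul]
  refine ENNReal.toReal_mono (ENNReal.mul_lt_top hfin.lt_top (Lp.memLp φ).2).ne ?_
  refine (eLpNorm_congr_ae (integralOp_ae_eq hκ hC φ)).trans_le ?_
  exact eLpNorm_kernelIntegral_le hC φ

end WeaklySingular

/-! ### Analytic and periodic functions on the strip. -/

section Strip

theorem strip_mono {r R : ℝ} (h : r ≤ R) : strip r ⊆ strip R := fun _ hz i => (hz i).trans_le h

theorem isOpen_strip (r : ℝ) : IsOpen (strip r) := by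
  have : strip r = ⋂ i, {z : EuclideanSpace ℂ (Fin 2) | |(z i).im| < r} := by
    ext z
    simp [strip]
  rw [this]
  exact isOpen_iInter_of_finite fun i => isOpen_lt (by fun_prop) continuous_const

theorem convex_strip (r : ℝ) : Convex ℝ (strip r) := by
  intro z hz w hw a b ha hb hab i
  have h1 : ((a • z + b • w) i).im = a * (z i).im + b * (w i).im := by simp
  have h2 := abs_lt.1 (hz i)
  have h3 := abs_lt.1 (hw i)
  rw [h1]
  refine abs_lt.2 ⟨?_, ?_⟩ <;> rcases ha.eq_or_lt with rfl | ha <;> nlinarith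

theorem realPoint_mem_strip {r : ℝ} (hr : 0 < r) (θ : Fin 2 → ℝ) : realPoint θ ∈ strip r := by
  intro i
  simpa [realPoint] using hr

theorem realPoint_add (θ η : Fin 2 → ℝ) : realPoint (θ + η) = realPoint θ + realPoint η := by
  ext i
  simp [realPoint]

theorem add_realPoint_mem_strip {r : ℝ} {z : EuclideanSpace ℂ (Fin 2)} (t : Fin 2 → ℝ) :
    z + realPoint t ∈ strip r ↔ z ∈ strip r := by
  simp [strip, realPoint]

theorem continuous_realPoint : Continuous realPoint := by
  unfold realPoint
  fun_prop

theorem im_le_of_mem_closure_strip {r : ℝ} {z : EuclideanSpace ℂ (Fin 2)}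
    (hz : z ∈ closure (strip r)) (i : Fin 2) : |(z i).im| ≤ r := by
  have hc : IsClosed {z : EuclideanSpace ℂ (Fin 2) | |(z i).im| ≤ r} :=
    isClosed_le (by fun_prop) continuous_const
  exact closure_minimal (fun w hw => (hw i).le) hc hz

/-- An analytic function on the strip is determined by its values at real points. -/
theorem eq_zero_of_eq_zero_realPoint {r : ℝ} {F : EuclideanSpace ℂ (Fin 2) → ℂ}
    (hF : AnalyticOnNhd ℂ F (strip r)) (h0 : ∀ θ, F (realPoint θ) = 0)
    {z : EuclideanSpace ℂ (Fin 2)} (hz : z ∈ strip r) : F z = 0 := by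
  let x : EuclideanSpace ℂ (Fin 2) := rePart z
  let y : EuclideanSpace ℂ (Fin 2) := realPoint fun i => (z i).im
  -- The complex line through Re z in the direction Im z meets real points for real s and reaches z
  -- at s = i, so the one-variable identity theorem suffices.
  let ℓ (s : ℂ) : EuclideanSpace ℂ (Fin 2) := x + s • y
  let D : Set ℂ := ℓ ⁻¹' strip r
  have him (s : ℂ) (i : Fin 2) : (ℓ s i).im = s.im * (z i).im := by
    simp [ℓ, x, y, rePart, realPoint]
  have hD : Convex ℝ D := by
    intro s hs t ht a b ha hb hab
    have : ℓ (a • s + b • t) = a • ℓ s + b • ℓ t := by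
      simp only [ℓ]
      have h1 : x = (a + b) • x := by rw [hab, one_smul]
      conv_lhs => rw [h1]
      simp only [add_smul, smul_add, smul_assoc]
      abel
    change ℓ _ ∈ strip r
    rw [this]
    exact convex_strip r hs ht ha hb hab
  have hr : 0 < r := (abs_nonneg _).trans_lt (hz 0)
  have hreal (s : ℝ) : F (ℓ s) = 0 := by
    rw [← h0 fun i => (z i).re + s * (z i).im]
    congr 1
    ext i
    simp [ℓ, x, y, rePart, realPoint]
  have hana : AnalyticOnNhd ℂ (F ∘ ℓ) D := by
    refine hF.comp (fun s _ => ?_) (mapsTo_preimage _ _)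
    have : AnalyticAt ℂ (fun s : ℂ => s • y) s := analyticAt_id.smul analyticAt_const
    exact analyticAt_const.add this
  have h0D : (0 : ℂ) ∈ D := by
    intro i
    rw [him]
    simpa using hr
  have hID : Complex.I ∈ D := by
    intro i
    rw [him]
    simpa using hz i
  have hfreq : ∃ᶠ s in 𝓝[≠] (0 : ℂ), (F ∘ ℓ) s = 0 := by
    have ht : Tendsto (fun s : ℝ => (s : ℂ)) (𝓝[≠] 0) (𝓝[≠] 0) := by
      refine tendsto_nhdsWithin_iff.2 ⟨?_, ?_⟩
      · exact (Complex.continuous_ofReal.tendsto' 0 0 Complex.ofReal_zero).mono_left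
          nhdsWithin_le_nhds
      · filter_upwards [self_mem_nhdsWithin] with s hs
        simpa using hs
    exact ht.frequently (Eventually.of_forall hreal).frequently
  have := hana.eqOn_zero_of_preconnected_of_frequently_eq_zero hD.isPreconnected h0D hfreq hID
  have hz' : ℓ Complex.I = z := by
    ext i
    simp only [ℓ, x, y, rePart, realPoint, PiLp.add_apply, PiLp.smul_apply, smul_eq_mul]
    rw [mul_comm, Complex.re_add_im]
  rwa [Function.comp_apply, hz'] at this

/-- Periodicity with respect to `2πℤ²` on a set. -/
def PeriodicOn {E : Type*} (f : EuclideanSpace ℂ (Fin 2) → E)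
    (s : Set (EuclideanSpace ℂ (Fin 2))) : Prop :=
  ∀ z ∈ s, ∀ n : Fin 2 → ℤ, f (z + realPoint fun i => n i * (2 * Real.pi)) = f z

/-- The difference between f and a lattice translate vanishes at real points, hence on the whole
strip. -/
theorem periodicOn_of_realPoint {r : ℝ} {f : EuclideanSpace ℂ (Fin 2) → ℂ}
    (hf : AnalyticOnNhd ℂ f (strip r)) (hper : IsBiperiodic fun θ => f (realPoint θ)) :
    PeriodicOn f (strip r) := by
  intro z hz n
  have h1 : AnalyticOnNhd ℂ (fun z => f (z + realPoint fun i => n i * (2 * Real.pi)) - f z)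
      (strip r) := by
    refine AnalyticOnNhd.sub ?_ hf
    refine hf.comp (fun z _ => analyticAt_id.add analyticAt_const) fun z hz => ?_
    exact (add_realPoint_mem_strip _).2 hz
  refine sub_eq_zero.1 (eq_zero_of_eq_zero_realPoint h1 (fun θ => ?_) hz)
  rw [← realPoint_add, sub_eq_zero]
  exact hper.add_zsmul n θ

theorem PeriodicOn.fderiv {E : Type*} [NormedAddCommGroup E] [NormedSpace ℂ E] {r : ℝ}
    {f : EuclideanSpace ℂ (Fin 2) → E} (hf : PeriodicOn f (strip r)) :
    PeriodicOn (fderiv ℂ f) (strip r) := by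
  intro z hz n
  rw [← fderiv_comp_add_right]
  refine Filter.EventuallyEq.fderiv_eq ?_
  filter_upwards [(isOpen_strip r).mem_nhds hz] with w hw using hf w hw n

/-- Periods bring the real parts into a bounded box. Continuity up to the closed strip then gives a
bound on a compact set. -/
theorem PeriodicOn.exists_norm_le {E : Type*} [NormedAddCommGroup E] {r : ℝ}
    {f : EuclideanSpace ℂ (Fin 2) → E} (hf : PeriodicOn f (strip r))
    (hc : ContinuousOn f (closure (strip r))) : ∃ C, ∀ z ∈ strip r, ‖f z‖ ≤ C := by
  let K : Set (EuclideanSpace ℂ (Fin 2)) :=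
    closure (strip r) ∩ {z | ∀ i, |(z i).re| ≤ 2 * Real.pi}
  have hK : IsCompact K := by
    refine Metric.isCompact_of_isClosed_isBounded ?_ ?_
    · refine isClosed_closure.inter ?_
      simp only [ofPred_forall]
      exact isClosed_iInter fun i => isClosed_le (by fun_prop) continuous_const
    · refine isBounded_iff_forall_norm_le.2 ⟨Real.sqrt (∑ _i : Fin 2, (2 * Real.pi + r) ^ 2), ?_⟩
      intro z hz
      rw [EuclideanSpace.norm_eq]
      gcongr with i
      refine (Complex.norm_le_abs_re_add_abs_im _).trans ?_
      exact add_le_add (hz.2 i) (im_le_of_mem_closure_strip hz.1 i)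
  obtain ⟨C, hC⟩ := hK.exists_bound_of_continuousOn (hc.mono inter_subset_left)
  refine ⟨C, fun z hz => ?_⟩
  have h2 := Real.two_pi_pos
  let n (i : Fin 2) : ℤ := -toIcoDiv Real.two_pi_pos 0 (z i).re
  rw [← hf z hz n]
  refine hC _ ⟨subset_closure ((add_realPoint_mem_strip _).2 hz), fun i => ?_⟩
  have h3 := toIcoMod_mem_Ico Real.two_pi_pos 0 (z i).re
  have h4 : ((z + realPoint fun i => n i * (2 * Real.pi)) i).re =
      toIcoMod Real.two_pi_pos 0 (z i).re := by
    rw [toIcoMod]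
    simp [n, realPoint, sub_eq_add_neg]
  rw [h4, abs_of_nonneg h3.1]
  linarith [h3.2]

end Strip

/-! ### Increments in real directions, controlled by M₀ and M₁. -/

section Taylor

variable {R : ℝ} {f : EuclideanSpace ℂ (Fin 2) → ℂ}

theorem rePart_mem_strip {r : ℝ} {z : EuclideanSpace ℂ (Fin 2)} (hz : z ∈ strip r) :
    rePart z ∈ strip r :=
  realPoint_mem_strip ((abs_nonneg _).trans_lt (hz 0)) _

/-- Boundedness is what makes the supremum meaningful: the `sSup` of an unbounded set of reals is 0
by convention. -/
theorem bddAbove_M0comp (hf : AnalyticOnNhd ℂ f (closure (strip R)))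
    (hper : PeriodicOn f (strip R)) :
    BddAbove ((fun z => ‖fderiv ℂ f z + fderiv ℂ f (rePart z)‖) '' strip R) := by
  obtain ⟨C, hC⟩ := hper.fderiv.exists_norm_le hf.fderiv.continuousOn
  refine ⟨C + C, ?_⟩
  rintro _ ⟨z, hz, rfl⟩
  exact (norm_add_le _ _).trans (add_le_add (hC z hz) (hC _ (rePart_mem_strip hz)))

theorem bddAbove_M1comp (hf : AnalyticOnNhd ℂ f (closure (strip R)))
    (hper : PeriodicOn f (strip R)) :
    BddAbove ((fun z => ‖fderiv ℂ (fderiv ℂ f) z‖) '' strip R) := by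
  obtain ⟨C, hC⟩ := hper.fderiv.fderiv.exists_norm_le hf.fderiv.fderiv.continuousOn
  exact ⟨C, by rintro _ ⟨z, hz, rfl⟩; exact hC z hz⟩

theorem norm_fderiv_add_le_M0comp (hf : AnalyticOnNhd ℂ f (closure (strip R)))
    (hper : PeriodicOn f (strip R)) {z : EuclideanSpace ℂ (Fin 2)} (hz : z ∈ strip R) :
    ‖fderiv ℂ f z + fderiv ℂ f (rePart z)‖ ≤ M0comp R f :=
  le_csSup (bddAbove_M0comp hf hper) ⟨z, hz, rfl⟩

theorem norm_fderiv_sub_le_M1comp (hf : AnalyticOnNhd ℂ f (closure (strip R)))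
    (hper : PeriodicOn f (strip R)) {z w : EuclideanSpace ℂ (Fin 2)} (hz : z ∈ strip R)
    (hw : w ∈ strip R) : ‖fderiv ℂ f w - fderiv ℂ f z‖ ≤ M1comp R f * ‖w - z‖ := by
  refine (convex_strip R).norm_image_sub_le_of_norm_fderiv_le (𝕜 := ℂ)
    (fun x hx => (hf.fderiv x (subset_closure hx)).differentiableAt) (fun x hx => ?_) hz hw
  exact le_csSup (bddAbove_M1comp hf hper) ⟨x, hx, rfl⟩

theorem M0comp_nonneg : 0 ≤ M0comp R f := by
  refine Real.sSup_nonneg ?_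
  rintro _ ⟨z, -, rfl⟩
  exact norm_nonneg _

theorem M1comp_nonneg : 0 ≤ M1comp R f := by
  refine Real.sSup_nonneg ?_
  rintro _ ⟨z, -, rfl⟩
  exact norm_nonneg (fderiv ℂ (fderiv ℂ f) z)

/-- The increment of `f` in the real direction `t`. -/
noncomputable def increment (f : EuclideanSpace ℂ (Fin 2) → ℂ) (t : Fin 2 → ℝ)
    (z : EuclideanSpace ℂ (Fin 2)) : ℂ :=
  f (z + realPoint t) - f z

theorem convex_im_eq (z : EuclideanSpace ℂ (Fin 2)) :
    Convex ℝ {w : EuclideanSpace ℂ (Fin 2) | ∀ i, (w i).im = (z i).im} := by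
  intro u hu v hv a b _ _ hab i
  simp [hu i, hv i, ← add_mul, hab]

/-- The real part is not holomorphic, but on a slice of constant imaginary part it is a translation.
There f ∘ Re may be replaced by a holomorphic translate of f. -/
theorem rePart_of_im_eq {z w : EuclideanSpace ℂ (Fin 2)} (h : ∀ i, (w i).im = (z i).im) :
    rePart w = w - (z - rePart z) := by
  ext i
  apply Complex.ext <;> simp [rePart, realPoint, h i]

theorem hasFDerivAt_sub_of_mem (hf : AnalyticOnNhd ℂ f (closure (strip R)))
    {w v : EuclideanSpace ℂ (Fin 2)} (h : w - v ∈ strip R) :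
    HasFDerivAt (fun w => f (w - v)) (fderiv ℂ f (w - v)) w := by
  have h1 := ((hf _ (subset_closure h)).differentiableAt.hasFDerivAt).comp w
    ((hasFDerivAt_id w).sub_const v)
  exact h1

/-- Mean value inequality on the slice of constant imaginary part, for f minus its translate; the
derivative there is a difference of gradients at points ‖z - Re z‖ apart. -/
theorem norm_increment_sub_le (hf : AnalyticOnNhd ℂ f (closure (strip R)))
    (hper : PeriodicOn f (strip R)) {z : EuclideanSpace ℂ (Fin 2)} (hz : z ∈ strip R)
    (t : Fin 2 → ℝ) :
    ‖increment f t z - increment f t (rePart z)‖ ≤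
      M1comp R f * ‖z - rePart z‖ * ‖realPoint t‖ := by
  have hs (w : EuclideanSpace ℂ (Fin 2)) (hw : ∀ i, (w i).im = (z i).im) : w ∈ strip R :=
    fun i => (hw i).symm ▸ hz i
  have h := (convex_im_eq z).norm_image_sub_le_of_norm_hasFDerivWithin_le (𝕜 := ℂ)
    (f := fun w => f w - f (w - (z - rePart z)))
    (f' := fun w => fderiv ℂ f w - fderiv ℂ f (w - (z - rePart z)))
    (C := M1comp R f * ‖z - rePart z‖) (x := z) (y := z + realPoint t)
    (fun w hw => by
      have h1 := rePart_mem_strip (hs w hw)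
      rw [rePart_of_im_eq hw] at h1
      exact (((hf w (subset_closure (hs w hw))).differentiableAt.hasFDerivAt).sub
        (hasFDerivAt_sub_of_mem hf h1)).hasFDerivWithinAt)
    (fun w hw => by
      have h1 := rePart_mem_strip (hs w hw)
      rw [rePart_of_im_eq hw] at h1
      simpa using norm_fderiv_sub_le_M1comp hf hper h1 (hs w hw))
    (fun i => rfl) (fun i => by simp [realPoint])
  rw [add_sub_cancel_left] at h
  refine (le_of_eq ?_).trans h
  congr 1
  rw [increment, increment, sub_sub_cancel,
    show z + realPoint t - (z - rePart z) = rePart z + realPoint t by abel]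
  ring

/-- The companion factor in the difference of squares of increments; it explains the sum of
gradients in the definition of M₀. -/
theorem norm_increment_add_le (hf : AnalyticOnNhd ℂ f (closure (strip R)))
    (hper : PeriodicOn f (strip R)) {z : EuclideanSpace ℂ (Fin 2)} (hz : z ∈ strip R)
    (t : Fin 2 → ℝ) :
    ‖increment f t z + increment f t (rePart z)‖ ≤ M0comp R f * ‖realPoint t‖ := by
  have hs (w : EuclideanSpace ℂ (Fin 2)) (hw : ∀ i, (w i).im = (z i).im) : w ∈ strip R :=
    fun i => (hw i).symm ▸ hz i
  have h := (convex_im_eq z).norm_image_sub_le_of_norm_hasFDerivWithin_le (𝕜 := ℂ)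
    (f := fun w => f w + f (w - (z - rePart z)))
    (f' := fun w => fderiv ℂ f w + fderiv ℂ f (w - (z - rePart z)))
    (C := M0comp R f) (x := z) (y := z + realPoint t)
    (fun w hw => by
      have h1 := rePart_mem_strip (hs w hw)
      rw [rePart_of_im_eq hw] at h1
      exact (((hf w (subset_closure (hs w hw))).differentiableAt.hasFDerivAt).add
        (hasFDerivAt_sub_of_mem hf h1)).hasFDerivWithinAt)
    (fun w hw => by
      have h1 := norm_fderiv_add_le_M0comp hf hper (hs w hw)
      rwa [rePart_of_im_eq hw] at h1)
    (fun i => rfl) (fun i => by simp [realPoint])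
  rw [add_sub_cancel_left] at h
  refine (le_of_eq ?_).trans h
  congr 1
  rw [increment, increment, sub_sub_cancel,
    show z + realPoint t - (z - rePart z) = rePart z + realPoint t by abel]
  ring

theorem norm_increment_sub_fderiv_le (hf : AnalyticOnNhd ℂ f (closure (strip R)))
    (hper : PeriodicOn f (strip R)) {z : EuclideanSpace ℂ (Fin 2)} (hz : z ∈ strip R)
    (t : Fin 2 → ℝ) :
    ‖increment f t z - fderiv ℂ f z (realPoint t)‖ ≤ M1comp R f * ‖realPoint t‖ ^ 2 := by
  have hzt : z + realPoint t ∈ strip R := (add_realPoint_mem_strip t).2 hz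
  have hs := (convex_strip R).segment_subset hz hzt
  have h := (convex_segment z (z + realPoint t)).norm_image_sub_le_of_norm_hasFDerivWithin_le'
    (𝕜 := ℂ) (f := f) (f' := fderiv ℂ f) (φ := fderiv ℂ f z)
    (C := M1comp R f * ‖realPoint t‖)
    (fun w hw => (hf w (subset_closure (hs hw))).differentiableAt.hasFDerivAt.hasFDerivWithinAt)
    (fun w hw => by
      refine (norm_fderiv_sub_le_M1comp hf hper hz (hs hw)).trans ?_
      refine mul_le_mul_of_nonneg_left ?_ M1comp_nonneg
      have := norm_sub_le_of_mem_segment hw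
      simpa using this)
    (left_mem_segment ℝ _ _) (right_mem_segment ℝ _ _)
  rw [add_sub_cancel_left] at h
  rw [increment, sq, ← mul_assoc]
  exact h

end Taylor

/-! ### Analytic continuation of the shifted kernel and its uniform bound. -/

section ComplexKernel

variable {Γ : (Fin 2 → ℝ) → Fin 3 → ℝ} {C₀ R₀ : ℝ} {γ : Fin 3 → EuclideanSpace ℂ (Fin 2) → ℂ}

theorem Biperiodic.isBiperiodic (hΓ : Biperiodic Γ) : IsBiperiodic Γ := hΓ

theorem exists_add_mem_square (θ : Fin 2 → ℝ) :
    ∃ n : Fin 2 → ℤ, (θ + fun i => n i * (2 * Real.pi)) ∈ square := by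
  refine ⟨fun i => -toIcoDiv Real.two_pi_pos 0 (θ i), fun i _ => ?_⟩
  have h := toIcoMod_mem_Ico Real.two_pi_pos 0 (θ i)
  rw [zero_add, toIcoMod] at h
  simpa [sub_eq_add_neg] using h

theorem AssumptionA1.le_norm (hA1 : AssumptionA1 Γ C₀) (hΓ : Biperiodic Γ) (θ η : Fin 2 → ℝ) :
    C₀ * zeta (θ - η) ≤ ‖WithLp.toLp 2 (Γ θ - Γ η)‖ := by
  obtain ⟨m, hm⟩ := exists_add_mem_square θ
  obtain ⟨n, hn⟩ := exists_add_mem_square η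
  have h := hA1.2 _ hm _ hn
  rw [hΓ.isBiperiodic.add_zsmul, hΓ.isBiperiodic.add_zsmul] at h
  have h1 : ((θ + fun i => m i * (2 * Real.pi)) - (η + fun i => n i * (2 * Real.pi)) : Fin 2 → ℝ) =
      (θ - η) + fun i => ((m - n) i : ℤ) * (2 * Real.pi) := by
    ext i
    simp only [Pi.sub_apply, Pi.add_apply, Int.cast_sub]
    ring
  rwa [h1, isBiperiodic_zeta.add_zsmul] at h

theorem AssumptionA2.analyticOnNhd (hA2 : AssumptionA2 Γ R₀ γ) (j : Fin 3) :
    AnalyticOnNhd ℂ (γ j) (closure (strip R₀)) := (hA2.2 j).1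

theorem AssumptionA2.periodicOn (hA2 : AssumptionA2 Γ R₀ γ) (hΓ : Biperiodic Γ) (j : Fin 3) :
    PeriodicOn (γ j) (strip R₀) := by
  refine periodicOn_of_realPoint ((hA2.analyticOnNhd j).mono subset_closure) fun θ i => ?_
  simp only [(hA2.2 j).2, hΓ θ i]

theorem AssumptionA2.increment_realPoint (hA2 : AssumptionA2 Γ R₀ γ) (j : Fin 3)
    (t η : Fin 2 → ℝ) :
    increment (γ j) t (realPoint η) = ((Γ (η + t) - Γ η) j : ℝ) := by
  rw [increment, ← realPoint_add, (hA2.2 j).2, (hA2.2 j).2]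
  simp

theorem PeriodicOn.increment_add {R : ℝ} {f : EuclideanSpace ℂ (Fin 2) → ℂ}
    (hf : PeriodicOn f (strip R)) (t : Fin 2 → ℝ) (n : Fin 2 → ℤ) {z : EuclideanSpace ℂ (Fin 2)}
    (hz : z ∈ strip R) : increment f (t + fun i => n i * (2 * Real.pi)) z = increment f t z := by
  rw [increment, increment, realPoint_add, ← add_assoc, hf _ ((add_realPoint_mem_strip t).2 hz)]

theorem PeriodicOn.increment {R : ℝ} {f : EuclideanSpace ℂ (Fin 2) → ℂ}
    (hf : PeriodicOn f (strip R)) (t : Fin 2 → ℝ) : PeriodicOn (increment f t) (strip R) := by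
  intro z hz n
  rw [FastFourierGalerkin.increment, FastFourierGalerkin.increment, hf z hz,
    add_right_comm, hf _ ((add_realPoint_mem_strip t).2 hz)]

/-- The analytic continuation of `η ↦ ‖Γ(η + t) - Γ(η)‖²`. -/
noncomputable def sqDist (γ : Fin 3 → EuclideanSpace ℂ (Fin 2) → ℂ) (t : Fin 2 → ℝ)
    (z : EuclideanSpace ℂ (Fin 2)) : ℂ :=
  ∑ j, increment (γ j) t z ^ 2

/-- The partial derivatives of the analytic continuation of `Γ`. -/
noncomputable def tangent (γ : Fin 3 → EuclideanSpace ℂ (Fin 2) → ℂ) (i : Fin 2)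
    (z : EuclideanSpace ℂ (Fin 2)) : Fin 3 → ℂ :=
  fun j => fderiv ℂ (γ j) z (realPoint (Pi.single i 1))

/-- The analytic continuation of `∂₀Γ × ∂₁Γ`. -/
noncomputable def normalVec (γ : Fin 3 → EuclideanSpace ℂ (Fin 2) → ℂ)
    (z : EuclideanSpace ℂ (Fin 2)) : Fin 3 → ℂ :=
  crossProduct (tangent γ 0 z) (tangent γ 1 z)

/-- The analytic continuation of the numerator of `η ↦ K(η + t, η)`. -/
noncomputable def numerator (γ : Fin 3 → EuclideanSpace ℂ (Fin 2) → ℂ) (t : Fin 2 → ℝ)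
    (z : EuclideanSpace ℂ (Fin 2)) : ℂ :=
  (fun j => increment (γ j) t z) ⬝ᵥ normalVec γ z

/-- The analytic continuation of `η ↦ K(η + t, η)`. -/
noncomputable def shiftedKernel (γ : Fin 3 → EuclideanSpace ℂ (Fin 2) → ℂ) (t : Fin 2 → ℝ)
    (z : EuclideanSpace ℂ (Fin 2)) : ℂ :=
  -(1 / (2 * Real.pi)) * (numerator γ t z / sqDist γ t z ^ ((3 / 2 : ℝ) : ℂ))

theorem norm_sub_rePart_le {r : ℝ} {z : EuclideanSpace ℂ (Fin 2)} (hz : z ∈ strip r) :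
    ‖z - rePart z‖ ≤ Real.sqrt 2 * r := by
  have hr : 0 < r := (abs_nonneg _).trans_lt (hz 0)
  have h1 (i : Fin 2) : ‖(z - rePart z) i‖ ^ 2 ≤ r ^ 2 := by
    have : (z - rePart z) i = (z i).im * Complex.I := by
      apply Complex.ext <;> simp [rePart, realPoint]
    rw [this, norm_mul, Complex.norm_I, mul_one, Complex.norm_real, Real.norm_eq_abs]
    exact pow_le_pow_left₀ (abs_nonneg _) (hz i).le 2
  rw [EuclideanSpace.norm_eq]
  refine Real.sqrt_le_iff.2 ⟨by positivity, ?_⟩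
  rw [mul_pow, Real.sq_sqrt zero_le_two, Fin.sum_univ_two]
  linarith [h1 0, h1 1]

theorem sum_M0comp_mul_M1comp_le :
    ∑ j, M0comp R₀ (γ j) * M1comp R₀ (γ j) ≤ M0 R₀ γ * M1 R₀ γ :=
  Real.sum_mul_le_sqrt_mul_sqrt _ _ _

theorem AssumptionA2.re_sqDist_realPoint (hA2 : AssumptionA2 Γ R₀ γ) (t η : Fin 2 → ℝ) :
    sqDist γ t (realPoint η) = (‖WithLp.toLp 2 (Γ (η + t) - Γ η)‖ ^ 2 : ℝ) := by
  rw [EuclideanSpace.norm_eq, Real.sq_sqrt (by positivity), sqDist]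
  simp [hA2.increment_realPoint]

/-- Each difference of squares factors into a sum, bounded through M₀, and a difference, bounded
through M₁ and ‖Im z‖ ≤ √2 r. Cauchy–Schwarz over the three components gives M₀ M₁. -/
theorem AssumptionA2.norm_sqDist_sub_le (hA2 : AssumptionA2 Γ R₀ γ) (hΓ : Biperiodic Γ) {r : ℝ}
    (hr : r ≤ R₀) {z : EuclideanSpace ℂ (Fin 2)} (hz : z ∈ strip r) (t : Fin 2 → ℝ) :
    ‖sqDist γ t z - sqDist γ t (rePart z)‖ ≤
      Real.sqrt 2 * r * (M0 R₀ γ * M1 R₀ γ) * ‖realPoint t‖ ^ 2 := by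
  have hz' : z ∈ strip R₀ := strip_mono hr hz
  have hr0 : 0 < r := (abs_nonneg _).trans_lt (hz 0)
  have h1 (j : Fin 3) : ‖increment (γ j) t z ^ 2 - increment (γ j) t (rePart z) ^ 2‖ ≤
      (M0comp R₀ (γ j) * M1comp R₀ (γ j)) * (Real.sqrt 2 * r * ‖realPoint t‖ ^ 2) := by
    have ha := norm_increment_add_le (hA2.analyticOnNhd j) (hA2.periodicOn hΓ j) hz' t
    have hb := norm_increment_sub_le (hA2.analyticOnNhd j) (hA2.periodicOn hΓ j) hz' t
    have hm := M1comp_nonneg (R := R₀) (f := γ j)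
    rw [sq_sub_sq, norm_mul]
    calc _ ≤ (M0comp R₀ (γ j) * ‖realPoint t‖) *
        (M1comp R₀ (γ j) * (Real.sqrt 2 * r) * ‖realPoint t‖) := by
          refine mul_le_mul ha (hb.trans ?_) (norm_nonneg _)
            (mul_nonneg M0comp_nonneg (norm_nonneg _))
          gcongr
          exact norm_sub_rePart_le hz
      _ = _ := by ring
  rw [sqDist, sqDist, ← Finset.sum_sub_distrib]
  refine (norm_sum_le _ _).trans ((Finset.sum_le_sum fun j _ => h1 j).trans ?_)
  rw [← Finset.sum_mul]
  calc _ ≤ (M0 R₀ γ * M1 R₀ γ) * (Real.sqrt 2 * r * ‖realPoint t‖ ^ 2) := by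
        gcongr
        exact sum_M0comp_mul_M1comp_le
    _ = _ := by ring

/-- After t is replaced by its shortest representative modulo periods, the deviation from the value
at Re z is a multiple of ζ(t)², and (A1) bounds that real value from below. This is the origin of
the threshold C₀²/(√2 M₀ M₁). -/
theorem AssumptionA2.re_sqDist_ge (hA2 : AssumptionA2 Γ R₀ γ) (hA1 : AssumptionA1 Γ C₀)
    (hΓ : Biperiodic Γ) {r : ℝ} (hr : r ≤ R₀) {z : EuclideanSpace ℂ (Fin 2)} (hz : z ∈ strip r)
    (t : Fin 2 → ℝ) :
    (C₀ ^ 2 - Real.sqrt 2 * r * (M0 R₀ γ * M1 R₀ γ)) * zeta t ^ 2 ≤ (sqDist γ t z).re := by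
  obtain ⟨n, hn⟩ := exists_norm_add_eq_zeta t
  have h1 : sqDist γ t z = sqDist γ (t + fun i => n i * (2 * Real.pi)) z := by
    simp only [sqDist, (hA2.periodicOn hΓ _).increment_add t n (strip_mono hr hz)]
  have h2 := hA2.norm_sqDist_sub_le hΓ hr hz (t + fun i => n i * (2 * Real.pi))
  have h3 := hA2.re_sqDist_realPoint (t + fun i => n i * (2 * Real.pi)) fun i => (z i).re
  have h4 := hA1.le_norm hΓ ((fun i => (z i).re) + (t + fun i => n i * (2 * Real.pi)))
    fun i => (z i).re
  rw [add_sub_cancel_left, isBiperiodic_zeta.add_zsmul] at h4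
  have h5 := pow_le_pow_left₀ (mul_nonneg hA1.1.le (zeta_nonneg t)) h4 2
  rw [hn] at h2
  rw [h1]
  have h6 := (abs_le.1 ((Complex.abs_re_le_norm _).trans h2)).1
  rw [Complex.sub_re, rePart, h3, Complex.ofReal_re] at h6
  rw [mul_pow] at h5
  linarith

theorem realPoint_eq_sum (t : Fin 2 → ℝ) :
    realPoint t = (t 0 : ℂ) • realPoint (Pi.single 0 1) +
      (t 1 : ℂ) • realPoint (Pi.single 1 1) := by
  ext i
  fin_cases i <;> simp [realPoint]

theorem fderiv_realPoint (z : EuclideanSpace ℂ (Fin 2)) (t : Fin 2 → ℝ) :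
    (fun j => fderiv ℂ (γ j) z (realPoint t)) =
      (t 0 : ℂ) • tangent γ 0 z + (t 1 : ℂ) • tangent γ 1 z := by
  ext j
  rw [realPoint_eq_sum]
  simp [tangent]

/-- The derivative in a real direction is a combination of the two tangent vectors, and their cross
product is orthogonal to both, also over ℂ for the bilinear dot product. -/
theorem fderiv_realPoint_dotProduct_normalVec (z : EuclideanSpace ℂ (Fin 2)) (t : Fin 2 → ℝ) :
    (fun j => fderiv ℂ (γ j) z (realPoint t)) ⬝ᵥ normalVec γ z = 0 := by
  rw [fderiv_realPoint, add_dotProduct, smul_dotProduct, smul_dotProduct, normalVec, dot_self_cross,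
    dot_cross_self]
  simp

theorem AssumptionA2.differentiableAt_tangent (hA2 : AssumptionA2 Γ R₀ γ)
    {z : EuclideanSpace ℂ (Fin 2)} (hz : z ∈ closure (strip R₀)) (i : Fin 2) (j : Fin 3) :
    DifferentiableAt ℂ (fun z => tangent γ i z j) z :=
  ((hA2.analyticOnNhd j).fderiv z hz).differentiableAt.clm_apply (differentiableAt_const _)

theorem AssumptionA2.differentiableAt_normalVec (hA2 : AssumptionA2 Γ R₀ γ)
    {z : EuclideanSpace ℂ (Fin 2)} (hz : z ∈ closure (strip R₀)) (j : Fin 3) :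
    DifferentiableAt ℂ (fun z => normalVec γ z j) z := by
  have h := hA2.differentiableAt_tangent hz
  have key (i k : Fin 3) : DifferentiableAt ℂ
      (fun z => tangent γ 0 z i * tangent γ 1 z k - tangent γ 0 z k * tangent γ 1 z i) z :=
    ((h 0 i).mul (h 1 k)).sub ((h 0 k).mul (h 1 i))
  simp only [normalVec, cross_apply]
  fin_cases j
  · exact key 1 2
  · exact key 2 0
  · exact key 0 1

theorem AssumptionA2.periodicOn_normalVec (hA2 : AssumptionA2 Γ R₀ γ) (hΓ : Biperiodic Γ) :
    PeriodicOn (normalVec γ) (strip R₀) := by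
  intro z hz n
  have h (i : Fin 2) : tangent γ i (z + realPoint fun i => n i * (2 * Real.pi)) =
      tangent γ i z := by
    ext j
    rw [tangent, tangent, (hA2.periodicOn hΓ j).fderiv z hz n]
  rw [normalVec, normalVec, h, h]

/-- The first-order term of the increment may be subtracted at no cost, and the Taylor remainder is
quadratic. This gain of one order makes the kernel weakly singular. -/
theorem AssumptionA2.exists_norm_numerator_le (hA2 : AssumptionA2 Γ R₀ γ) (hΓ : Biperiodic Γ) :
    ∃ C, 0 ≤ C ∧ ∀ z ∈ strip R₀, ∀ t, ‖numerator γ t z‖ ≤ C * zeta t ^ 2 := by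
  obtain ⟨B, hB⟩ := (hA2.periodicOn_normalVec hΓ).exists_norm_le
    (continuousOn_pi.2 fun j z hz =>
      (hA2.differentiableAt_normalVec hz j).continuousAt.continuousWithinAt)
  have hB0 : 0 ≤ B := (norm_nonneg _).trans (hB _ (realPoint_mem_strip hA2.1 0))
  refine ⟨∑ j, M1comp R₀ (γ j) * B,
    Finset.sum_nonneg fun j _ => mul_nonneg M1comp_nonneg hB0, fun z hz t => ?_⟩
  obtain ⟨n, hn⟩ := exists_norm_add_eq_zeta t
  have h1 : numerator γ t z = numerator γ (t + fun i => n i * (2 * Real.pi)) z := by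
    simp only [numerator, (hA2.periodicOn hΓ _).increment_add t n hz]
  rw [h1, ← hn]
  generalize (t + fun i => n i * (2 * Real.pi)) = s
  rw [numerator, ← sub_zero (dotProduct _ _), ← fderiv_realPoint_dotProduct_normalVec z s,
    ← sub_dotProduct, dotProduct, Finset.sum_mul]
  refine norm_sum_le_of_le _ fun j _ => ?_
  rw [norm_mul, mul_right_comm]
  refine mul_le_mul (norm_increment_sub_fderiv_le (hA2.analyticOnNhd j) (hA2.periodicOn hΓ j) hz s)
    ((norm_le_pi_norm _ j).trans (hB z hz)) (norm_nonneg _)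
    (mul_nonneg M1comp_nonneg (by positivity))

theorem AssumptionA2.exists_norm_shiftedKernel_le (hA2 : AssumptionA2 Γ R₀ γ)
    (hA1 : AssumptionA1 Γ C₀) (hΓ : Biperiodic Γ) {r : ℝ} (hr : r ≤ R₀)
    (hr' : Real.sqrt 2 * r * (M0 R₀ γ * M1 R₀ γ) < C₀ ^ 2) :
    ∃ C, 0 ≤ C ∧ ∀ z ∈ strip r, ∀ t, ‖shiftedKernel γ t z‖ ≤ C * (zeta t)⁻¹ := by
  obtain ⟨B, hB0, hB⟩ := hA2.exists_norm_numerator_le hΓ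
  set δ := C₀ ^ 2 - Real.sqrt 2 * r * (M0 R₀ γ * M1 R₀ γ) with hδ
  have hδ0 : 0 < δ := sub_pos.2 hr'
  have hpi := Real.pi_pos
  refine ⟨1 / (2 * Real.pi) * (B / δ ^ (3 / 2 : ℝ)), by positivity, fun z hz t => ?_⟩
  have hN := hB z (strip_mono hr hz) t
  -- For t in the period lattice the numerator vanishes, and both sides are 0 because 0⁻¹ = 0.
  rcases (zeta_nonneg t).eq_or_lt with h0 | h0
  · have : numerator γ t z = 0 := by
      rw [← h0] at hN
      simpa using hN
    simp [shiftedKernel, this, ← h0]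
  have hS : δ * zeta t ^ 2 ≤ ‖sqDist γ t z‖ :=
    (hA2.re_sqDist_ge hA1 hΓ hr hz t).trans (Complex.re_le_norm _)
  have hS' : δ ^ (3 / 2 : ℝ) * zeta t ^ 3 ≤ ‖sqDist γ t z‖ ^ (3 / 2 : ℝ) := by
    have := Real.rpow_le_rpow (by positivity) hS (show (0 : ℝ) ≤ 3 / 2 by norm_num)
    rw [Real.mul_rpow hδ0.le (by positivity), ← Real.rpow_natCast, ← Real.rpow_mul h0.le] at this
    norm_num at this ⊢
    exact_mod_cast this
  have hnorm : ‖-(1 / (2 * (Real.pi : ℂ)))‖ = 1 / (2 * Real.pi) := by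
    simp [abs_of_pos hpi]
  rw [shiftedKernel, norm_mul, norm_div, Complex.norm_cpow_real, hnorm, mul_assoc]
  gcongr
  calc _ ≤ B * zeta t ^ 2 / (δ ^ (3 / 2 : ℝ) * zeta t ^ 3) := by gcongr
    _ = _ := by
      field_simp

/-- Positive real part keeps the squared distance in the slit plane, where the principal power 3/2
is holomorphic and nonzero. -/
theorem AssumptionA2.differentiableOn_shiftedKernel (hA2 : AssumptionA2 Γ R₀ γ)
    (hA1 : AssumptionA1 Γ C₀) (hΓ : Biperiodic Γ) {r : ℝ} (hr : r ≤ R₀)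
    (hr' : Real.sqrt 2 * r * (M0 R₀ γ * M1 R₀ γ) < C₀ ^ 2) {t : Fin 2 → ℝ} (ht : zeta t ≠ 0) :
    DifferentiableOn ℂ (shiftedKernel γ t) (strip r) := by
  intro z hz
  refine DifferentiableAt.differentiableWithinAt ?_
  have hz' := strip_mono hr hz
  have hinc (j : Fin 3) : DifferentiableAt ℂ (increment (γ j) t) z := by
    refine DifferentiableAt.sub ?_ (hA2.analyticOnNhd j z (subset_closure hz')).differentiableAt
    refine DifferentiableAt.comp (g := γ j) z ?_ (differentiableAt_id.add_const _)
    exact (hA2.analyticOnNhd j _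
      (subset_closure ((add_realPoint_mem_strip t).2 hz'))).differentiableAt
  have hpos : 0 < (sqDist γ t z).re :=
    (mul_pos (sub_pos.2 hr') (by positivity)).trans_le (hA2.re_sqDist_ge hA1 hΓ hr hz t)
  have hS : DifferentiableAt ℂ (sqDist γ t) z :=
    DifferentiableAt.fun_sum fun j _ => (hinc j).pow 2
  have hN : DifferentiableAt ℂ (fun z => ∑ j, increment (γ j) t z * normalVec γ z j) z :=
    DifferentiableAt.fun_sum fun j _ =>
      (hinc j).fun_mul (hA2.differentiableAt_normalVec (subset_closure hz') j)
  have hne : sqDist γ t z ^ ((3 / 2 : ℝ) : ℂ) ≠ 0 := by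
    rw [Ne, Complex.cpow_eq_zero_iff]
    rintro ⟨h, -⟩
    rw [h] at hpos
    exact lt_irrefl _ hpos
  have hP : DifferentiableAt ℂ (fun z => sqDist γ t z ^ ((3 / 2 : ℝ) : ℂ)) z :=
    hS.cpow_const (Complex.mem_slitPlane_iff.2 (Or.inl hpos))
  have hQ : DifferentiableAt ℂ (fun z => (∑ j, increment (γ j) t z * normalVec γ z j) /
      sqDist γ t z ^ ((3 / 2 : ℝ) : ℂ)) z := by
    simp only [div_eq_mul_inv]
    exact hN.fun_mul (hP.fun_inv hne)
  exact hQ.const_mul (-(1 / (2 * (Real.pi : ℂ))))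

theorem AssumptionA2.periodicOn_shiftedKernel (hA2 : AssumptionA2 Γ R₀ γ) (hΓ : Biperiodic Γ)
    (t : Fin 2 → ℝ) : PeriodicOn (shiftedKernel γ t) (strip R₀) := by
  intro z hz n
  have h1 (j : Fin 3) := (hA2.periodicOn hΓ j).increment t z hz n
  simp only [shiftedKernel, numerator, sqDist, h1, hA2.periodicOn_normalVec hΓ z hz n]

/-- `realPoint` as a continuous `ℝ`-linear map. -/
noncomputable def realPointCLM : (Fin 2 → ℝ) →L[ℝ] EuclideanSpace ℂ (Fin 2) :=
  LinearMap.toContinuousLinearMap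
    { toFun := realPoint
      map_add' := realPoint_add
      map_smul' := fun c θ => by
        ext i
        simp [realPoint] }

theorem AssumptionA2.partialGamma_eq (hA2 : AssumptionA2 Γ R₀ γ) (i : Fin 2) (η : Fin 2 → ℝ)
    (j : Fin 3) : (partialGamma Γ i η j : ℂ) = tangent γ i (realPoint η) j := by
  have hη := subset_closure (realPoint_mem_strip hA2.1 η)
  have h1 : HasFDerivAt (fun θ => (Γ θ j : ℂ))
      (((fderiv ℂ (γ j) (realPoint η)).restrictScalars ℝ).comp realPointCLM) η := by
    have h2 := (((hA2.analyticOnNhd j _ hη).differentiableAt.hasFDerivAt).restrictScalars ℝ).comp η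
      realPointCLM.hasFDerivAt
    refine h2.congr_of_eventuallyEq (Eventually.of_forall fun θ => ?_)
    exact ((hA2.2 j).2 θ).symm
  have h3 : HasFDerivAt (fun θ => Γ θ j) (Complex.reCLM.comp
      (((fderiv ℂ (γ j) (realPoint η)).restrictScalars ℝ).comp realPointCLM)) η :=
    Complex.reCLM.hasFDerivAt.comp η h1
  have h4 : HasFDerivAt (fun θ => (Γ θ j : ℂ)) (Complex.ofRealCLM.comp
      (fderiv ℝ (fun θ => Γ θ j) η)) η :=
    Complex.ofRealCLM.hasFDerivAt.comp η h3.differentiableAt.hasFDerivAt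
  exact congrArg (fun L : (Fin 2 → ℝ) →L[ℝ] ℂ => L (Pi.single i 1)) (h4.unique h1)

theorem AssumptionA2.kernelK_eq (hA2 : AssumptionA2 Γ R₀ γ) (t η : Fin 2 → ℝ) :
    kernelK Γ (η + t) η = shiftedKernel γ t (realPoint η) := by
  have h1 (i : Fin 2) : (fun j => (partialGamma Γ i η j : ℂ)) = tangent γ i (realPoint η) :=
    funext fun j => hA2.partialGamma_eq i η j
  have h2 : ‖WithLp.toLp 2 (Γ (η + t) - Γ η)‖ ^ 3 =
      (‖WithLp.toLp 2 (Γ (η + t) - Γ η)‖ ^ 2) ^ (3 / 2 : ℝ) := by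
    rw [← Real.rpow_natCast, ← Real.rpow_natCast, ← Real.rpow_mul (norm_nonneg _)]
    norm_num
  rw [shiftedKernel, hA2.re_sqDist_realPoint, ← Complex.ofReal_cpow (by positivity), ← h2,
    numerator, normalVec, ← h1, ← h1, kernelK]
  simp only [hA2.increment_realPoint]
  push_cast
  simp [cross_apply, dotProduct, Fin.sum_univ_three]

theorem AssumptionA2.continuous_coord (hA2 : AssumptionA2 Γ R₀ γ) (j : Fin 3) :
    Continuous fun θ => Γ θ j := by
  have h : (fun θ => Γ θ j) = fun θ => (γ j (realPoint θ)).re := by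
    ext θ
    rw [(hA2.2 j).2, Complex.ofReal_re]
  rw [h]
  refine Complex.continuous_re.comp (continuous_iff_continuousAt.2 fun θ => ?_)
  exact ContinuousAt.comp (g := γ j) (hA2.analyticOnNhd j _
    (subset_closure (realPoint_mem_strip hA2.1 θ))).continuousAt continuous_realPoint.continuousAt

theorem AssumptionA2.continuous_partialGamma (hA2 : AssumptionA2 Γ R₀ γ) (i : Fin 2) (j : Fin 3) :
    Continuous fun η => partialGamma Γ i η j := by
  have h : (fun η => partialGamma Γ i η j) = fun η => (tangent γ i (realPoint η) j).re := by
    ext η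
    rw [← hA2.partialGamma_eq, Complex.ofReal_re]
  rw [h]
  refine Complex.continuous_re.comp (continuous_iff_continuousAt.2 fun θ => ?_)
  exact ContinuousAt.comp (g := fun z => tangent γ i z j) (hA2.differentiableAt_tangent
    (subset_closure (realPoint_mem_strip hA2.1 θ)) i j).continuousAt
    continuous_realPoint.continuousAt

theorem AssumptionA2.measurable_kernelK (hA2 : AssumptionA2 Γ R₀ γ) :
    Measurable (Function.uncurry (kernelK Γ)) := by
  have h1 (j : Fin 3) := (hA2.continuous_coord j).measurable
  have h2 (i : Fin 2) (j : Fin 3) := (hA2.continuous_partialGamma i j).measurable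
  have h3 (j : Fin 3) : Measurable fun z : (Fin 2 → ℝ) × (Fin 2 → ℝ) => Γ z.1 j - Γ z.2 j :=
    ((h1 j).comp measurable_fst).sub ((h1 j).comp measurable_snd)
  have h4 (i : Fin 2) (j : Fin 3) :
      Measurable fun z : (Fin 2 → ℝ) × (Fin 2 → ℝ) => partialGamma Γ i z.2 j :=
    (h2 i j).comp measurable_snd
  unfold Function.uncurry kernelK
  simp only [EuclideanSpace.norm_eq, cross_apply, dotProduct, Fin.sum_univ_three,
    Matrix.cons_val_zero, Matrix.cons_val_one, Matrix.cons_val, Pi.sub_apply]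
  fun_prop

theorem AssumptionA2.exists_norm_kernelK_le (hA2 : AssumptionA2 Γ R₀ γ)
    (hA1 : AssumptionA1 Γ C₀) (hΓ : Biperiodic Γ) {r : ℝ} (hr0 : 0 < r) (hr : r ≤ R₀)
    (hr' : Real.sqrt 2 * r * (M0 R₀ γ * M1 R₀ γ) < C₀ ^ 2) :
    ∃ C, ∀ θ η, ‖kernelK Γ θ η‖ ≤ C * (zeta (θ - η))⁻¹ := by
  obtain ⟨C, -, hC⟩ := hA2.exists_norm_shiftedKernel_le hA1 hΓ hr hr'
  refine ⟨C, fun θ η => ?_⟩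
  have h := hC _ (realPoint_mem_strip hr0 η) (θ - η)
  rwa [← hA2.kernelK_eq, add_sub_cancel] at h

end ComplexKernel

/-! ### Contour shifts and exponential decay of the Fourier coefficients in η. -/

section ContourShift

/-- Cauchy's theorem on a rectangle one period wide; the vertical sides cancel by periodicity. -/
theorem intervalIntegral_eq_shift {r : ℝ} {g : ℂ → ℂ}
    (hg : DifferentiableOn ℂ g {s | |s.im| < r})
    (hper : ∀ s : ℂ, |s.im| < r → g (s + 2 * Real.pi) = g s) {y : ℝ} (hy : |y| < r) :
    ∫ x in (0 : ℝ)..2 * Real.pi, g (x + y * Complex.I) = ∫ x in (0 : ℝ)..2 * Real.pi, g x := by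
  have hbd : ∀ v ∈ uIcc 0 y, |v| < r := by
    intro v hv
    rcases le_total 0 y with h | h
    · rw [uIcc_of_le h] at hv
      rw [abs_of_nonneg h] at hy
      rw [abs_of_nonneg hv.1]
      exact hv.2.trans_lt hy
    · rw [uIcc_of_ge h] at hv
      rw [abs_of_nonpos h] at hy
      rw [abs_of_nonpos hv.2]
      linarith [hv.1]
  have h := Complex.integral_boundary_rect_eq_zero_of_differentiableOn g 0
    ((2 * Real.pi : ℝ) + y * Complex.I) (hg.mono fun s hs => by
      refine hbd _ ?_
      simpa using hs.2)
  simp only [Complex.zero_re, Complex.zero_im, Complex.add_re, Complex.ofReal_re, Complex.mul_re,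
    Complex.I_re, mul_zero, Complex.ofReal_im, Complex.I_im, mul_one, sub_self, add_zero,
    Complex.add_im, Complex.mul_im, zero_add, Complex.ofReal_zero, zero_mul] at h
  have h2 : ∫ v in (0 : ℝ)..y, g ((2 * Real.pi : ℝ) + v * Complex.I) =
      ∫ v in (0 : ℝ)..y, g (v * Complex.I) := by
    refine intervalIntegral.integral_congr fun v hv => ?_
    rw [← hper (v * Complex.I) (by simpa using hbd v hv)]
    congr 1
    push_cast
    ring
  rw [h2, add_sub_cancel_right] at h
  exact (sub_eq_zero.1 h).symm

variable {r : ℝ} {F : EuclideanSpace ℂ (Fin 2) → ℂ}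

theorem realPoint_add_I_smul_mem_strip {y : Fin 2 → ℝ} (hy : ∀ i, |y i| < r) (x : Fin 2 → ℝ) :
    realPoint x + Complex.I • realPoint y ∈ strip r := by
  intro i
  simpa [realPoint] using hy i

theorem continuous_comp_realPoint_add (hF : ContinuousOn F (strip r)) {y : Fin 2 → ℝ}
    (hy : ∀ i, |y i| < r) : Continuous fun x => F (realPoint x + Complex.I • realPoint y) :=
  hF.comp_continuous (continuous_realPoint.add continuous_const)
    fun x => realPoint_add_I_smul_mem_strip hy x

theorem integrable_squareMeasure_of_continuous {f : (Fin 2 → ℝ) → ℂ} (hf : Continuous f) :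
    Integrable f squareMeasure := by
  have h : IntegrableOn f (Icc 0 fun _ => 2 * Real.pi) volume :=
    hf.continuousOn.integrableOn_compact isCompact_Icc
  refine h.mono_set fun x hx => ⟨fun i => (hx i (mem_univ i)).1, fun i => (hx i (mem_univ i)).2.le⟩

theorem integral_square_eq (i : Fin 2) {f : (Fin 2 → ℝ) → ℂ} (hf : Continuous f) :
    ∫ x, f x ∂squareMeasure = ∫ u, (∫ a in (0 : ℝ)..2 * Real.pi, f (i.insertNth a u))
      ∂(Measure.pi fun _ : Fin 1 => volume.restrict (Ico 0 (2 * Real.pi))) := by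
  have hpi : squareMeasure = Measure.pi fun _ : Fin 2 => volume.restrict (Ico 0 (2 * Real.pi)) :=
    Measure.restrict_pi_pi _ _
  have hint := integrable_squareMeasure_of_continuous hf
  rw [hpi] at hint ⊢
  have hmp := (measurePreserving_piFinSuccAbove
    (fun _ : Fin 2 => (volume : Measure ℝ).restrict (Ico 0 (2 * Real.pi))) i).symm
  rw [← hmp.integrable_comp_emb (MeasurableEquiv.measurableEmbedding _)] at hint
  rw [← hmp.integral_comp (MeasurableEquiv.measurableEmbedding _)]
  refine (integral_prod_symm _ hint).trans ?_
  refine integral_congr_ae (Eventually.of_forall fun u => ?_)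
  simp only
  rw [intervalIntegral.integral_of_le Real.two_pi_pos.le, ← restrict_Ico_eq_restrict_Ioc]
  rfl

theorem integral_update_eq (hF : DifferentiableOn ℂ F (strip r)) (hper : PeriodicOn F (strip r))
    {y : Fin 2 → ℝ} (hy : ∀ i, |y i| < r) (i : Fin 2) :
    ∫ x, F (realPoint x + Complex.I • realPoint y) ∂squareMeasure =
      ∫ x, F (realPoint x + Complex.I • realPoint (Function.update y i 0)) ∂squareMeasure := by
  have hr : 0 < r := (abs_nonneg _).trans_lt (hy 0)
  have hy' : ∀ j, |Function.update y i 0 j| < r := by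
    intro j
    rcases eq_or_ne j i with rfl | h
    · simpa using hr
    · simpa [h] using hy j
  rw [integral_square_eq i (continuous_comp_realPoint_add hF.continuousOn hy),
    integral_square_eq i (continuous_comp_realPoint_add hF.continuousOn hy')]
  refine integral_congr_ae (Eventually.of_forall fun u => ?_)
  simp only
  -- With the other coordinate frozen in p, the line p + s e reduces the shift in coordinate i to
  -- the one-variable case.
  let e : EuclideanSpace ℂ (Fin 2) := realPoint (Pi.single i 1)
  let p : EuclideanSpace ℂ (Fin 2) := realPoint (i.insertNth 0 u) +
    Complex.I • realPoint (Function.update y i 0)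
  have hei (s : ℂ) (j : Fin 2) : (p + s • e) j = if j = i then s else p j := by
    rcases eq_or_ne j i with rfl | h
    · simp [p, e, realPoint]
    · simp [e, realPoint, h]
  have hmem (s : ℂ) (hs : |s.im| < r) : p + s • e ∈ strip r := by
    intro j
    rw [hei]
    split_ifs with h
    · exact hs
    · exact realPoint_add_I_smul_mem_strip hy' _ j
  have hg : DifferentiableOn ℂ (fun s : ℂ => F (p + s • e)) {s | |s.im| < r} := by
    refine hF.comp (fun s _ => ?_) hmem
    exact ((differentiableAt_id.smul_const e).const_add p).differentiableWithinAt
  have hgper (s : ℂ) (hs : |s.im| < r) : F (p + (s + 2 * Real.pi) • e) = F (p + s • e) := by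
    rw [← hper _ (hmem s hs) (Pi.single i 1)]
    congr 1
    ext j
    change (p + (s + 2 * Real.pi) • e) j = (p + s • e) j + _
    rw [hei, hei]
    rcases eq_or_ne j i with rfl | h
    · simp [realPoint]
    · simp [realPoint, h]
  have hfun (w : ℝ) (y' : Fin 2 → ℝ) (hw : y' i = w) (hyy : ∀ j, j ≠ i → y' j = y j) (a : ℝ) :
      realPoint (i.insertNth a u) + Complex.I • realPoint y' =
        p + ((a : ℂ) + w * Complex.I) • e := by
    ext j
    rw [hei]
    rcases eq_or_ne j i with rfl | h
    · simp [realPoint, hw, mul_comm]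
    · obtain ⟨k, rfl⟩ := Fin.exists_succAbove_eq h
      simp [realPoint, p, hyy _ h, h]
  simp only [hfun (y i) y rfl (fun _ _ => rfl), hfun 0 (Function.update y i 0) (by simp)
    (fun j hj => by simp [hj])]
  rw [intervalIntegral_eq_shift hg hgper (hy i)]
  simp

/-- The integral over the square of a periodic analytic function does not change when the domain
of integration is shifted in imaginary direction. -/
theorem integral_shift_eq (hF : DifferentiableOn ℂ F (strip r)) (hper : PeriodicOn F (strip r))
    {y : Fin 2 → ℝ} (hy : ∀ i, |y i| < r) :
    ∫ x, F (realPoint x + Complex.I • realPoint y) ∂squareMeasure =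
      ∫ x, F (realPoint x) ∂squareMeasure := by
  have hr : 0 < r := (abs_nonneg _).trans_lt (hy 0)
  have hy' : ∀ j, |Function.update y 0 0 j| < r := by
    intro j
    fin_cases j
    · simpa using hr
    · simpa using hy 1
  have h0 : Function.update (Function.update y 0 0) 1 0 = 0 := by
    ext j
    fin_cases j <;> simp
  rw [integral_update_eq hF hper hy 0, integral_update_eq hF hper hy' 1, h0]
  have : realPoint 0 = 0 := by
    ext j
    simp [realPoint]
  simp [this]

/-- The analytic continuation of `fourierFun`. -/
noncomputable def complexFourierFun (m : Fin 2 → ℤ) (z : EuclideanSpace ℂ (Fin 2)) : ℂ :=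
  ∏ i, ((1 / Real.sqrt (2 * Real.pi) : ℝ) : ℂ) * Complex.exp (Complex.I * (m i : ℂ) * z i)

theorem complexFourierFun_realPoint (m : Fin 2 → ℤ) (θ : Fin 2 → ℝ) :
    complexFourierFun m (realPoint θ) = fourierFun m θ := rfl

theorem periodicOn_complexFourierFun (m : Fin 2 → ℤ) (s : Set (EuclideanSpace ℂ (Fin 2))) :
    PeriodicOn (complexFourierFun m) s := by
  intro z _ n
  refine Finset.prod_congr rfl fun i _ => ?_
  congr 1
  have : Complex.I * (m i : ℂ) * (z + realPoint fun i => n i * (2 * Real.pi)) i =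
      Complex.I * (m i : ℂ) * z i + ((m i * n i : ℤ) : ℂ) * (2 * Real.pi * Complex.I) := by
    simp [realPoint]
    ring
  rw [this, Complex.exp_add, Complex.exp_int_mul_two_pi_mul_I, mul_one]

theorem differentiable_complexFourierFun (m : Fin 2 → ℤ) :
    Differentiable ℂ (complexFourierFun m) := by
  unfold complexFourierFun
  simp only [Fin.prod_univ_two]
  fun_prop

theorem norm_complexFourierFun (m : Fin 2 → ℤ) (x y : Fin 2 → ℝ) :
    ‖complexFourierFun m (realPoint x + Complex.I • realPoint y)‖ =
      (2 * Real.pi)⁻¹ * Real.exp (-∑ i, m i * y i) := by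
  have h (i : Fin 2) : ‖((1 / Real.sqrt (2 * Real.pi) : ℝ) : ℂ) *
      Complex.exp (Complex.I * (m i : ℂ) *
      (realPoint x + Complex.I • realPoint y) i)‖ =
      (Real.sqrt (2 * Real.pi))⁻¹ * Real.exp (-(m i * y i)) := by
    rw [norm_mul, Complex.norm_exp, Complex.norm_real, Real.norm_of_nonneg (by positivity), one_div]
    simp [realPoint]
  rw [complexFourierFun, norm_prod, Finset.prod_congr rfl fun i _ => h i, Finset.prod_mul_distrib,
    ← Real.exp_sum, Finset.sum_neg_distrib, Fin.prod_univ_two, ← mul_inv,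
    Real.mul_self_sqrt Real.two_pi_pos.le]

variable {Γ : (Fin 2 → ℝ) → Fin 3 → ℝ} {C₀ R₀ : ℝ} {γ : Fin 3 → EuclideanSpace ℂ (Fin 2) → ℂ}

/-- The Fourier coefficients of the function `η ↦ K(η + t, η)`. -/
noncomputable def diagCoef (Γ : (Fin 2 → ℝ) → Fin 3 → ℝ) (m : Fin 2 → ℤ) (t : Fin 2 → ℝ) : ℂ :=
  ∫ η, kernelK Γ (η + t) η * fourierFun m η ∂squareMeasure

theorem AssumptionA2.exists_norm_diagCoef_le (hA2 : AssumptionA2 Γ R₀ γ)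
    (hA1 : AssumptionA1 Γ C₀) (hΓ : Biperiodic Γ) {β r : ℝ} (hβ : 0 < β) (hβr : β < r) (hr : r ≤ R₀)
    (hr' : Real.sqrt 2 * r * (M0 R₀ γ * M1 R₀ γ) < C₀ ^ 2) :
    ∃ C, 0 ≤ C ∧ ∀ m t, ‖diagCoef Γ m t‖ ≤ C * Real.exp (-β * ∑ i, |(m i : ℝ)|) * (zeta t)⁻¹ := by
  obtain ⟨C, hC0, hC⟩ := hA2.exists_norm_shiftedKernel_le hA1 hΓ hr hr'
  have hpi := Real.pi_pos
  refine ⟨C * (2 * Real.pi)⁻¹ * squareMeasure.real univ, by positivity, fun m t => ?_⟩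
  rcases eq_or_ne (zeta t) 0 with h0 | h0
  · have : ∀ η, kernelK Γ (η + t) η = 0 := by
      intro η
      have := hC _ (realPoint_mem_strip (hβ.trans hβr) η) t
      rw [← hA2.kernelK_eq, h0, inv_zero, mul_zero] at this
      exact norm_le_zero_iff.1 this
    simp [diagCoef, this, h0]
  -- The sign makes m · y = β‖m‖₁, so the character shrinks by e^{-β‖m‖₁}. The strict inequality β <
  -- r keeps the shifted contour inside the open strip.
  let y (i : Fin 2) : ℝ := β * SignType.sign (m i : ℝ)
  have hy (i : Fin 2) : |y i| < r := by
    refine lt_of_le_of_lt ?_ hβr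
    rw [abs_mul, abs_of_pos hβ]
    refine mul_le_of_le_one_right hβ.le ?_
    rcases lt_trichotomy (m i : ℝ) 0 with h | h | h <;> simp [h]
  have hd : DifferentiableOn ℂ (fun z => shiftedKernel γ t z * complexFourierFun m z) (strip r) :=
    (hA2.differentiableOn_shiftedKernel hA1 hΓ hr hr' h0).mul
      (differentiable_complexFourierFun m).differentiableOn
  have hp : PeriodicOn (fun z => shiftedKernel γ t z * complexFourierFun m z) (strip r) := by
    intro z hz n
    simp only [hA2.periodicOn_shiftedKernel hΓ t z (strip_mono hr hz) n,
      periodicOn_complexFourierFun m _ z hz n]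
  have h1 : diagCoef Γ m t = ∫ x, shiftedKernel γ t (realPoint x) *
      complexFourierFun m (realPoint x) ∂squareMeasure := by
    simp only [diagCoef, hA2.kernelK_eq, complexFourierFun_realPoint]
  rw [h1, ← integral_shift_eq hd hp hy]
  have hsum : ∑ i, (m i : ℝ) * y i = β * ∑ i, |(m i : ℝ)| := by
    rw [Finset.mul_sum]
    refine Finset.sum_congr rfl fun i _ => ?_
    rw [← self_mul_sign (m i : ℝ)]
    ring
  refine (norm_integral_le_of_norm_le_const (C := C * (zeta t)⁻¹ *
    ((2 * Real.pi)⁻¹ * Real.exp (-β * ∑ i, |(m i : ℝ)|)))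
    (Eventually.of_forall fun x => ?_)).trans_eq (by ring)
  rw [norm_mul, norm_complexFourierFun, hsum, neg_mul]
  gcongr
  exact hC _ (realPoint_add_I_smul_mem_strip hy x) t

end ContourShift

/-! ### Matrix entries: decay off the diagonal and along each diagonal. -/

section Entries

/-- After the substitution θ = η + t the variable η carries only the frequency l - k, which is why
the decay is in the difference of the indices. -/
theorem fourierFun_neg_add_mul (k l : Fin 2 → ℤ) (η t : Fin 2 → ℝ) :
    fourierFun (-k) (η + t) * fourierFun l η = fourierFun (-k) t * fourierFun (l - k) η := by
  simp only [fourierFun, ← Finset.prod_mul_distrib]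
  refine Finset.prod_congr rfl fun i _ => ?_
  have h1 : Complex.I * (((-k) i : ℤ) : ℂ) * ((η + t) i : ℝ) =
      Complex.I * (((-k) i : ℤ) : ℂ) * (t i : ℝ) +
      Complex.I * (((-k) i : ℤ) : ℂ) * (η i : ℝ) := by
    rw [Pi.add_apply]
    push_cast
    ring
  have h2 : Complex.I * (((l - k) i : ℤ) : ℂ) * (η i : ℝ) =
      Complex.I * (((-k) i : ℤ) : ℂ) * (η i : ℝ) +
      Complex.I * ((l i : ℤ) : ℂ) * (η i : ℝ) := by
    rw [Pi.sub_apply, Pi.neg_apply]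
    push_cast
    ring
  rw [h1, h2, Complex.exp_add, Complex.exp_add]
  ring

theorem isBiperiodic_fourierFun (k : Fin 2 → ℤ) : IsBiperiodic (fourierFun k) := by
  intro θ i
  have h := periodicOn_complexFourierFun k univ (realPoint θ) (mem_univ _) (Pi.single i 1)
  rw [← realPoint_add, complexFourierFun_realPoint, complexFourierFun_realPoint] at h
  rw [← h]
  congr 2
  ext j
  rcases eq_or_ne j i with rfl | hj
  · simp
  · simp [hj]

theorem norm_fourierFun_eq (k : Fin 2 → ℤ) (θ : Fin 2 → ℝ) :
    ‖fourierFun k θ‖ = (2 * Real.pi)⁻¹ := by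
  rw [norm_fourierFun, Fin.prod_univ_two, one_div, ← mul_inv,
    Real.mul_self_sqrt Real.two_pi_pos.le]

theorem integrable_zeta_inv : Integrable (fun t => (zeta t)⁻¹) squareMeasure := by
  refine ⟨continuous_zeta.measurable.inv.aestronglyMeasurable, ?_⟩
  rw [hasFiniteIntegral_iff_ofReal (Eventually.of_forall fun t => inv_nonneg.2 (zeta_nonneg t))]
  exact lintegral_zeta_inv_lt_top

theorem integrable_prod_zeta_inv_snd :
    Integrable (fun z : (Fin 2 → ℝ) × (Fin 2 → ℝ) => (zeta z.2)⁻¹)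
      (squareMeasure.prod squareMeasure) :=
  integrable_zeta_inv.comp_snd squareMeasure

theorem integrable_prod_zeta_inv_sub :
    Integrable (fun z : (Fin 2 → ℝ) × (Fin 2 → ℝ) => (zeta (z.1 - z.2))⁻¹)
      (squareMeasure.prod squareMeasure) := by
  have hm : Measurable fun z : (Fin 2 → ℝ) × (Fin 2 → ℝ) => zeta (z.1 - z.2) :=
    continuous_zeta.measurable.comp (measurable_fst.sub measurable_snd)
  refine ⟨hm.inv.aestronglyMeasurable, ?_⟩
  rw [hasFiniteIntegral_iff_ofReal (Eventually.of_forall fun t => inv_nonneg.2 (zeta_nonneg _)),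
    lintegral_prod (fun z : (Fin 2 → ℝ) × (Fin 2 → ℝ) => ENNReal.ofReal (zeta (z.1 - z.2))⁻¹)
      hm.inv.ennreal_ofReal.aemeasurable]
  simp only [lintegral_zeta_inv_sub_left, lintegral_const]
  exact ENNReal.mul_lt_top lintegral_zeta_inv_lt_top (measure_lt_top _ _)

variable {Γ : (Fin 2 → ℝ) → Fin 3 → ℝ} {C₀ R₀ : ℝ} {γ : Fin 3 → EuclideanSpace ℂ (Fin 2) → ℂ}

theorem entryK_eq_integral_integral (hκ : Measurable (Function.uncurry (kernelK Γ)))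
    {C : ℝ} (hC : ∀ θ η, ‖kernelK Γ θ η‖ ≤ C * (zeta (θ - η))⁻¹) (k l : Fin 2 → ℤ) :
    entryK Γ k l = ∫ θ, ∫ η, fourierFun (-k) θ * (kernelK Γ θ η * fourierFun l η)
      ∂squareMeasure ∂squareMeasure := by
  rw [entryK, L2.inner_def]
  refine integral_congr_ae ?_
  filter_upwards [(memLp_fourierFun k).coeFn_toLp, integralOp_ae_eq hκ hC (fourierL2 l)]
    with θ h2 h3
  have h4 : kernelIntegral (kernelK Γ) (fourierL2 l) θ =
      ∫ η, kernelK Γ θ η * fourierFun l η ∂squareMeasure := by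
    refine integral_congr_ae ?_
    filter_upwards [(memLp_fourierFun l).coeFn_toLp] with η h5
    rw [fourierL2, h5]
  have h5 : (fourierL2 k : (Fin 2 → ℝ) → ℂ) θ = fourierFun k θ := h2
  have h6 : (opK Γ (fourierL2 l) : (Fin 2 → ℝ) → ℂ) θ =
      kernelIntegral (kernelK Γ) (fourierL2 l) θ := h3
  simp only [h5, h6, h4, RCLike.inner_apply, conj_fourierFun]
  rw [integral_const_mul, mul_comm]

theorem integrable_prod_of_norm_le {f : (Fin 2 → ℝ) × (Fin 2 → ℝ) → ℂ}
    {g h : (Fin 2 → ℝ) × (Fin 2 → ℝ) → ℂ} {w : (Fin 2 → ℝ) × (Fin 2 → ℝ) → ℝ} {C B : ℝ}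
    (hw : Integrable w (squareMeasure.prod squareMeasure))
    (hf : Measurable f) (hg : Measurable g) (hh : Measurable h)
    (hfw : ∀ z, ‖f z‖ ≤ C * w z) (hgB : ∀ z, ‖g z‖ = B) (hhB : ∀ z, ‖h z‖ = B) :
    Integrable (fun z => g z * (f z * h z)) (squareMeasure.prod squareMeasure) := by
  refine Integrable.mono' (hw.const_mul (B * C * B)) (hg.mul (hf.mul hh)).aestronglyMeasurable
    (Eventually.of_forall fun z => ?_)
  have hB : 0 ≤ B := (norm_nonneg _).trans_eq (hgB z)
  rw [norm_mul, norm_mul, hgB, hhB]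
  calc _ ≤ B * (C * w z * B) := by
        gcongr
        exact hfw z
    _ = _ := by ring

theorem integrable_prod_kernelK (hκ : Measurable (Function.uncurry (kernelK Γ)))
    {C : ℝ} (hC : ∀ θ η, ‖kernelK Γ θ η‖ ≤ C * (zeta (θ - η))⁻¹) (k l : Fin 2 → ℤ) :
    Integrable (fun z : (Fin 2 → ℝ) × (Fin 2 → ℝ) =>
      fourierFun k z.1 * (kernelK Γ z.1 z.2 * fourierFun l z.2))
      (squareMeasure.prod squareMeasure) :=
  integrable_prod_of_norm_le (f := fun z => kernelK Γ z.1 z.2) (g := fun z => fourierFun k z.1)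
    (h := fun z => fourierFun l z.2) integrable_prod_zeta_inv_sub hκ
    ((continuous_fourierFun k).measurable.comp measurable_fst)
    ((continuous_fourierFun l).measurable.comp measurable_snd) (fun z => hC z.1 z.2)
    (fun _ => norm_fourierFun_eq _ _) (fun _ => norm_fourierFun_eq _ _)

theorem measurable_comp_add {κ : (Fin 2 → ℝ) → (Fin 2 → ℝ) → ℂ}
    (hκ : Measurable (Function.uncurry κ)) :
    Measurable fun z : (Fin 2 → ℝ) × (Fin 2 → ℝ) => κ (z.1 + z.2) z.1 :=
  hκ.comp ((measurable_fst.add measurable_snd).prodMk measurable_fst)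

theorem integrable_prod_shifted_kernelK (hκ : Measurable (Function.uncurry (kernelK Γ)))
    {C : ℝ} (hC : ∀ θ η, ‖kernelK Γ θ η‖ ≤ C * (zeta (θ - η))⁻¹) (k m : Fin 2 → ℤ) :
    Integrable (fun z : (Fin 2 → ℝ) × (Fin 2 → ℝ) =>
      fourierFun k z.2 * (kernelK Γ (z.1 + z.2) z.1 * fourierFun m z.1))
      (squareMeasure.prod squareMeasure) := by
  have h2 := measurable_comp_add hκ
  have h3 (z : (Fin 2 → ℝ) × (Fin 2 → ℝ)) : ‖kernelK Γ (z.1 + z.2) z.1‖ ≤ C * (zeta z.2)⁻¹ := by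
    have := hC (z.1 + z.2) z.1
    rwa [add_sub_cancel_left] at this
  exact integrable_prod_of_norm_le integrable_prod_zeta_inv_snd h2
    ((continuous_fourierFun k).measurable.comp measurable_snd)
    ((continuous_fourierFun m).measurable.comp measurable_fst) h3
    (fun _ => norm_fourierFun_eq _ _) (fun _ => norm_fourierFun_eq _ _)

theorem integral_kernelK_shift (hΓ : Biperiodic Γ) (k l : Fin 2 → ℤ) (η : Fin 2 → ℝ) :
    ∫ θ, fourierFun (-k) θ * (kernelK Γ θ η * fourierFun l η) ∂squareMeasure =
      ∫ t, fourierFun (-k) t * (kernelK Γ (η + t) η * fourierFun (l - k) η) ∂squareMeasure := by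
  have hp : IsBiperiodic fun θ => fourierFun (-k) θ * (kernelK Γ θ η * fourierFun l η) := by
    intro θ i
    simp only [isBiperiodic_fourierFun (-k) θ i, kernelK, hΓ θ i]
  rw [← hp.integral_comp_add η]
  refine integral_congr_ae (Eventually.of_forall fun t => ?_)
  simp only
  rw [mul_left_comm, fourierFun_neg_add_mul]
  ring

/-- Fubini is applied once to bring the θ-integral inside, where periodicity permits the shift by η,
and once more to bring the η-integral inside. -/
theorem entryK_eq_integral (hκ : Measurable (Function.uncurry (kernelK Γ))) (hΓ : Biperiodic Γ)
    {C : ℝ} (hC : ∀ θ η, ‖kernelK Γ θ η‖ ≤ C * (zeta (θ - η))⁻¹) (k l : Fin 2 → ℤ) :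
    entryK Γ k l = ∫ t, fourierFun (-k) t * diagCoef Γ (l - k) t ∂squareMeasure := by
  have h1 := integral_integral_swap
    (f := fun θ η => fourierFun (-k) θ * (kernelK Γ θ η * fourierFun l η))
    (integrable_prod_kernelK hκ hC (-k) l)
  have h2 := integral_integral_swap
    (f := fun η t => fourierFun (-k) t * (kernelK Γ (η + t) η * fourierFun (l - k) η))
    (integrable_prod_shifted_kernelK hκ hC (-k) (l - k))
  rw [entryK_eq_integral_integral hκ hC k l, h1]
  simp only [integral_kernelK_shift hΓ]
  rw [h2]
  simp only [integral_const_mul, diagCoef]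

theorem AssumptionA2.exists_norm_entryK_le (hA2 : AssumptionA2 Γ R₀ γ)
    (hA1 : AssumptionA1 Γ C₀) (hΓ : Biperiodic Γ) {β r : ℝ} (hβ : 0 < β) (hβr : β < r) (hr : r ≤ R₀)
    (hr' : Real.sqrt 2 * r * (M0 R₀ γ * M1 R₀ γ) < C₀ ^ 2) :
    ∃ C, 0 ≤ C ∧ ∀ k l, ‖entryK Γ k l‖ ≤ C * Real.exp (-β * ∑ i, |((k - l) i : ℝ)|) := by
  obtain ⟨C, hC0, hC⟩ := hA2.exists_norm_diagCoef_le hA1 hΓ hβ hβr hr hr'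
  obtain ⟨B, hB⟩ := hA2.exists_norm_kernelK_le hA1 hΓ (hβ.trans hβr) hr hr'
  have hpi := Real.pi_pos
  have h0 : 0 ≤ ∫ t, (zeta t)⁻¹ ∂squareMeasure :=
    integral_nonneg fun t => inv_nonneg.2 (zeta_nonneg t)
  refine ⟨(2 * Real.pi)⁻¹ * C * ∫ t, (zeta t)⁻¹ ∂squareMeasure, by positivity, fun k l => ?_⟩
  rw [entryK_eq_integral hA2.measurable_kernelK hΓ hB]
  have hsymm : ∑ i, |((k - l) i : ℝ)| = ∑ i, |((l - k) i : ℝ)| := by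
    refine Finset.sum_congr rfl fun i _ => ?_
    rw [Pi.sub_apply, Pi.sub_apply, Int.cast_sub, Int.cast_sub, abs_sub_comm]
  rw [hsymm]
  refine (norm_integral_le_of_norm_le (integrable_zeta_inv.const_mul
    ((2 * Real.pi)⁻¹ * (C * Real.exp (-β * ∑ i, |((l - k) i : ℝ)|))))
    (Eventually.of_forall fun t => ?_)).trans_eq ?_
  · rw [norm_mul, norm_fourierFun_eq, mul_assoc]
    gcongr
    exact hC _ t
  · rw [integral_const_mul]
    ring

/-- The frequency vector `k` as a linear form, up to the factor `2π`. -/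
noncomputable def freqForm (k : Fin 2 → ℤ) : StrongDual ℝ (Fin 2 → ℝ) :=
  (2 * Real.pi)⁻¹ • ∑ i, (k i : ℝ) • ContinuousLinearMap.proj i

theorem freqForm_apply (k : Fin 2 → ℤ) (t : Fin 2 → ℝ) :
    freqForm k t = (2 * Real.pi)⁻¹ * ∑ i, (k i : ℝ) * t i := by
  simp only [freqForm, FunLike.coe_smul, Pi.smul_apply, smul_eq_mul, _root_.sum_apply,
    ContinuousLinearMap.proj_apply]

theorem tendsto_freqForm : Tendsto freqForm cofinite (cocompact (StrongDual ℝ (Fin 2 → ℝ))) := by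
  have hpi := Real.two_pi_pos
  have h1 (k : Fin 2 → ℤ) : (2 * Real.pi)⁻¹ * ‖k‖ ≤ ‖freqForm k‖ := by
    rw [inv_mul_le_iff₀ hpi, pi_norm_le_iff_of_nonneg (by positivity)]
    intro i
    have h2 := (freqForm k).le_opNorm (Pi.single i 1)
    rw [freqForm_apply, Pi.norm_single, norm_one, mul_one, norm_mul,
      Real.norm_of_nonneg (by positivity), inv_mul_le_iff₀ hpi] at h2
    refine le_trans (le_of_eq ?_) h2
    simp [Pi.single_apply, Int.norm_eq_abs]
  rw [← Metric.cobounded_eq_cocompact, ← tendsto_norm_atTop_iff_cobounded]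
  refine tendsto_atTop_mono h1 (Tendsto.const_mul_atTop (by positivity) ?_)
  rw [← cocompact_eq_cofinite]
  exact tendsto_norm_cocompact_atTop

theorem fourierFun_neg_eq (k : Fin 2 → ℤ) (t : Fin 2 → ℝ) :
    fourierFun (-k) t = ((2 * Real.pi)⁻¹ : ℝ) * (Real.fourierChar (-freqForm k t) : ℂ) := by
  have hpi := Real.pi_pos.ne'
  have h3 : (1 / Real.sqrt (2 * Real.pi)) * (1 / Real.sqrt (2 * Real.pi)) = (2 * Real.pi)⁻¹ := by
    rw [div_mul_div_comm, Real.mul_self_sqrt Real.two_pi_pos.le]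
    simp
  rw [← h3, Real.fourierChar_apply, freqForm_apply]
  simp only [fourierFun, Fin.sum_univ_two, Fin.prod_univ_two, Pi.neg_apply]
  generalize 1 / Real.sqrt (2 * Real.pi) = c
  rw [mul_mul_mul_comm, ← Complex.exp_add, ← Complex.ofReal_mul]
  congr 2
  push_cast
  field_simp
  ring

/-- On the diagonal l = k - m the factor `diagCoef` no longer depends on k, so the entries are
Fourier coefficients of one fixed function and the Riemann–Lebesgue lemma applies. -/
theorem tendsto_entryK (hκ : Measurable (Function.uncurry (kernelK Γ))) (hΓ : Biperiodic Γ)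
    {C : ℝ} (hC : ∀ θ η, ‖kernelK Γ θ η‖ ≤ C * (zeta (θ - η))⁻¹) (m : Fin 2 → ℤ) :
    Tendsto (fun k => entryK Γ k (k - m)) cofinite (𝓝 0) := by
  have h1 := (tendsto_integral_exp_smul_cocompact (square.indicator (diagCoef Γ (-m)))
    (volume : Measure (Fin 2 → ℝ))).comp tendsto_freqForm
  have h2 := h1.const_mul (((2 * Real.pi)⁻¹ : ℝ) : ℂ)
  rw [mul_zero] at h2
  refine h2.congr fun k => ?_
  have hsq : MeasurableSet square := MeasurableSet.univ_pi fun _ => measurableSet_Ico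
  rw [entryK_eq_integral hκ hΓ hC, sub_sub_cancel_left, Function.comp_apply, ← integral_const_mul,
    ← integral_indicator hsq]
  refine integral_congr_ae (Eventually.of_forall fun t => ?_)
  by_cases ht : t ∈ square
  · simp only [indicator_of_mem ht, fourierFun_neg_eq, Circle.smul_def, smul_eq_mul]
    ring
  · simp only [indicator_of_notMem ht, smul_zero, mul_zero]

end Entries

/-! ### Fourier projections and best approximation in H_p. -/

section Projection

theorem hasSum_norm_fourierCoef_sq (φ : L2Square) :
    HasSum (fun k => ‖fourierCoef k φ‖ ^ 2) (‖φ‖ ^ 2) := by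
  have h := SeqL2.hasSum_norm_sq (fourierHilbertBasis.repr φ)
  simpa only [fourierHilbertBasis_repr, LinearIsometryEquiv.norm_map] using h

theorem hasSum_fourierL2 (φ : L2Square) : HasSum (fun k => fourierCoef k φ • fourierL2 k) φ := by
  have h := fourierHilbertBasis.hasSum_repr φ
  simpa only [fourierHilbertBasis_repr, fourierHilbertBasis_apply] using h

theorem fourierCoef_sub (k : Fin 2 → ℤ) (φ ψ : L2Square) :
    fourierCoef k (φ - ψ) = fourierCoef k φ - fourierCoef k ψ := by
  simp only [fourierCoef_eq_inner, inner_sub_right]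

theorem fourierCoef_sum_fourierL2 (n : ℕ) (c : (Fin 2 → ℤ) → ℂ) (k : Fin 2 → ℤ) :
    fourierCoef k (∑ l ∈ freqBox n, c l • fourierL2 l) = if k ∈ freqBox n then c k else 0 := by
  rw [fourierCoef_eq_inner, inner_sum]
  simp only [inner_smul_right, orthonormal_iff_ite.1 orthonormal_fourierL2, mul_ite, mul_one,
    mul_zero, Finset.sum_ite_eq]

theorem fourierL2_mem_trialSpace {n : ℕ} {k : Fin 2 → ℤ} (hk : k ∈ freqBox n) :
    fourierL2 k ∈ trialSpace n :=
  Submodule.subset_span ⟨k, hk, rfl⟩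

theorem sum_fourierL2_mem_trialSpace (n : ℕ) (c : (Fin 2 → ℤ) → ℂ) :
    ∑ l ∈ freqBox n, c l • fourierL2 l ∈ trialSpace n :=
  Submodule.sum_mem _ fun _ hl => Submodule.smul_mem _ _ (fourierL2_mem_trialSpace hl)

theorem proj_eq_sum (n : ℕ) (φ : L2Square) :
    proj n φ = ∑ k ∈ freqBox n, fourierCoef k φ • fourierL2 k := by
  have hsymm : (trialSpace n).starProjection φ =
      ∑ k ∈ freqBox n, fourierCoef k φ • fourierL2 k := by
    refine Submodule.eq_starProjection_of_mem_orthogonal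
      (sum_fourierL2_mem_trialSpace n fun k => fourierCoef k φ) ?_
    have h : trialSpace n ≤ (Submodule.span ℂ
        {φ - ∑ k ∈ freqBox n, fourierCoef k φ • fourierL2 k})ᗮ := by
      refine Submodule.span_le.2 ?_
      rintro _ ⟨k, hk, rfl⟩
      rw [SetLike.mem_coe, Submodule.mem_orthogonal_singleton_iff_inner_left,
        ← fourierCoef_eq_inner, fourierCoef_sub, fourierCoef_sum_fourierL2,
        if_pos (Finset.mem_coe.1 hk), sub_self]
    rw [Submodule.mem_orthogonal]
    intro u hu
    exact (Submodule.mem_orthogonal_singleton_iff_inner_left).1 (h hu)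
  exact hsymm

theorem fourierCoef_proj (n : ℕ) (φ : L2Square) (k : Fin 2 → ℤ) :
    fourierCoef k (proj n φ) = if k ∈ freqBox n then fourierCoef k φ else 0 := by
  rw [proj_eq_sum, fourierCoef_sum_fourierL2]

theorem proj_mem_trialSpace (n : ℕ) (φ : L2Square) : proj n φ ∈ trialSpace n :=
  Submodule.starProjection_apply_mem _ _

theorem mem_freqBox {n : ℕ} {k : Fin 2 → ℤ} : k ∈ freqBox n ↔ ∀ i, |k i| ≤ n := by
  simp [freqBox, abs_le]

theorem tendsto_proj (φ : L2Square) : Tendsto (fun n => proj n φ) atTop (𝓝 φ) := by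
  have h : Tendsto freqBox atTop atTop := by
    refine tendsto_atTop_finset_of_monotone (fun m n hmn k hk => ?_) fun k => ?_
    · rw [mem_freqBox] at hk ⊢
      exact fun i => (hk i).trans (by exact_mod_cast hmn)
    · refine ⟨∑ i, (k i).natAbs, mem_freqBox.2 fun i => ?_⟩
      rw [Int.abs_eq_natAbs]
      exact_mod_cast Finset.single_le_sum (f := fun i => (k i).natAbs) (fun _ _ => Nat.zero_le _)
        (Finset.mem_univ i)
  simp only [proj_eq_sum]
  exact (hasSum_fourierL2 φ).comp h

theorem norm_sub_proj_le {p : ℕ} {φ : L2Square} (hφ : MemSobolev p φ) (n : ℕ) :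
    ‖φ - proj n φ‖ ≤ (((n : ℝ) + 1) ^ p)⁻¹ * sobolevNorm p φ := by
  have h1 (k : Fin 2 → ℤ) : ‖fourierCoef k (φ - proj n φ)‖ ^ 2 ≤
      ((((n : ℝ) + 1) ^ p)⁻¹) ^ 2 * sobolevTerm p φ k := by
    rw [fourierCoef_sub, fourierCoef_proj, sobolevTerm]
    split_ifs with hk
    · rw [sub_self, norm_zero, zero_pow two_ne_zero]
      positivity
    · rw [sub_zero, ← mul_assoc]
      refine le_mul_of_one_le_left (by positivity) ?_
      rw [mem_freqBox] at hk
      push Not at hk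
      obtain ⟨i, hi⟩ := hk
      -- Outside the box some integer coordinate exceeds n in absolute value, hence is at least n +
      -- 1.
      have h2 : ((n : ℝ) + 1) ^ 2 ≤ 1 + ∑ i, (k i : ℝ) ^ 2 := by
        have h3 : (n : ℝ) + 1 ≤ |(k i : ℝ)| := by exact_mod_cast hi
        have h4 := pow_le_pow_left₀ (by positivity) h3 2
        rw [sq_abs] at h4
        have h5 := Finset.single_le_sum (f := fun i => (k i : ℝ) ^ 2) (fun _ _ => sq_nonneg _)
          (Finset.mem_univ i)
        linarith
      rw [inv_pow, ← pow_mul, mul_comm p, pow_mul, ← inv_pow, ← mul_pow]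
      refine one_le_pow₀ ?_
      rw [inv_mul_eq_div, one_le_div (by positivity)]
      exact h2
  have h2 := hasSum_norm_fourierCoef_sq (φ - proj n φ)
  have h3 := h2.summable.tsum_le_tsum h1 (hφ.mul_left _)
  rw [h2.tsum_eq, tsum_mul_left] at h3
  have h4 : 0 ≤ ∑' k, sobolevTerm p φ k := tsum_nonneg fun k => by
    unfold sobolevTerm
    positivity
  rw [sobolevNorm, ← Real.sqrt_sq (by positivity : 0 ≤ (((n : ℝ) + 1) ^ p)⁻¹), ← Real.sqrt_mul
    (by positivity)]
  exact Real.le_sqrt_of_sq_le h3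

theorem norm_le_sobolevNorm {p : ℕ} {φ : L2Square} (hφ : MemSobolev p φ) :
    ‖φ‖ ≤ sobolevNorm p φ := by
  have h1 (k : Fin 2 → ℤ) : ‖fourierCoef k φ‖ ^ 2 ≤ sobolevTerm p φ k := by
    refine le_mul_of_one_le_left (by positivity) (one_le_pow₀ ?_)
    have : 0 ≤ ∑ i, (k i : ℝ) ^ 2 := by positivity
    linarith
  have h2 := hasSum_norm_fourierCoef_sq φ
  have h3 := h2.summable.tsum_le_tsum h1 hφ
  rw [h2.tsum_eq] at h3
  exact Real.le_sqrt_of_sq_le h3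

theorem sobolevNorm_nonneg (p : ℕ) (φ : L2Square) : 0 ≤ sobolevNorm p φ := Real.sqrt_nonneg _

end Projection

/-! ### The operator norm of the truncation error. -/

section Truncation

variable {Γ : (Fin 2 → ℝ) → Fin 3 → ℝ} {q : ℝ}

/-- The coefficients of `T φ` are given by the matrix of `𝒦`. -/
theorem hasSum_fourierCoef_clm {T : L2Square →L[ℂ] L2Square} (hT : ∀ φ, opK Γ φ = T φ)
    (φ : L2Square) (k : Fin 2 → ℤ) :
    HasSum (fun l => entryK Γ k l * fourierCoef l φ) (fourierCoef k (T φ)) := by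
  have h := (hasSum_fourierL2 φ).mapL ((innerSL ℂ (fourierL2 k)).comp T)
  simp only [ContinuousLinearMap.comp_apply, map_smul, innerSL_apply_apply, smul_eq_mul] at h
  rw [fourierCoef_eq_inner]
  have h' : (fun l => entryK Γ k l * fourierCoef l φ) =
      fun l => fourierCoef l φ * inner ℂ (fourierL2 k) (T (fourierL2 l)) := by
    funext l
    rw [entryK, hT, mul_comm]
  rw [h']
  exact h

/-- The truncated operator as a linear map. -/
noncomputable def truncLinearMap (Γ : (Fin 2 → ℝ) → Fin 3 → ℝ) (q : ℝ) (n : ℕ) :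
    L2Square →ₗ[ℂ] L2Square where
  toFun := truncOp Γ q n
  map_add' φ ψ := by
    simp only [truncOp_eq, fourierCoef_eq_inner, inner_add_right, mul_add, Finset.sum_add_distrib,
      add_smul]
  map_smul' c φ := by
    simp only [truncOp_eq, fourierCoef_eq_inner, inner_smul_right, Finset.smul_sum, smul_smul,
      Finset.mul_sum, RingHom.id_apply, mul_left_comm c]

theorem truncOp_mem_trialSpace (n : ℕ) (φ : L2Square) : truncOp Γ q n φ ∈ trialSpace n := by
  rw [truncOp_eq]
  exact sum_fourierL2_mem_trialSpace n fun k => ∑ l ∈ freqBox n, truncEntry Γ q n k l *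
      fourierCoef l φ

theorem one_le_dof (n : ℕ) : 1 ≤ dof n := by
  refine one_le_pow₀ ?_
  have : (0 : ℝ) ≤ n := Nat.cast_nonneg n
  linarith

/-- The error of the truncation. -/
theorem norm_proj_clm_sub_truncOp_le {T : L2Square →L[ℂ] L2Square} (hT : ∀ φ, opK Γ φ = T φ)
    {C β b : ℝ} (hC : 0 ≤ C) (hb : 0 ≤ b) (hsum : Summable fun m : Fin 2 → ℤ =>
      Real.exp (-(β - b) * ∑ i, |(m i : ℝ)|))
    (hentry : ∀ k l, ‖entryK Γ k l‖ ≤ C * Real.exp (-β * ∑ i, |((k - l) i : ℝ)|)) (n : ℕ)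
    (φ : L2Square) :
    ‖proj n (T (proj n φ)) - truncOp Γ q n φ‖ ≤
      C * Real.exp (-b * (q * Real.log (dof n))) *
        (∑' m : Fin 2 → ℤ, Real.exp (-(β - b) * ∑ i, |(m i : ℝ)|)) * ‖φ‖ := by
  classical
  -- Nonzero entries of E occur only at distance above q ln N. There e^{-βs} splits into e^{-bs}, at
  -- most e^{-b q ln N}, and the factor e^{-(β-b)s}, whose sum over all differences bounds the norm.
  let E (k l : Fin 2 → ℤ) : ℂ :=
    if k ∈ freqBox n ∧ l ∈ freqBox n then entryK Γ k l - truncEntry Γ q n k l else 0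
  have hE (k l : Fin 2 → ℤ) : ‖E k l‖ ≤ C * Real.exp (-b * (q * Real.log (dof n))) *
      Real.exp (-(β - b) * ∑ i, |((k - l) i : ℝ)|) := by
    simp only [E, truncEntry]
    split_ifs with h1 h2
    · rw [sub_self, norm_zero]
      positivity
    · rw [sub_zero]
      refine (hentry k l).trans ?_
      rw [mul_assoc, ← Real.exp_add]
      gcongr
      push Not at h2
      have h3 : ((∑ i, |k i - l i| : ℤ) : ℝ) = ∑ i, |((k - l) i : ℝ)| := by
        push_cast
        simp
      rw [h3] at h2
      have h4 := mul_le_mul_of_nonneg_left h2.le hb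
      linarith
    · rw [norm_zero]
      positivity
  obtain ⟨S, hSn, hS, -⟩ := exists_matrixOperator (A := E) (hsum.mul_left _) hE
  rw [tsum_mul_left] at hSn
  have hkey : fourierHilbertBasis.repr (proj n (T (proj n φ)) - truncOp Γ q n φ) =
      S (fourierHilbertBasis.repr φ) := by
    ext k
    have h1 := hS (fourierHilbertBasis.repr φ) k
    simp only [fourierHilbertBasis_repr] at h1
    rw [fourierHilbertBasis_repr, fourierCoef_sub, fourierCoef_proj, truncOp_eq,
      fourierCoef_sum_fourierL2 n fun k => ∑ l ∈ freqBox n, truncEntry Γ q n k l * fourierCoef l φ]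
    refine HasSum.unique ?_ h1
    split_ifs with hk
    · have h2 := hasSum_fourierCoef_clm hT (proj n φ) k
      have h3 : HasSum (fun l => if l ∈ freqBox n then truncEntry Γ q n k l *
          fourierCoef l φ else 0)
          (∑ l ∈ freqBox n, truncEntry Γ q n k l * fourierCoef l φ) := by
        rw [← Finset.sum_congr rfl fun l (hl : l ∈ freqBox n) => if_pos hl]
        exact hasSum_sum_of_ne_finset_zero fun l hl => if_neg hl
      have h4 : (fun l => E k l * fourierCoef l φ) =
          fun l => entryK Γ k l * fourierCoef l (proj n φ) -
            if l ∈ freqBox n then truncEntry Γ q n k l * fourierCoef l φ else 0 := by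
        funext l
        simp only [E, fourierCoef_proj, hk, true_and]
        split_ifs <;> ring
      rw [h4]
      exact h2.sub h3
    · have : (fun l => E k l * fourierCoef l φ) = fun _ => 0 := by
        ext l
        simp [E, hk]
      rw [this, sub_zero]
      exact hasSum_zero
  rw [← LinearIsometryEquiv.norm_map fourierHilbertBasis.repr, hkey,
    ← LinearIsometryEquiv.norm_map fourierHilbertBasis.repr φ]
  exact S.le_of_opNorm_le hSn _

end Truncation

/-! ### Summability of exponential weights; the Sobolev weight. -/

section ExponentialWeights

theorem summable_exp_neg_mul_abs {δ : ℝ} (hδ : 0 < δ) :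
    Summable fun n : ℤ => Real.exp (-δ * |(n : ℝ)|) := by
  have h : Summable fun n : ℕ => Real.exp (-δ) ^ n :=
    summable_geometric_of_lt_one (Real.exp_nonneg _) (Real.exp_lt_one_iff.2 (neg_neg_of_pos hδ))
  have h' : Summable fun n : ℕ => Real.exp (-δ * (n : ℝ)) := by
    refine h.congr fun n => ?_
    rw [← Real.exp_nat_mul, mul_comm]
  exact Summable.of_nat_of_neg (by simpa using h') (by simpa using h')

theorem summable_exp_neg_mul_sum_abs {δ : ℝ} (hδ : 0 < δ) :
    Summable fun m : Fin 2 → ℤ => Real.exp (-δ * ∑ i, |(m i : ℝ)|) := by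
  have h := (summable_exp_neg_mul_abs hδ).mul_of_nonneg (summable_exp_neg_mul_abs hδ)
    (fun _ => Real.exp_nonneg _) (fun _ => Real.exp_nonneg _)
  refine ((finTwoArrowEquiv ℤ).summable_iff.2 h).congr fun m => ?_
  simp only [Function.comp_apply, finTwoArrowEquiv_apply, Fin.sum_univ_two, mul_add, Real.exp_add]
  rfl

/-- Half of the exponent absorbs the polynomial, by x^p / p! ≤ e^x at x = (β/2)(1 + s); the other
half remains summable. -/
theorem summable_exp_mul_pow {β : ℝ} (hβ : 0 < β) (p : ℕ) :
    Summable fun m : Fin 2 → ℤ => Real.exp (-β * ∑ i, |(m i : ℝ)|) *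
      (2 * (1 + ∑ i, |(m i : ℝ)|)) ^ p := by
  have hδ : 0 < β / 2 := half_pos hβ
  refine Summable.of_nonneg_of_le (fun m => by positivity) (fun m => ?_)
    ((summable_exp_neg_mul_sum_abs hδ).mul_left
      ((2 / (β / 2)) ^ p * p.factorial * Real.exp (β / 2)))
  have hs : 0 ≤ ∑ i, |(m i : ℝ)| := by positivity
  generalize ∑ i, |(m i : ℝ)| = s at hs
  have h1 := Real.pow_div_factorial_le_exp (β / 2 * (1 + s)) (by positivity) p
  rw [div_le_iff₀ (by positivity)] at h1
  have h2 : (2 * (1 + s)) ^ p = (2 / (β / 2)) ^ p * (β / 2 * (1 + s)) ^ p := by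
    rw [← mul_pow]
    congr 1
    field_simp
  calc Real.exp (-β * s) * (2 * (1 + s)) ^ p
      ≤ Real.exp (-β * s) * ((2 / (β / 2)) ^ p * (Real.exp (β / 2 * (1 + s)) * p.factorial)) := by
        rw [h2]
        gcongr
    _ = (2 / (β / 2)) ^ p * p.factorial * (Real.exp (-β * s) * Real.exp (β / 2 * (1 + s))) := by
        ring
    _ = _ := by
        rw [mul_assoc _ (Real.exp (β / 2)), ← Real.exp_add, ← Real.exp_add]
        congr 2
        ring

/-- The weight of the Sobolev norm. -/
noncomputable def sobolevWeight (p : ℕ) (k : Fin 2 → ℤ) : ℝ :=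
  Real.sqrt ((1 + ∑ i, (k i : ℝ) ^ 2) ^ p)

theorem one_le_sobolevWeight (p : ℕ) (k : Fin 2 → ℤ) : 1 ≤ sobolevWeight p k := by
  rw [sobolevWeight, Real.one_le_sqrt]
  refine one_le_pow₀ ?_
  have : 0 ≤ ∑ i, (k i : ℝ) ^ 2 := by positivity
  linarith

/-- A Peetre-type inequality: the weight grows at most polynomially in k - l, which exponential
off-diagonal decay can afford. -/
theorem sobolevWeight_le (p : ℕ) (k l : Fin 2 → ℤ) :
    sobolevWeight p k ≤ (2 * (1 + ∑ i, |((k - l) i : ℝ)|)) ^ p * sobolevWeight p l := by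
  have h : 1 + ∑ i, (k i : ℝ) ^ 2 ≤
      (2 * (1 + ∑ i, |((k - l) i : ℝ)|)) ^ 2 * (1 + ∑ i, (l i : ℝ) ^ 2) := by
    have hk (i : Fin 2) : (k i : ℝ) = l i + ((k - l) i : ℤ) := by
      rw [Pi.sub_apply]
      push_cast
      ring
    simp only [hk, Fin.sum_univ_two]
    generalize ((k - l) 0 : ℝ) = u
    generalize ((k - l) 1 : ℝ) = v
    generalize (l 0 : ℝ) = x
    generalize (l 1 : ℝ) = y
    have h1 : 1 + u ^ 2 + v ^ 2 ≤ (1 + (|u| + |v|)) ^ 2 := by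
      nlinarith [abs_nonneg u, abs_nonneg v, sq_abs u, sq_abs v,
        mul_nonneg (abs_nonneg u) (abs_nonneg v)]
    have h2 : 1 + ((x + u) ^ 2 + (y + v) ^ 2) ≤
        4 * (1 + u ^ 2 + v ^ 2) * (1 + (x ^ 2 + y ^ 2)) := by
      nlinarith [sq_nonneg (x - u), sq_nonneg (y - v), mul_nonneg (sq_nonneg x) (sq_nonneg u),
        mul_nonneg (sq_nonneg x) (sq_nonneg v), mul_nonneg (sq_nonneg y) (sq_nonneg u),
        mul_nonneg (sq_nonneg y) (sq_nonneg v), sq_nonneg x, sq_nonneg y, sq_nonneg u, sq_nonneg v]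
    refine h2.trans ?_
    rw [mul_pow]
    norm_num
    gcongr
  rw [sobolevWeight, sobolevWeight, ← Real.sqrt_sq (by positivity :
    0 ≤ (2 * (1 + ∑ i, |((k - l) i : ℝ)|)) ^ p), ← Real.sqrt_mul (by positivity)]
  refine Real.sqrt_le_sqrt ?_
  rw [← pow_mul, mul_comm p, pow_mul, ← mul_pow]
  gcongr

theorem memSobolev_iff (p : ℕ) (φ : L2Square) : MemSobolev p φ ↔
    Memℓp (fun k => (sobolevWeight p k : ℂ) * fourierHilbertBasis.repr φ k) 2 := by
  rw [memℓp_two_iff, MemSobolev]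
  refine summable_congr fun k => ?_
  rw [fourierHilbertBasis_repr, norm_mul, mul_pow, Complex.norm_real, sobolevWeight,
    Real.norm_of_nonneg (Real.sqrt_nonneg _), Real.sq_sqrt (by positivity), sobolevTerm]

end ExponentialWeights

/-! ### Abstract perturbed Galerkin methods. -/

section Galerkin

variable {E : Type*} [NormedAddCommGroup E] [InnerProductSpace ℂ E] {V : Submodule ℂ E}
  [FiniteDimensional ℂ V] {T : E →L[ℂ] E} {B : E →ₗ[ℂ] E} {c ε : ℝ}

/-- Stability of a perturbed Galerkin method. -/
theorem galerkin_stability (hc : ∀ u, c * ‖u‖ ≤ ‖u - T u‖)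
    (hT : ∀ u, ‖T u - V.starProjection (T u)‖ ≤ c / 4 * ‖u‖)
    (hB : ∀ u, ‖V.starProjection (T (V.starProjection u)) - B u‖ ≤ ε * ‖u‖) (hε : ε ≤ c / 4)
    {u : E} (hu : u ∈ V) : c / 2 * ‖u‖ ≤ ‖u - B u‖ := by
  have h1 := hB u
  rw [Submodule.starProjection_eq_self_iff.2 hu] at h1
  -- Projection and consistency errors cost c/4 each, leaving c/2 of the lower bound for the exact
  -- operator.
  have h2 : u - T u = (u - B u) - (T u - V.starProjection (T u)) -
      (V.starProjection (T u) - B u) := by abel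
  have h3 := hc u
  rw [h2] at h3
  have h4 := norm_sub_le ((u - B u) - (T u - V.starProjection (T u)))
    (V.starProjection (T u) - B u)
  have h5 := norm_sub_le (u - B u) (T u - V.starProjection (T u))
  have h6 := mul_le_mul_of_nonneg_right hε (norm_nonneg u)
  linarith [hT u]

/-- Unique solvability of a stable Galerkin equation. -/
theorem exists_galerkin_solution (hBV : ∀ u, B u ∈ V) (hc : 0 < c)
    (hstab : ∀ u ∈ V, c * ‖u‖ ≤ ‖u - B u‖) {g : E} (hg : g ∈ V) :
    ∃ v, ∀ ψ, ψ ∈ V ∧ ψ - B ψ = g ↔ ψ = v := by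
  have hinj (u : E) (hu : u ∈ V) (h : u - B u = 0) : u = 0 := by
    have h1 := hstab u hu
    rw [h, norm_zero] at h1
    exact norm_le_zero_iff.1 (nonpos_of_mul_nonpos_right h1 hc)
  let A : V →ₗ[ℂ] V := (LinearMap.id - B).restrict fun u hu => V.sub_mem hu (hBV u)
  have hA : Function.Injective A := by
    rw [injective_iff_map_eq_zero]
    intro u hu
    exact Subtype.ext (hinj u u.2 (congrArg Subtype.val hu))
  obtain ⟨v, hv⟩ := LinearMap.surjective_of_injective hA ⟨g, hg⟩
  have hv' : (v : E) - B v = g := congrArg Subtype.val hv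
  refine ⟨v, fun ψ => ⟨fun h => ?_, ?_⟩⟩
  · refine sub_eq_zero.1 (hinj _ (V.sub_mem h.1 v.2) ?_)
    rw [map_sub, sub_sub_sub_comm, h.2, hv', sub_self]
  · rintro rfl
    exact ⟨v.2, hv'⟩

/-- The error of a perturbed Galerkin method is bounded by the errors of best approximation and of
consistency. -/
theorem norm_sub_galerkin_solution_le (hc : 0 < c) (hstab : ∀ u ∈ V, c * ‖u‖ ≤ ‖u - B u‖)
    (hε : 0 ≤ ε) (hB : ∀ u, ‖V.starProjection (T (V.starProjection u)) - B u‖ ≤ ε * ‖u‖)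
    {ρ v g : E} (hρ : ρ - T ρ = g) (hv : v ∈ V) (hv' : v - B v = V.starProjection g) :
    ‖ρ - v‖ ≤ (1 + ‖T‖ / c) * ‖ρ - V.starProjection ρ‖ + ε / c * ‖ρ‖ := by
  set P := V.starProjection with hP
  have hPρ : P ρ ∈ V := Submodule.starProjection_apply_mem _ _
  have hPP : P (P ρ) = P ρ := Submodule.starProjection_eq_self_iff.2 hPρ
  -- Error equation for P ρ - v: the residual is the approximation error passed through T plus the
  -- consistency error at P ρ. Writing P (P ρ) matches the form of `hB`.
  have h1 : (P ρ - v) - B (P ρ - v) = P (T (ρ - P ρ)) + (P (T (P (P ρ))) - B (P ρ)) := by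
    have : P g = P ρ - P (T ρ) := by rw [← hρ, map_sub]
    rw [hPP, map_sub, sub_sub_sub_comm, hv', this, map_sub, map_sub]
    abel
  have h2 := hstab _ (V.sub_mem hPρ hv)
  rw [h1] at h2
  have h3 : ‖P (T (ρ - P ρ))‖ ≤ ‖T‖ * ‖ρ - P ρ‖ :=
    (Submodule.norm_starProjection_apply_le _ _).trans (T.le_opNorm _)
  have h4 : ‖P (T (P (P ρ))) - B (P ρ)‖ ≤ ε * ‖ρ‖ :=
    (hB _).trans (mul_le_mul_of_nonneg_left (Submodule.norm_starProjection_apply_le _ _) hε)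
  have h5 : ‖P ρ - v‖ ≤ (‖T‖ * ‖ρ - P ρ‖ + ε * ‖ρ‖) / c := by
    rw [le_div_iff₀ hc]
    linarith [norm_add_le (P (T (ρ - P ρ))) (P (T (P (P ρ))) - B (P ρ))]
  calc ‖ρ - v‖ ≤ ‖ρ - P ρ‖ + ‖P ρ - v‖ := norm_sub_le_norm_sub_add_norm_sub _ _ _
    _ ≤ ‖ρ - P ρ‖ + (‖T‖ * ‖ρ - P ρ‖ + ε * ‖ρ‖) / c := by gcongr
    _ = _ := by ring

end Galerkin

/-! ### Powers and logarithms of N. -/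

section DegreesOfFreedom

theorem dof_rpow (n p : ℕ) : dof n ^ (-(p : ℝ) / 2) = ((2 * (n : ℝ) + 1) ^ p)⁻¹ := by
  have h : (0 : ℝ) ≤ 2 * n + 1 := by positivity
  rw [dof, ← Real.rpow_natCast _ 2, ← Real.rpow_mul h, ← Real.rpow_natCast, ← Real.rpow_neg h]
  congr 1
  push_cast
  ring

/-- The factor 2^p comes from 2n + 1 ≤ 2(n + 1), converting the projection rate into a power of N.
-/
theorem inv_pow_le_dof_rpow (n p : ℕ) :
    (((n : ℝ) + 1) ^ p)⁻¹ ≤ 2 ^ p * dof n ^ (-(p : ℝ) / 2) := by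
  rw [dof_rpow, ← inv_pow, ← inv_pow, ← mul_pow]
  refine pow_le_pow_left₀ (by positivity) ?_ p
  rw [← div_eq_mul_inv, inv_eq_one_div, div_le_div_iff₀ (by positivity) (by positivity)]
  linarith

theorem exp_neg_mul_log_dof_le {p : ℕ} {b q : ℝ} (h : (p : ℝ) / 2 ≤ q * b) (n : ℕ) :
    Real.exp (-b * (q * Real.log (dof n))) ≤ dof n ^ (-(p : ℝ) / 2) := by
  have h1 : 0 ≤ Real.log (dof n) := Real.log_nonneg (one_le_dof n)
  rw [Real.rpow_def_of_pos (one_pos.trans_le (one_le_dof n))]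
  refine Real.exp_le_exp.2 ?_
  nlinarith

theorem tendsto_dof : Tendsto dof atTop atTop := by
  refine tendsto_atTop_mono (fun n => ?_) tendsto_natCast_atTop_atTop
  have : (0 : ℝ) ≤ n := Nat.cast_nonneg n
  rw [dof]
  nlinarith

theorem tendsto_dof_rpow {p : ℕ} (hp : 1 ≤ p) :
    Tendsto (fun n => dof n ^ (-(p : ℝ) / 2)) atTop (𝓝 0) := by
  have hp' : (0 : ℝ) < p := by exact_mod_cast hp
  have h := (tendsto_rpow_neg_atTop (half_pos hp')).comp tendsto_dof
  simpa only [Function.comp_def, neg_div] using h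

end DegreesOfFreedom

/-! ### Compactness of 𝒦 and Sobolev regularity of the solution. -/

section Operator

variable {Γ : (Fin 2 → ℝ) → Fin 3 → ℝ} {a : (Fin 2 → ℤ) → ℝ} {T : L2Square →L[ℂ] L2Square}

/-- The double layer operator in Fourier coordinates. -/
theorem exists_matrix_of_opK (hT : ∀ φ, opK Γ φ = T φ) (ha : Summable a)
    (hA : ∀ k l, ‖entryK Γ k l‖ ≤ a (k - l))
    (hA0 : ∀ m, Tendsto (fun k => entryK Γ k (k - m)) cofinite (𝓝 0)) :
    ∃ S : SeqL2 (Fin 2 → ℤ) →L[ℂ] SeqL2 (Fin 2 → ℤ),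
      (∀ u k, HasSum (fun l => entryK Γ k l * u l) (S u k)) ∧ IsCompactOperator S ∧
      ∀ φ, fourierHilbertBasis.repr (T φ) = S (fourierHilbertBasis.repr φ) := by
  obtain ⟨S, -, hS, hSc⟩ := exists_matrixOperator ha hA
  refine ⟨S, hS, hSc hA0, fun φ => ?_⟩
  ext k
  have h1 := hS (fourierHilbertBasis.repr φ) k
  simp only [fourierHilbertBasis_repr] at h1
  rw [fourierHilbertBasis_repr]
  exact (hasSum_fourierCoef_clm hT φ k).unique h1

theorem isCompactOperator_of_repr {S : SeqL2 (Fin 2 → ℤ) →L[ℂ] SeqL2 (Fin 2 → ℤ)}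
    (hS : IsCompactOperator S)
    (h : ∀ φ, fourierHilbertBasis.repr (T φ) = S (fourierHilbertBasis.repr φ)) :
    IsCompactOperator T := by
  have h1 := (hS.comp_clm (fourierHilbertBasis.repr.toContinuousLinearEquiv :
    L2Square →L[ℂ] SeqL2 (Fin 2 → ℤ))).clm_comp
    (fourierHilbertBasis.repr.symm.toContinuousLinearEquiv :
      SeqL2 (Fin 2 → ℤ) →L[ℂ] L2Square)
  have h2 : (T : L2Square → L2Square) = fun φ =>
      fourierHilbertBasis.repr.symm (S (fourierHilbertBasis.repr φ)) := by
    funext φ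
    rw [← h, LinearIsometryEquiv.symm_apply_apply]
  rw [h2]
  exact h1

/-- Regularity of the solution of `(𝓘 - 𝒦) ρ = g`. -/
theorem exists_solution_memSobolev {C β : ℝ} (hβ : 0 < β)
    {S : SeqL2 (Fin 2 → ℤ) →L[ℂ] SeqL2 (Fin 2 → ℤ)}
    (hA : ∀ k l, ‖entryK Γ k l‖ ≤ C * Real.exp (-β * ∑ i, |((k - l) i : ℝ)|))
    (hA0 : ∀ m, Tendsto (fun k => entryK Γ k (k - m)) cofinite (𝓝 0))
    (hS : ∀ u k, HasSum (fun l => entryK Γ k l * u l) (S u k))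
    (hTS : ∀ φ, fourierHilbertBasis.repr (T φ) = S (fourierHilbertBasis.repr φ))
    (hinj : Function.Injective fun φ => φ - T φ) {p : ℕ} {g : L2Square} (hg : MemSobolev p g) :
    ∃ ρ, ρ - T ρ = g ∧ MemSobolev p ρ := by
  have hST (u : SeqL2 (Fin 2 → ℤ)) : S u =
      fourierHilbertBasis.repr (T (fourierHilbertBasis.repr.symm u)) := by
    rw [hTS, LinearIsometryEquiv.apply_symm_apply]
  have hinjS : Function.Injective fun u => u - S u := by
    intro u v huv
    refine fourierHilbertBasis.repr.symm.injective (hinj ?_)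
    refine fourierHilbertBasis.repr.injective ?_
    simpa only [hST, map_sub, LinearIsometryEquiv.apply_symm_apply] using huv
  have hsum : Summable fun m : Fin 2 → ℤ => C * Real.exp (-β * ∑ i, |(m i : ℝ)|) *
      (2 * (1 + ∑ i, |(m i : ℝ)|)) ^ p := by
    simpa only [mul_assoc] using (summable_exp_mul_pow hβ p).mul_left C
  -- The solution is constructed directly with weighted coefficients; uniqueness in L₂ later
  -- identifies it as the only solution.
  obtain ⟨y, hy, hyw⟩ := exists_weighted_solution
    (a := fun m : Fin 2 → ℤ => C * Real.exp (-β * ∑ i, |(m i : ℝ)|))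
    (v := fun m : Fin 2 → ℤ => (2 * (1 + ∑ i, |(m i : ℝ)|)) ^ p)
    (one_le_sobolevWeight p) (sobolevWeight_le p) hsum hA hA0 hS hinjS ((memSobolev_iff p g).1 hg)
  refine ⟨fourierHilbertBasis.repr.symm y, ?_, ?_⟩
  · refine fourierHilbertBasis.repr.injective ?_
    rw [map_sub, ← hST, LinearIsometryEquiv.apply_symm_apply, hy]
  · rw [memSobolev_iff, LinearIsometryEquiv.apply_symm_apply]
    exact hyw

end Operator

/-! ### Choice of the radii, consistency, and assembly of the theorem. -/

theorem exists_decay_radii {C R μ b : ℝ} (hb : 0 < b) (hb' : b < min (C ^ 2 / (√2 * μ)) (R / 2)) :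
    ∃ β r, b < β ∧ β < r ∧ r ≤ R ∧ √2 * r * μ < C ^ 2 := by
  -- Two intermediate values: the decay rate β exceeds b so that e^{-(β-b)‖m‖₁} is summable, and the
  -- strip width r exceeds β so that the contour shift stays inside.
  obtain ⟨β, h1, h2⟩ := exists_between hb'
  obtain ⟨r, h3, h4⟩ := exists_between h2
  rw [lt_min_iff] at h4
  refine ⟨β, r, h1, h3, by linarith [h4.2], ?_⟩
  have hr : 0 < r := hb.trans (h1.trans h3)
  -- Were this product zero or negative, the quotient in `hb'` would be at most 0 (division by zero
  -- gives 0), contradicting r > 0.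
  have h5 : 0 < √2 * μ := by
    by_contra h
    have := div_nonpos_of_nonneg_of_nonpos (sq_nonneg C) (not_lt.1 h)
    linarith [h4.1]
  have h6 := (lt_div_iff₀ h5).1 h4.1
  linarith

theorem starProjection_trialSpace (n : ℕ) (φ : L2Square) :
    (trialSpace n).starProjection φ = proj n φ := rfl

theorem truncLinearMap_apply (Γ : (Fin 2 → ℝ) → Fin 3 → ℝ) (q : ℝ) (n : ℕ) (φ : L2Square) :
    truncLinearMap Γ q n φ = truncOp Γ q n φ := rfl

/-- The truncation error is of order `N^{-p/2}`. -/
theorem exists_consistency_error_le {Γ : (Fin 2 → ℝ) → Fin 3 → ℝ} {T : L2Square →L[ℂ] L2Square}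
    (hT : ∀ φ, opK Γ φ = T φ) {C β b q : ℝ} {p : ℕ} (hb : 0 < b) (hbβ : b < β)
    (hqb : (p : ℝ) / 2 ≤ q * b) (hC : 0 ≤ C)
    (hA : ∀ k l, ‖entryK Γ k l‖ ≤ C * Real.exp (-β * ∑ i, |((k - l) i : ℝ)|)) :
    ∃ D, 0 ≤ D ∧ ∀ n φ, ‖proj n (T (proj n φ)) - truncOp Γ q n φ‖ ≤
      D * dof n ^ (-(p : ℝ) / 2) * ‖φ‖ := by
  have hδ : Summable fun m : Fin 2 → ℤ => Real.exp (-(β - b) * ∑ i, |(m i : ℝ)|) :=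
    summable_exp_neg_mul_sum_abs (sub_pos.2 hbβ)
  have hZ : 0 ≤ ∑' m : Fin 2 → ℤ, Real.exp (-(β - b) * ∑ i, |(m i : ℝ)|) :=
    tsum_nonneg fun m => (Real.exp_pos _).le
  refine ⟨C * ∑' m : Fin 2 → ℤ, Real.exp (-(β - b) * ∑ i, |(m i : ℝ)|), mul_nonneg hC hZ,
    fun n φ => ?_⟩
  have h := norm_proj_clm_sub_truncOp_le (q := q) hT hC hb.le hδ hA n φ
  generalize ∑' m : Fin 2 → ℤ, Real.exp (-(β - b) * ∑ i, |(m i : ℝ)|) = Z at hZ h ⊢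
  refine h.trans (mul_le_mul_of_nonneg_right ?_ (norm_nonneg φ))
  rw [mul_right_comm C Z]
  exact mul_le_mul_of_nonneg_right
    (mul_le_mul_of_nonneg_left (exp_neg_mul_log_dof_le hqb n) hC) hZ

/-- Stability and convergence of the fast method when the entries of the matrix decay
exponentially. -/
theorem stability_and_convergence {Γ : (Fin 2 → ℝ) → Fin 3 → ℝ} {T : L2Square →L[ℂ] L2Square}
    (hT : ∀ φ, opK Γ φ = T φ) (hinj : Function.Injective fun φ => φ - T φ) {C β b q : ℝ} {p : ℕ}
    (hp : 1 ≤ p) (hb : 0 < b) (hbβ : b < β) (hqb : (p : ℝ) / 2 ≤ q * b) (hC : 0 ≤ C)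
    (hA : ∀ k l, ‖entryK Γ k l‖ ≤ C * Real.exp (-β * ∑ i, |((k - l) i : ℝ)|))
    (hA0 : ∀ m, Tendsto (fun k => entryK Γ k (k - m)) cofinite (𝓝 0)) :
    ∃ c : ℝ, 0 < c ∧ ∃ n₀ : ℕ,
      (∀ n ≥ n₀, ∀ φ : L2Square, MemSobolev p φ →
        c * ‖proj n φ‖ ≤ ‖proj n φ - truncOp Γ q n (proj n φ)‖) ∧
      (∀ φ : L2Square, MemSobolev p φ → ∃ n₁ : ℕ, ∀ n ≥ n₁,
        c * ‖φ‖ ≤ ‖proj n φ - truncOp Γ q n (proj n φ)‖) ∧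
      (∀ g : L2Square, MemSobolev p g →
        ∃ ρ : L2Square, (∀ ψ : L2Square, ψ - opK Γ ψ = g ↔ ψ = ρ) ∧ MemSobolev p ρ ∧
          ∀ n ≥ n₀, ∃ ρt : L2Square, (∀ ψ : L2Square, IsFastSolution Γ q n g ψ ↔ ψ = ρt) ∧
            ‖ρ - ρt‖ ≤ c * dof n ^ (-(p : ℝ) / 2) * Real.log (dof n) * sobolevNorm p ρ) := by
  have hβ : 0 < β := hb.trans hbβ
  simp only [hT]
  obtain ⟨S, hS, hSc, hTS⟩ := exists_matrix_of_opK hT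
    ((summable_exp_neg_mul_sum_abs hβ).mul_left C) hA hA0
  have hTc : IsCompactOperator T := isCompactOperator_of_repr hSc hTS
  obtain ⟨-, c, hc, hcT⟩ := FastFourierGalerkin.IsCompactOperator.bijective_one_sub hTc hinj
  obtain ⟨D, hD, hB⟩ := exists_consistency_error_le hT hb hbβ hqb hC hA
  have hN (n : ℕ) : 0 ≤ dof n ^ (-(p : ℝ) / 2) :=
    Real.rpow_nonneg (zero_le_one.trans (one_le_dof n)) _
  let K : ℝ := (1 + ‖T‖ / (c / 2)) * 2 ^ p + D / (c / 2)
  have hev1 := FastFourierGalerkin.IsCompactOperator.tendsto_norm_sub_comp hTc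
    (P := fun n => (trialSpace n).starProjection)
    (fun n => Submodule.starProjection_norm_le _) tendsto_proj
    (by positivity : 0 < c / 4)
  have hev2 : ∀ᶠ n in atTop, D * dof n ^ (-(p : ℝ) / 2) ≤ c / 4 := by
    have h := (tendsto_dof_rpow hp).const_mul D
    rw [mul_zero] at h
    exact h.eventually_le_const (by positivity)
  -- The true constant K of the error bound is traded for (c/4) ln N, so that the small stability
  -- constant c/4 also serves in the convergence estimate.
  have hev3 : ∀ᶠ n in atTop, K ≤ c / 4 * Real.log (dof n) :=
    ((Real.tendsto_log_atTop.comp tendsto_dof).const_mul_atTop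
      (by positivity : 0 < c / 4)).eventually_ge_atTop K
  obtain ⟨n₀, hn₀⟩ := eventually_atTop.1 (hev1.and (hev2.and hev3))
  have hB' (n : ℕ) (u : L2Square) : ‖(trialSpace n).starProjection
      (T ((trialSpace n).starProjection u)) - truncLinearMap Γ q n u‖ ≤
      D * dof n ^ (-(p : ℝ) / 2) * ‖u‖ := by
    rw [truncLinearMap_apply, starProjection_trialSpace, starProjection_trialSpace]
    exact hB n u
  have hstab (n : ℕ) (hn : n ≥ n₀) (u : L2Square) (hu : u ∈ trialSpace n) :
      c / 2 * ‖u‖ ≤ ‖u - truncLinearMap Γ q n u‖ :=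
    galerkin_stability hcT (hn₀ n hn).1 (hB' n) (hn₀ n hn).2.1 hu
  refine ⟨c / 4, by positivity, n₀, fun n hn φ _ => ?_, fun φ _ => ?_, fun g hg => ?_⟩
  · refine le_trans ?_ (hstab n hn _ (proj_mem_trialSpace n φ))
    gcongr
    norm_num
  -- Stability holds with c/2 on the trial space; the spare factor 1/2 pays for replacing the
  -- projection of φ by φ, from an index depending on φ.
  · have h : ∀ᶠ n in atTop, 1 / 2 * ‖φ‖ ≤ ‖proj n φ‖ := by
      rcases eq_or_ne φ 0 with rfl | hφ
      · simp
      · refine (tendsto_proj φ).norm.eventually_const_le ?_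
        linarith [norm_pos_iff.2 hφ]
    obtain ⟨n₁, hn₁⟩ := eventually_atTop.1 h
    refine ⟨max n₀ n₁, fun n hn => ?_⟩
    refine le_trans ?_ (hstab n (le_of_max_le_left hn) _ (proj_mem_trialSpace n φ))
    have := mul_le_mul_of_nonneg_left (hn₁ n (le_of_max_le_right hn)) (half_pos hc).le
    linarith
  · obtain ⟨ρ, hρ, hρp⟩ := exists_solution_memSobolev hβ hA hA0 hS hTS hinj hg
    refine ⟨ρ, fun ψ => ⟨fun h => hinj (h.trans hρ.symm), fun h => h ▸ hρ⟩, hρp, fun n hn => ?_⟩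
    obtain ⟨v, hv⟩ := exists_galerkin_solution (B := truncLinearMap Γ q n)
      (truncOp_mem_trialSpace n) (half_pos hc) (hstab n hn) (proj_mem_trialSpace n g)
    refine ⟨v, hv, ?_⟩
    have hv' := (hv v).2 rfl
    have h1 := norm_sub_galerkin_solution_le (half_pos hc) (hstab n hn)
      (mul_nonneg hD (hN n)) (hB' n) hρ hv'.1 hv'.2
    have h2 : ‖ρ - proj n ρ‖ ≤ 2 ^ p * dof n ^ (-(p : ℝ) / 2) * sobolevNorm p ρ :=
      (norm_sub_proj_le hρp n).trans
        (mul_le_mul_of_nonneg_right (inv_pow_le_dof_rpow n p) (sobolevNorm_nonneg p ρ))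
    have h3 := norm_le_sobolevNorm hρp
    have h4 : 0 ≤ dof n ^ (-(p : ℝ) / 2) * sobolevNorm p ρ :=
      mul_nonneg (hN n) (sobolevNorm_nonneg p ρ)
    calc ‖ρ - v‖ ≤ (1 + ‖T‖ / (c / 2)) * ‖ρ - proj n ρ‖ +
          D * dof n ^ (-(p : ℝ) / 2) / (c / 2) * ‖ρ‖ := h1
      _ ≤ (1 + ‖T‖ / (c / 2)) * (2 ^ p * dof n ^ (-(p : ℝ) / 2) * sobolevNorm p ρ) +
          D * dof n ^ (-(p : ℝ) / 2) / (c / 2) * sobolevNorm p ρ := by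
        have := hN n
        gcongr
      _ = K * (dof n ^ (-(p : ℝ) / 2) * sobolevNorm p ρ) := by
        simp only [K]
        ring
      _ ≤ c / 4 * Real.log (dof n) * (dof n ^ (-(p : ℝ) / 2) * sobolevNorm p ρ) :=
        mul_le_mul_of_nonneg_right (hn₀ n hn).2.2 h4
      _ = _ := by ring

end FastFourierGalerkin

theorem mainTheorem1 (p : ℕ) (hp : 1 ≤ p)
    (Γ : (Fin 2 → ℝ) → Fin 3 → ℝ) (hΓ : Biperiodic Γ)
    (C₀ : ℝ) (hA1 : AssumptionA1 Γ C₀)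
    (R₀ : ℝ) (γ : Fin 3 → EuclideanSpace ℂ (Fin 2) → ℂ) (hA2 : AssumptionA2 Γ R₀ γ)
    (hinj : Function.Injective fun φ : L2Square => φ - opK Γ φ)
    (b : ℝ) (hb : 0 < b)
    (hb' : b < min (C₀ ^ 2 / (Real.sqrt 2 * M0 R₀ γ * M1 R₀ γ)) (R₀ / 2))
    (q : ℝ) (hq : 0 < q) (hqb : (p : ℝ) / 2 ≤ q * b) :
    -- the operator `𝒦` is well defined on `L₂`
    (∀ φ : L2Square,
      (∀ᵐ θ ∂squareMeasure, Integrable (fun η => kernelK Γ θ η * φ η) squareMeasure) ∧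
      opK Γ φ =ᵐ[squareMeasure] kernelIntegral (kernelK Γ) φ) ∧
    ∃ c : ℝ, 0 < c ∧ ∃ n₀ : ℕ,
      -- stability, uniformly in `φ`
      (∀ n ≥ n₀, ∀ φ : L2Square, MemSobolev p φ →
        c * ‖proj n φ‖ ≤ ‖proj n φ - truncOp Γ q n (proj n φ)‖) ∧
      -- stability with `‖φ‖` on the other side, for `n` large depending on `φ`
      (∀ φ : L2Square, MemSobolev p φ → ∃ n₁ : ℕ, ∀ n ≥ n₁,
        c * ‖φ‖ ≤ ‖proj n φ - truncOp Γ q n (proj n φ)‖) ∧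
      -- unique solvability and convergence
      (∀ g : L2Square, MemSobolev p g →
        ∃ ρ : L2Square, (∀ ψ : L2Square, ψ - opK Γ ψ = g ↔ ψ = ρ) ∧ MemSobolev p ρ ∧
          ∀ n ≥ n₀, ∃ ρt : L2Square, (∀ ψ : L2Square, IsFastSolution Γ q n g ψ ↔ ψ = ρt) ∧
            ‖ρ - ρt‖ ≤ c * dof n ^ (-(p : ℝ) / 2) * Real.log (dof n) * sobolevNorm p ρ) := by
  rw [mul_assoc] at hb'
  obtain ⟨β, r, hbβ, hβr, hr, hr'⟩ := exists_decay_radii hb hb'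
  have hβ : 0 < β := hb.trans hbβ
  obtain ⟨CK, hCK⟩ := hA2.exists_norm_kernelK_le hA1 hΓ (hβ.trans hβr) hr hr'
  refine ⟨fun φ => ⟨integrable_of_weaklySingular hA2.measurable_kernelK hCK φ,
    integralOp_ae_eq hA2.measurable_kernelK hCK φ⟩, ?_⟩
  obtain ⟨T, hT⟩ : ∃ T : L2Square →L[ℂ] L2Square, ∀ φ, opK Γ φ = T φ :=
    exists_clm_integralOp hA2.measurable_kernelK hCK
  obtain ⟨C, hC, hA⟩ := hA2.exists_norm_entryK_le hA1 hΓ hβ hβr hr hr'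
  have hinj' : Function.Injective fun φ => φ - T φ := by simpa only [hT] using hinj
  exact stability_and_convergence hT hinj' hp hb hbβ hqb hC hA
    (tendsto_entryK hA2.measurable_kernelK hΓ hCK)
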